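/- **Setting.** For $z=(x,\xi)\in\mathbb R^{2d}$ let $\pi(z)f(t)=e^{2\pi i\xi\cdot t}f(t-x)$, $V_gf(z)=\langle f,\pi(z)g\rangle$, and $W(f,h)(x,\xi)=\int f(x+\tfrac t2)\overline{h(x-\tfrac t2)}e^{-2\pi i t\cdot\xi}\,dt$. Put $j(\zeta_1,\zeta_2)=(\zeta_2,-\zeta_1)$. Brackets are sesquilinear. For $\sigma\in\mathcal S'(\mathbb R^{2d})$ the Weyl transform $\sigma^w$ is defined by $\langle\sigma^wf,h\rangle=\langle\sigma,W(h,f)\rangle$ for $f,h\in\mathcal S(\mathbb R^d)$. Let $\Lambda\subset\mathbb R^{2d}$ be a lattice and $C$ a relatively compact fundamental domain of $\Lambda$ that contains $0$ and meets every neighbourhood of $0$ in a set of positive measure. A *solid Banach space* of sequences on $\Lambda$ is a Banach space $\mathcal Y$ of sequences such that $|a|\le|b|$ pointwise and $b\in\mathcal Y$ imply $a\in\mathcal Y$ and $\|a\|_{\mathcal Y}\le\|b\|_{\mathcal Y}$. Let $\mathcal A$ be a solid Banach space of sequences on $\Lambda$ that contains the finitely supported sequences and is an involutive Banach algebra with respect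 to (absolutely convergent) convolution: $\|a*b\|_{\mathcal A}\le\|a\|_{\mathcal A}\|b\|_{\mathcal A}$, and $\|a^*\|_{\mathcal A}\le\|a\|_{\mathcal A}$ with $a^*(\lambda)=\overline{a(-\lambda)}$. For a function $F$ on $\mathbb R^{2d}$ let $\|F\|_{W(\mathcal A)}$ be the $\mathcal A$-norm of the sequence $\lambda\mapsto\operatorname{ess\,sup}_{\lambda+C}|F|$ ($\infty$ if that sequence is not in $\mathcal A$). For a matrix $A$ on $\Lambda$ let $\|A\|_{\mathcal C_{\mathcal A}}=\|d_A\|_{\mathcal A}$ with $d_A(\mu)=\sup_\lambda|a_{\lambda,\lambda-\mu}|$. Let $g\in L^2(\mathbb R^d)$ be such that $V_gg\in W(\mathcal A)$ and $\{\pi(\lambda)g:\lambda\in\Lambda\}$ is a tight frame with constant $1$, i.e. $\|f\|_2^2=\sum_{\lambda\in\Lambda}|\langle f,\pi(\lambda)g\rangle|^2$ for all $f\in L^2(\mathbb R^d)$. For a window $\Phi$ on $\mathbb R^{2d}$ let $\mathcal V_\Phi\sigma(z,\zeta)=\langle\sigma,M_\zeta T_z\Phi\rangle$ be the short-time Fourier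 transform of $\sigma$, where $M_\zeta T_z\Phi(w)=e^{2\pi i\zeta\cdot w}\Phi(w-z)$, and $\mathcal G_\Phi(\sigma)(\zeta)=\operatorname{ess\,sup}_z|\mathcal V_\Phi\sigma(z,\zeta)|$. The symbol class $\widetilde M^{\infty,\mathcal A}$ consists of all $\sigma\in\mathcal S'(\mathbb R^{2d})$ with $\|\mathcal G_\Psi(\sigma)\circ j\|_{W(\mathcal A)}<\infty$, where $\Psi(z)=e^{-\pi z\cdot z/2}$. For $\sigma$ in this class, the bracket $\langle\sigma,F\rangle$ with a function $F\in M^1(\mathbb R^{2d})$ (that is, $\mathcal V_\Psi F\in L^1$) that is not a Schwartz function is understood as the duality of $M^\infty$ and $M^1$, $\langle\sigma,F\rangle=\iint\mathcal V_\Psi\sigma\,\overline{\mathcal V_\Psi F}\,dz\,d\zeta$. Let $\|\sigma\|_{\widetilde M^{\infty,\mathcal A}}=\|\mathcal G_{W(g,g)}(\sigma)\circ j\|_{W(\mathcal A)}$ be the norm with respect to the window $W(g,g)$, and let $M(\sigma)$ be the matrix with entries $M(\sigma)_{\lambda,\mu}=\langle\sigma^w\pi(\mu)g,\pi(\lambda)g\rangle=\langle\sigma,W(\pi(\lambda)g,\pi(\mu)g)\rangle$,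 $\lambda,\mu\in\Lambda$. For a solid Banach space $\mathcal Y$ of sequences on $\Lambda$ that contains the finitely supported sequences as a dense subspace, $M(\mathcal Y)$ is the completion of $\mathcal L_0=\operatorname{span}\{\pi(\lambda)g:\lambda\in\Lambda\}$ with respect to the norm $\|f\|_{M(\mathcal Y)}=\|(\langle f,\pi(\lambda)g\rangle)_{\lambda\in\Lambda}\|_{\mathcal Y}$. **Theorem.** There is a constant $C_0$ (depending only on $\mathcal A,C,g$) such that every $\sigma\in\widetilde M^{\infty,\mathcal A}$ satisfies $$\|M(\sigma)\|_{\mathcal C_{\mathcal A}}\le\|\sigma\|_{\widetilde M^{\infty,\mathcal A}}\le C_0\,\|\mathcal G_\Psi(\sigma)\circ j\|_{W(\mathcal A)}<\infty ,$$ and the following hold. 1. $\sigma^w$ extends to a bounded operator on $L^2(\mathbb R^d)$ with $\|\sigma^w\|_{L^2\to L^2}\le\|M(\sigma)\|_{\mathcal C_{\mathcal A}}$, and $M(\sigma)_{\lambda,\mu}=\langle\sigma^w\pi(\mu)g,\pi(\lambda)g\rangle$ for this extension. 2. Let $\mathcal Y$ be as above, and suppose that $\mathcal A$ acts boundedly on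 $\mathcal Y$ by convolution: for some $K\ge0$ the convolution $a*c$ converges absolutely, belongs to $\mathcal Y$, and $\|a*c\|_{\mathcal Y}\le K\|a\|_{\mathcal A}\|c\|_{\mathcal Y}$ for all $a\in\mathcal A$, $c\in\mathcal Y$. Then the norm of $M(\mathcal Y)$ is finite on $\mathcal L_0$, $\sigma^w$ maps $\mathcal L_0$ into $M(\mathcal Y)$ (an element $h$ of $L^2$ being regarded as an element of $M(\mathcal Y)$ if its coefficient sequence $(\langle h,\pi(\lambda)g\rangle)_\lambda$ is a limit in $\mathcal Y$ of coefficient sequences of elements of $\mathcal L_0$), and $\sigma^w$ extends to a bounded operator on $M(\mathcal Y)$ with $$\|\sigma^w\|_{M(\mathcal Y)\to M(\mathcal Y)}\le K\,\|M(\sigma)\|_{\mathcal C_{\mathcal A}}\le K\,\|\sigma\|_{\widetilde M^{\infty,\mathcal A}} .$$ In particular, for $K=1$, $\|\sigma^w\|_{M(\mathcal Y)\to M(\mathcal Y)}\le\|M(\sigma)\|_{\mathcal C_{\mathcal A}}\le\|\sigma\|_{\widetilde M^{\infty,\mathcal A}}$. -/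

import Mathlib

open MeasureTheory Filter Topology SchwartzMap
open scoped ENNReal NNReal ContDiff ComplexConjugate

noncomputable section

namespace WeylGabor

/-- The space `ℝᵈ`. -/
abbrev Eu (d : ℕ) : Type := EuclideanSpace ℝ (Fin d)
/-- The phase space `ℝ²ᵈ`, with elements `z = (x, ξ)`. -/
abbrev Phase (d : ℕ) : Type := Eu d × Eu d

/-- The dot product on `ℝ²ᵈ`. -/
def phaseDot {d : ℕ} (ζ z : Phase d) : ℝ := inner ℝ ζ.1 z.1 + inner ℝ ζ.2 z.2

theorem hasTemperateGrowth_cexp_I :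
    (fun s : ℝ => Complex.exp (2 * Real.pi * Complex.I * s)).HasTemperateGrowth := by
  have hder : ∀ n : ℕ, iteratedDeriv n (fun s : ℝ => Complex.exp (2 * Real.pi * Complex.I * s))
      = fun s : ℝ => (2 * Real.pi * Complex.I) ^ n * Complex.exp (2 * Real.pi * Complex.I * s) := by
    intro n
    induction n with
    | zero => simp
    | succ n ih =>
      rw [iteratedDeriv_succ, ih]
      funext s
      have h1 : HasDerivAt (fun s : ℝ => 2 * Real.pi * Complex.I * (s : ℂ))
          (2 * Real.pi * Complex.I) s := by
        simpa using (Complex.ofRealCLM.hasDerivAt (x := s)).const_mul (2 * Real.pi * Complex.I)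
      rw [(h1.cexp.const_mul _).deriv]
      ring
  refine ⟨?_, fun n => ⟨0, ‖(2 * Real.pi * Complex.I : ℂ) ^ n‖, fun s => ?_⟩⟩
  · exact (contDiff_const.mul Complex.ofRealCLM.contDiff).cexp
  · rw [norm_iteratedFDeriv_eq_norm_iteratedDeriv, hder, norm_mul]
    have : ‖Complex.exp (2 * Real.pi * Complex.I * s)‖ = 1 := by
      rw [show (2 * Real.pi * Complex.I * s : ℂ) = ((2 * Real.pi * s : ℝ) : ℂ) * Complex.I by
        push_cast; ring]
      exact Complex.norm_exp_ofReal_mul_I _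
    simp [this]

theorem hasTemperateGrowth_phaseDot {d : ℕ} (ζ : Phase d) :
    (fun z : Phase d => phaseDot ζ z).HasTemperateGrowth := by
  have : (fun z : Phase d => phaseDot ζ z) =
      ⇑((innerSL ℝ ζ.1).comp (ContinuousLinearMap.fst ℝ (Eu d) (Eu d)) +
        (innerSL ℝ ζ.2).comp (ContinuousLinearMap.snd ℝ (Eu d) (Eu d))) := by
    funext z; simp [phaseDot]
  rw [this]
  exact ContinuousLinearMap.hasTemperateGrowth _

/-- The character `e^{2 π i ζ · z}` of `ℝ²ᵈ`. -/
def phaseChar {d : ℕ} (ζ z : Phase d) : ℂ := Complex.exp (2 * Real.pi * Complex.I * phaseDot ζ z)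

theorem hasTemperateGrowth_phaseChar {d : ℕ} (ζ : Phase d) :
    (phaseChar ζ).HasTemperateGrowth :=
  hasTemperateGrowth_cexp_I.comp (hasTemperateGrowth_phaseDot ζ)

theorem hasTemperateGrowth_gaussExponent (d : ℕ) :
    (fun z : Phase d => -(Real.pi / 2) * phaseDot z z).HasTemperateGrowth := by
  have h1 : (fun z : Phase d => ‖z.1‖ ^ 2).HasTemperateGrowth :=
    (Function.hasTemperateGrowth_norm_sq (H := Eu d)).comp
      (ContinuousLinearMap.fst ℝ (Eu d) (Eu d)).hasTemperateGrowth
  have h2 : (fun z : Phase d => ‖z.2‖ ^ 2).HasTemperateGrowth :=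
    (Function.hasTemperateGrowth_norm_sq (H := Eu d)).comp
      (ContinuousLinearMap.snd ℝ (Eu d) (Eu d)).hasTemperateGrowth
  have : (fun z : Phase d => -(Real.pi / 2) * phaseDot z z) =
      (fun z : Phase d => -(Real.pi / 2) * (‖z.1‖ ^ 2 + ‖z.2‖ ^ 2)) := by
    funext z; simp [phaseDot]
  rw [this]
  exact (Function.HasTemperateGrowth.const _).mul (h1.add h2)

theorem norm_sq_le_phaseDot {d : ℕ} (z : Phase d) : ‖z‖ ^ 2 ≤ phaseDot z z := by
  have : phaseDot z z = ‖z.1‖ ^ 2 + ‖z.2‖ ^ 2 := by simp [phaseDot]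
  rw [this, Prod.norm_def]
  rcases max_cases ‖z.1‖ ‖z.2‖ with ⟨h, _⟩ | ⟨h, _⟩ <;> rw [h] <;> nlinarith [sq_nonneg ‖z.1‖, sq_nonneg ‖z.2‖]

theorem pow_mul_exp_bound (m : ℕ) :
    ∃ B : ℝ, ∀ r : ℝ, 0 ≤ r → (1 + r) ^ m * Real.exp (-(Real.pi / 2) * r ^ 2) ≤ B := by
  refine ⟨m.factorial * Real.exp 2, fun r hr => ?_⟩
  have h1 : (1 + r) ^ m ≤ m.factorial * Real.exp (1 + r) := by
    have := Real.pow_div_factorial_le_exp (1 + r) (by positivity) m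
    rwa [div_le_iff₀ (by positivity), mul_comm] at this
  calc _ ≤ (m.factorial * Real.exp (1 + r)) * Real.exp (-(Real.pi / 2) * r ^ 2) := by gcongr
    _ = m.factorial * Real.exp (1 + r + -(Real.pi / 2) * r ^ 2) := by rw [mul_assoc, ← Real.exp_add]
    _ ≤ _ := by
      gcongr
      nlinarith [Real.pi_gt_three, sq_nonneg (r - 1), sq_nonneg r, mul_nonneg (sub_nonneg.2 Real.pi_gt_three.le) (sq_nonneg r)]

/-- The Gaussian `Ψ(z) = e^{-π z · z / 2}` on `ℝ²ᵈ`. -/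
def gaussian (d : ℕ) : 𝓢(Phase d, ℂ) where
  toFun z := (Real.exp (-(Real.pi / 2) * phaseDot z z) : ℂ)
  smooth' := Complex.ofRealCLM.contDiff.comp
    (Real.contDiff_exp.comp (hasTemperateGrowth_gaussExponent d).1)
  decay' := by
    intro k n
    obtain ⟨l, C, hC, hg⟩ := (hasTemperateGrowth_gaussExponent d).norm_iteratedFDeriv_le_uniform n
    obtain ⟨B, hB⟩ := pow_mul_exp_bound (k + l * n)
    refine ⟨n.factorial * (C + 1) ^ n * B, fun z => ?_⟩
    have hexp : ContDiff ℝ ∞ (fun s : ℝ => (Real.exp s : ℂ)) :=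
      Complex.ofRealCLM.contDiff.comp Real.contDiff_exp
    have hid : ∀ i : ℕ, iteratedDeriv i (fun s : ℝ => (Real.exp s : ℂ)) =
        fun s : ℝ => (Real.exp s : ℂ) := by
      intro i
      induction i with
      | zero => simp
      | succ i ih =>
        rw [iteratedDeriv_succ, ih]
        funext s
        exact (Real.hasDerivAt_exp s).ofReal_comp.deriv
    have key := norm_iteratedFDeriv_comp_le (n := n) hexp (hasTemperateGrowth_gaussExponent d).1
      (mod_cast le_top) z (C := Real.exp (-(Real.pi / 2) * phaseDot z z))
      (D := (C + 1) * (1 + ‖z‖) ^ l)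
      (by
        intro i _
        rw [norm_iteratedFDeriv_eq_norm_iteratedDeriv, hid, Complex.norm_real,
          Real.norm_of_nonneg (Real.exp_pos _).le])
      (by
        intro i hi1 hi
        refine (hg i hi z).trans ?_
        rw [mul_pow]
        gcongr
        · exact (by linarith : C ≤ C + 1).trans (le_self_pow₀ (by linarith) (by omega))
        · exact le_self_pow₀ (one_le_pow₀ (by simp)) (by omega))
    change ‖z‖ ^ k * ‖iteratedFDeriv ℝ n ((fun s : ℝ => (Real.exp s : ℂ)) ∘
      fun z : Phase d => -(Real.pi / 2) * phaseDot z z) z‖ ≤ _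
    have hz : ‖z‖ ^ k ≤ (1 + ‖z‖) ^ k := pow_le_pow_left₀ (norm_nonneg _) (by linarith) _
    have he : Real.exp (-(Real.pi / 2) * phaseDot z z) ≤ Real.exp (-(Real.pi / 2) * ‖z‖ ^ 2) := by
      apply Real.exp_le_exp.2
      nlinarith [norm_sq_le_phaseDot z, Real.pi_pos]
    calc _ ≤ (1 + ‖z‖) ^ k * (n.factorial * Real.exp (-(Real.pi / 2) * ‖z‖ ^ 2) *
          ((C + 1) * (1 + ‖z‖) ^ l) ^ n) := by
            gcongr
            refine key.trans ?_
            gcongr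
      _ = n.factorial * (C + 1) ^ n *
          ((1 + ‖z‖) ^ (k + l * n) * Real.exp (-(Real.pi / 2) * ‖z‖ ^ 2)) := by
            rw [mul_pow, pow_add, pow_mul]; ring
      _ ≤ _ := by
            gcongr
            exact hB _ (norm_nonneg _)

/-- Pointwise complex conjugation. -/
def schwartzConj {d : ℕ} (F : 𝓢(Phase d, ℂ)) : 𝓢(Phase d, ℂ) :=
  SchwartzMap.postcompCLM (𝕜 := ℝ) (Complex.conjCLE : ℂ →L[ℝ] ℂ) F

theorem schwartzConj_apply {d : ℕ} (F : 𝓢(Phase d, ℂ)) (z : Phase d) :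
    schwartzConj F z = conj (F z) := rfl

/-- The time-frequency shift `M_ζ T_z F` of a Schwartz function on `ℝ²ᵈ`. -/
def schwartzPhaseShift {d : ℕ} (z ζ : Phase d) (F : 𝓢(Phase d, ℂ)) : 𝓢(Phase d, ℂ) :=
  SchwartzMap.smulLeftCLM ℂ (phaseChar ζ) (SchwartzMap.compSubConstCLM ℂ z F)

theorem schwartzPhaseShift_apply {d : ℕ} (z ζ : Phase d) (F : 𝓢(Phase d, ℂ)) (w : Phase d) :
    schwartzPhaseShift z ζ F w = phaseChar ζ w * F (w - z) := by
  simp [schwartzPhaseShift, SchwartzMap.smulLeftCLM_apply_apply (hasTemperateGrowth_phaseChar ζ)]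

section PartialFourier

variable {d : ℕ} {F : Type} [NormedAddCommGroup F] [NormedSpace ℂ F]

/-- The Fourier transform in the second variable. -/
def partialFourier (G : 𝓢(Phase d, F)) (z : Phase d) : F :=
  ∫ t : Eu d, Complex.exp (-2 * Real.pi * Complex.I * inner ℝ t z.2) • G (z.1, t)

theorem norm_phase (a : ℝ) : ‖Complex.exp (-2 * Real.pi * Complex.I * a)‖ = 1 := by
  rw [show (-2 * Real.pi * Complex.I * a : ℂ) = ((-2 * Real.pi * a : ℝ) : ℂ) * Complex.I by
    push_cast; ring]
  exact Complex.norm_exp_ofReal_mul_I _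

theorem exists_slice_bound (G : 𝓢(Phase d, F)) (k : ℕ) : ∃ C : ℝ, 0 ≤ C ∧ ∀ (x t : Eu d),
    ‖x‖ ^ k * ‖G (x, t)‖ ≤
      C * (1 + ‖t‖) ^ (-((volume : Measure (Eu d)).integrablePower : ℝ)) := by
  set N := (volume : Measure (Eu d)).integrablePower
  refine ⟨2 ^ (k + N) * (Finset.Iic (k + N, 0)).sup
    (fun m => SchwartzMap.seminorm ℝ m.1 m.2) G, by positivity, fun x t => ?_⟩
  have h := SchwartzMap.one_add_le_sup_seminorm_apply (𝕜 := ℝ) (m := (k + N, 0))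
    (k := k + N) (n := 0) le_rfl le_rfl G (x, t)
  rw [Real.rpow_neg (by positivity), Real.rpow_natCast, ← div_eq_mul_inv,
    le_div_iff₀ (by positivity)]
  refine le_trans ?_ h
  rw [norm_iteratedFDeriv_zero, pow_add]
  have h1 : ‖x‖ ≤ 1 + ‖(x, t)‖ := (norm_fst_le (x, t)).trans (by simp)
  have h2 : ‖t‖ ≤ ‖(x, t)‖ := norm_snd_le (x, t)
  calc _ = ‖x‖ ^ k * (1 + ‖t‖) ^ N * ‖G (x, t)‖ := by ring
    _ ≤ _ := by gcongr

theorem integrable_slice (G : 𝓢(Phase d, F)) (x : Eu d) : Integrable fun t : Eu d => G (x, t) := by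
  obtain ⟨C, -, hC⟩ := exists_slice_bound G 0
  refine Integrable.mono' ((Measure.integrable_pow_neg_integrablePower _).const_mul C)
    (G.continuous.comp (by fun_prop)).aestronglyMeasurable (ae_of_all _ fun t => ?_)
  simpa using hC x t

theorem continuous_phase (ξ : Eu d) :
    Continuous fun t : Eu d => Complex.exp (-2 * Real.pi * Complex.I * inner ℝ t ξ) := by
  fun_prop

theorem integrable_phase_slice (G : 𝓢(Phase d, F)) (z : Phase d) : Integrable fun t : Eu d =>
    Complex.exp (-2 * Real.pi * Complex.I * inner ℝ t z.2) • G (z.1, t) := by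
  refine (integrable_slice G z.1).mono
    ((continuous_phase z.2).smul (G.continuous.comp (by fun_prop))).aestronglyMeasurable
    (ae_of_all _ fun t => ?_)
  rw [norm_smul, norm_phase, one_mul]

theorem partialFourier_bound_fst (G : 𝓢(Phase d, F)) (k : ℕ) :
    ∃ C : ℝ, ∀ z : Phase d, ‖z.1‖ ^ k * ‖partialFourier G z‖ ≤ C := by
  obtain ⟨C, -, hC⟩ := exists_slice_bound G k
  refine ⟨∫ t : Eu d, C * (1 + ‖t‖) ^ (-((volume : Measure (Eu d)).integrablePower : ℝ)),
    fun z => ?_⟩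
  calc _ ≤ ‖z.1‖ ^ k * ∫ t : Eu d, ‖G (z.1, t)‖ := by
        gcongr
        refine (norm_integral_le_integral_norm _).trans (le_of_eq ?_)
        simp only [norm_smul, norm_phase, one_mul]
    _ = ∫ t : Eu d, ‖z.1‖ ^ k * ‖G (z.1, t)‖ := (integral_const_mul _ _).symm
    _ ≤ _ := integral_mono ((integrable_slice G z.1).norm.const_mul _)
        ((Measure.integrable_pow_neg_integrablePower _).const_mul C) (fun t => hC z.1 t)

/-- The partial Fourier transform exchanges multiplication and differentiation. -/
theorem norm_snd_mul_partialFourier_le (G : 𝓢(Phase d, F)) :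
    ∃ G' : 𝓢(Phase d, Eu d →L[ℝ] F), ∀ z : Phase d,
      ‖z.2‖ * ‖partialFourier G z‖ ≤ ‖partialFourier G' z‖ := by
  let P : (Phase d →L[ℝ] F) →L[ℝ] (Eu d →L[ℝ] F) :=
    (ContinuousLinearMap.compL ℝ (Eu d) (Phase d) F).flip (ContinuousLinearMap.inr ℝ (Eu d) (Eu d))
  refine ⟨SchwartzMap.postcompCLM (𝕜 := ℝ) P (SchwartzMap.fderivCLM ℝ _ _ G), fun z => ?_⟩
  have hd : ∀ t : Eu d, HasFDerivAt (fun t : Eu d => G (z.1, t))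
      ((fderiv ℝ G (z.1, t)).comp (ContinuousLinearMap.inr ℝ (Eu d) (Eu d))) t := by
    intro t
    have h1 : HasFDerivAt (fun t : Eu d => ((z.1, t) : Phase d))
      (ContinuousLinearMap.inr ℝ (Eu d) (Eu d)) t := hasFDerivAt_prodMk_right z.1 t
    exact (G.hasFDerivAt (z.1, t)).comp t h1
  have hf : fderiv ℝ (fun t : Eu d => G (z.1, t)) = fun t =>
      (SchwartzMap.postcompCLM (𝕜 := ℝ) P (SchwartzMap.fderivCLM ℝ _ _ G)) (z.1, t) := by
    funext t; exact (hd t).fderiv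
  have key := Real.fourier_fderiv (integrable_slice G z.1) (fun t => (hd t).differentiableAt)
    (by rw [hf]; exact integrable_slice _ z.1)
  have h2 : ∀ {F' : Type} [NormedAddCommGroup F'] [NormedSpace ℂ F'] (H : 𝓢(Phase d, F')),
      FourierTransform.fourier (fun t : Eu d => H (z.1, t)) z.2 = partialFourier H z := by
    intro F' _ _ H
    rw [Real.fourier_eq']
    refine integral_congr_ae (ae_of_all _ fun t => ?_)
    simp only
    congr 2
    push_cast; ring
  have key2 := congrFun key z.2
  rw [hf, h2] at key2
  rw [key2]
  rcases (norm_nonneg z.2).eq_or_lt with h0 | h0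
  · rw [← h0, zero_mul]; exact norm_nonneg _
  have h3 := ContinuousLinearMap.le_opNorm (VectorFourier.fourierSMulRight (-innerSL ℝ)
    (FourierTransform.fourier fun t : Eu d => G (z.1, t)) z.2) z.2
  rw [VectorFourier.fourierSMulRight_apply, h2, norm_smul, norm_smul] at h3
  have h4 : ‖-(2 * Real.pi * Complex.I : ℂ)‖ = 2 * Real.pi := by
    simp [abs_of_pos Real.pi_pos]
  have h5 : ‖(-innerSL ℝ : Eu d →L[ℝ] Eu d →L[ℝ] ℝ) z.2 z.2‖ = ‖z.2‖ ^ 2 := by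
    simp
  rw [h4, h5] at h3
  refine le_of_mul_le_mul_right ?_ h0
  refine le_trans ?_ h3
  have := mul_nonneg (sq_nonneg ‖z.2‖) (norm_nonneg (partialFourier G z))
  nlinarith [Real.pi_gt_three]

theorem partialFourier_bound (k : ℕ) : ∀ {F : Type} [NormedAddCommGroup F] [NormedSpace ℂ F]
    (l : ℕ) (G : 𝓢(Phase d, F)),
    ∃ C : ℝ, ∀ z : Phase d, ‖z.1‖ ^ l * ‖z.2‖ ^ k * ‖partialFourier G z‖ ≤ C := by
  induction k with
  | zero =>
    intro F _ _ l G
    simpa using partialFourier_bound_fst G l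
  | succ k ih =>
    intro F _ _ l G
    obtain ⟨G', hG'⟩ := norm_snd_mul_partialFourier_le G
    obtain ⟨C, hC⟩ := ih l G'
    refine ⟨C, fun z => le_trans ?_ (hC z)⟩
    calc _ = ‖z.1‖ ^ l * ‖z.2‖ ^ k * (‖z.2‖ * ‖partialFourier G z‖) := by ring
      _ ≤ _ := by gcongr; exact hG' z

theorem partialFourier_decay (k : ℕ) (G : 𝓢(Phase d, F)) :
    ∃ C : ℝ, ∀ z : Phase d, ‖z‖ ^ k * ‖partialFourier G z‖ ≤ C := by
  obtain ⟨C₁, h₁⟩ := partialFourier_bound 0 k G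
  obtain ⟨C₂, h₂⟩ := partialFourier_bound k 0 G
  refine ⟨max C₁ C₂, fun z => ?_⟩
  rw [Prod.norm_def]
  rcases max_cases ‖z.1‖ ‖z.2‖ with ⟨h, _⟩ | ⟨h, _⟩ <;> rw [h]
  · exact le_max_of_le_left (by simpa using h₁ z)
  · exact le_max_of_le_right (by simpa using h₂ z)

theorem partialFourier_hasFDerivAt (G : 𝓢(Phase d, F)) :
    ∃ G' : 𝓢(Phase d, Phase d →L[ℝ] F), ∀ z : Phase d,
      HasFDerivAt (partialFourier G) (partialFourier G' z) z := by
  let J : Phase d →L[ℝ] Phase d :=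
    (ContinuousLinearMap.inl ℝ (Eu d) (Eu d)).comp (ContinuousLinearMap.fst ℝ (Eu d) (Eu d))
  let P : (Phase d →L[ℝ] F) →L[ℝ] (Phase d →L[ℝ] F) :=
    (ContinuousLinearMap.compL ℝ (Phase d) (Phase d) F).flip J
  let B : Phase d →L[ℝ] Phase d →L[ℝ] ℝ :=
    (innerSL ℝ : Eu d →L[ℝ] Eu d →L[ℝ] ℝ).bilinearComp
      (ContinuousLinearMap.snd ℝ (Eu d) (Eu d)) (ContinuousLinearMap.snd ℝ (Eu d) (Eu d))
  let G' : 𝓢(Phase d, Phase d →L[ℝ] F) :=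
    SchwartzMap.postcompCLM (𝕜 := ℝ) P (SchwartzMap.fderivCLM ℝ _ _ G) +
      (-2 * Real.pi * Complex.I : ℂ) • SchwartzMap.smulRightCLM ℂ F B G
  refine ⟨G', fun z => ?_⟩
  have hder : ∀ (t : Eu d) (w : Phase d), HasFDerivAt
      (fun w : Phase d =>
        Complex.exp (-2 * Real.pi * Complex.I * inner ℝ t w.2) • G (w.1, t))
      (Complex.exp (-2 * Real.pi * Complex.I * inner ℝ t w.2) • G' (w.1, t)) w := by
    intro t w
    have h1 : HasFDerivAt (fun w : Phase d => ((w.1, t) : Phase d)) J w :=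
      (hasFDerivAt_fst.prodMk (hasFDerivAt_const t w)).congr_fderiv (by ext v <;> simp [J])
    have h2 := (G.hasFDerivAt (w.1, t)).comp w h1
    have h3 : HasFDerivAt (fun w : Phase d => ((inner ℝ t w.2 : ℝ) : ℂ))
        (Complex.ofRealCLM.comp ((innerSL ℝ t).comp
          (ContinuousLinearMap.snd ℝ (Eu d) (Eu d)))) w :=
      (Complex.ofRealCLM.comp ((innerSL ℝ t).comp
          (ContinuousLinearMap.snd ℝ (Eu d) (Eu d)))).hasFDerivAt
    have h4 := ((h3.const_mul (-2 * Real.pi * Complex.I)).cexp).smul h2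
    refine h4.congr_fderiv ?_
    refine ContinuousLinearMap.ext fun v => ?_
    have h5 : G' (w.1, t) v = fderiv ℝ G (w.1, t) (J v) +
        (-2 * Real.pi * Complex.I : ℂ) • (inner ℝ t v.2 • G (w.1, t)) := rfl
    rw [smul_apply, h5, smul_add, ← Complex.coe_smul (inner ℝ t v.2),
      smul_smul, smul_smul]
    simp only [add_apply, smul_apply, ContinuousLinearMap.comp_apply,
      ContinuousLinearMap.smulRight_apply, Function.comp_apply, smul_eq_mul, innerSL_apply_apply,
      ContinuousLinearMap.coe_snd', Complex.ofRealCLM_apply, mul_assoc]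
    congr 1
    rw [smul_smul]
    congr 1
    ring
  obtain ⟨C, -, hC⟩ := exists_slice_bound G' 0
  exact hasFDerivAt_integral_of_dominated_of_fderiv_le (s := Set.univ) Filter.univ_mem
    (Eventually.of_forall fun w => (integrable_phase_slice G w).aestronglyMeasurable)
    (integrable_phase_slice G z) (integrable_phase_slice G' z).aestronglyMeasurable
    (ae_of_all _ fun t w _ => by
      rw [norm_smul, norm_phase, one_mul]; simpa using hC w.1 t)
    ((Measure.integrable_pow_neg_integrablePower _).const_mul C)
    (ae_of_all _ fun t w _ => hder t w)

theorem partialFourier_schwartz (n : ℕ) : ∀ {F : Type} [NormedAddCommGroup F] [NormedSpace ℂ F]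
    (G : 𝓢(Phase d, F)), ContDiff ℝ n (partialFourier G) ∧ ∀ k : ℕ, ∃ C : ℝ, ∀ z : Phase d,
      ‖z‖ ^ k * ‖iteratedFDeriv ℝ n (partialFourier G) z‖ ≤ C := by
  induction n with
  | zero =>
    intro F _ _ G
    obtain ⟨G', hG'⟩ := partialFourier_hasFDerivAt G
    refine ⟨contDiff_zero.2 (continuous_iff_continuousAt.2 fun z => (hG' z).continuousAt),
      fun k => ?_⟩
    simpa using partialFourier_decay k G
  | succ n ih =>
    intro F _ _ G
    obtain ⟨G', hG'⟩ := partialFourier_hasFDerivAt G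
    have hf : fderiv ℝ (partialFourier G) = partialFourier G' := funext fun z => (hG' z).fderiv
    refine ⟨?_, fun k => ?_⟩
    · rw [Nat.cast_succ, contDiff_succ_iff_fderiv]
      exact ⟨fun z => (hG' z).differentiableAt, by simp, hf ▸ (ih G').1⟩
    · simpa only [← norm_iteratedFDeriv_fderiv, hf] using (ih G').2 k

end PartialFourier

section Wigner

variable {d : ℕ}

/-- The function `(x, y) ↦ f(x) conj (g(y))`. -/
def tensorConj (f g : 𝓢(Eu d, ℂ)) : 𝓢(Phase d, ℂ) where
  toFun z := f z.1 * conj (g z.2)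
  smooth' := ((f.smooth ⊤).comp contDiff_fst).mul
    ((Complex.conjCLE : ℂ →L[ℝ] ℂ).contDiff.comp ((g.smooth ⊤).comp contDiff_snd))
  decay' := by
    intro k n
    let g' : 𝓢(Eu d, ℂ) := SchwartzMap.postcompCLM (𝕜 := ℝ) (Complex.conjCLE : ℂ →L[ℝ] ℂ) g
    have hb : ∀ h : 𝓢(Eu d, ℂ), ∃ C : ℝ, 0 ≤ C ∧ ∀ i ≤ n, ∀ x : Eu d,
        (1 + ‖x‖) ^ k * ‖iteratedFDeriv ℝ i h x‖ ≤ C := fun h =>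
      ⟨2 ^ k * (Finset.Iic (k, n)).sup (fun m => SchwartzMap.seminorm ℝ m.1 m.2) h,
        by positivity, fun i hi x =>
        SchwartzMap.one_add_le_sup_seminorm_apply (𝕜 := ℝ) (m := (k, n)) le_rfl hi h x⟩
    have hfst : ∀ (h : 𝓢(Eu d, ℂ)) (i : ℕ) (z : Phase d),
        ‖iteratedFDeriv ℝ i (fun z : Phase d => h z.1) z‖ ≤ ‖iteratedFDeriv ℝ i h z.1‖ := by
      intro h i z
      have := (ContinuousLinearMap.fst ℝ (Eu d) (Eu d)).iteratedFDeriv_comp_right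
        (h.smooth ⊤) z (i := i) (mod_cast le_top)
      change ‖iteratedFDeriv ℝ i (h ∘ ContinuousLinearMap.fst ℝ (Eu d) (Eu d)) z‖ ≤ _
      rw [this]
      refine (ContinuousMultilinearMap.norm_compContinuousLinearMap_le _ _).trans ?_
      refine mul_le_of_le_one_right (norm_nonneg _) (Finset.prod_le_one (fun _ _ => norm_nonneg _)
        fun _ _ => ContinuousLinearMap.norm_fst_le ℝ (Eu d) (Eu d))
    have hsnd : ∀ (h : 𝓢(Eu d, ℂ)) (i : ℕ) (z : Phase d),
        ‖iteratedFDeriv ℝ i (fun z : Phase d => h z.2) z‖ ≤ ‖iteratedFDeriv ℝ i h z.2‖ := by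
      intro h i z
      have := (ContinuousLinearMap.snd ℝ (Eu d) (Eu d)).iteratedFDeriv_comp_right
        (h.smooth ⊤) z (i := i) (mod_cast le_top)
      change ‖iteratedFDeriv ℝ i (h ∘ ContinuousLinearMap.snd ℝ (Eu d) (Eu d)) z‖ ≤ _
      rw [this]
      refine (ContinuousMultilinearMap.norm_compContinuousLinearMap_le _ _).trans ?_
      refine mul_le_of_le_one_right (norm_nonneg _) (Finset.prod_le_one (fun _ _ => norm_nonneg _)
        fun _ _ => ContinuousLinearMap.norm_snd_le ℝ (Eu d) (Eu d))
    obtain ⟨Cf, hCf0, hCf⟩ := hb f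
    obtain ⟨Cg, hCg0, hCg⟩ := hb g'
    refine ⟨∑ i ∈ Finset.range (n + 1), (n.choose i : ℝ) * (Cf * Cg), fun z => ?_⟩
    have key := norm_iteratedFDeriv_mul_le (𝕜 := ℝ) (n := n) (N := ∞)
      (f := fun z : Phase d => f z.1) (g := fun z : Phase d => g' z.2)
      ((f.smooth ⊤).comp contDiff_fst) ((g'.smooth ⊤).comp contDiff_snd) z (mod_cast le_top)
    have hz : ‖z‖ ^ k ≤ (1 + ‖z.1‖) ^ k * (1 + ‖z.2‖) ^ k := by
      rw [← mul_pow]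
      refine pow_le_pow_left₀ (norm_nonneg _) ?_ k
      rw [Prod.norm_def]
      refine max_le ?_ ?_ <;>
        nlinarith [norm_nonneg z.1, norm_nonneg z.2, mul_nonneg (norm_nonneg z.1) (norm_nonneg z.2)]
    refine (mul_le_mul hz key (norm_nonneg _) (by positivity)).trans ?_
    rw [Finset.mul_sum]
    refine Finset.sum_le_sum fun i hi => ?_
    have hi' : i ≤ n := Nat.lt_succ_iff.1 (Finset.mem_range.1 hi)
    calc _ ≤ (1 + ‖z.1‖) ^ k * (1 + ‖z.2‖) ^ k * ((n.choose i : ℝ) *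
          ‖iteratedFDeriv ℝ i f z.1‖ * ‖iteratedFDeriv ℝ (n - i) g' z.2‖) := by
            gcongr
            · exact hfst f i z
            · exact hsnd g' (n - i) z
      _ = (n.choose i : ℝ) * (((1 + ‖z.1‖) ^ k * ‖iteratedFDeriv ℝ i f z.1‖) *
          ((1 + ‖z.2‖) ^ k * ‖iteratedFDeriv ℝ (n - i) g' z.2‖)) := by ring
      _ ≤ _ := by
            gcongr
            · exact hCf i hi' z.1
            · exact hCg (n - i) (Nat.sub_le _ _) z.2

/-- The change of coordinates `(x, t) ↦ (x + t/2, x - t/2)`. -/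
def wignerCoords (d : ℕ) : Phase d ≃L[ℝ] Phase d :=
  ContinuousLinearEquiv.equivOfInverse
    ((ContinuousLinearMap.fst ℝ (Eu d) (Eu d) +
        (1 / 2 : ℝ) • ContinuousLinearMap.snd ℝ (Eu d) (Eu d)).prod
      (ContinuousLinearMap.fst ℝ (Eu d) (Eu d) -
        (1 / 2 : ℝ) • ContinuousLinearMap.snd ℝ (Eu d) (Eu d)))
    (((1 / 2 : ℝ) • (ContinuousLinearMap.fst ℝ (Eu d) (Eu d) +
        ContinuousLinearMap.snd ℝ (Eu d) (Eu d))).prod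
      (ContinuousLinearMap.fst ℝ (Eu d) (Eu d) - ContinuousLinearMap.snd ℝ (Eu d) (Eu d)))
    (by intro z; ext1 <;> simp <;> module)
    (by intro z; ext1 <;> simp <;> module)

/-- The Wigner distribution `W(f, g)(x, ξ) = ∫ f(x + t/2) conj (g(x - t/2)) e^{-2 π i t · ξ} dt`. -/
def wigner (f g : Eu d → ℂ) (z : Phase d) : ℂ :=
  ∫ t : Eu d, f (z.1 + (1 / 2 : ℝ) • t) * conj (g (z.1 - (1 / 2 : ℝ) • t)) *
    Complex.exp (-2 * Real.pi * Complex.I * inner ℝ t z.2)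

theorem wigner_eq_partialFourier (f g : 𝓢(Eu d, ℂ)) : wigner f g = partialFourier
    (SchwartzMap.compCLMOfContinuousLinearEquiv ℂ (wignerCoords d) (tensorConj f g)) := by
  funext z
  refine integral_congr_ae (ae_of_all _ fun t => ?_)
  exact mul_comm _ _

/-- The Wigner distribution of two Schwartz functions is a Schwartz function. -/
def schwartzWigner (f g : 𝓢(Eu d, ℂ)) : 𝓢(Phase d, ℂ) where
  toFun := wigner f g
  smooth' := by
    rw [wigner_eq_partialFourier]
    exact contDiff_infty.2 fun n => (partialFourier_schwartz n _).1
  decay' := by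
    intro k n
    rw [wigner_eq_partialFourier]
    exact (partialFourier_schwartz n _).2 k

end Wigner

/-! ### Time-frequency shifts on `L²(ℝᵈ)` -/

section TimeFrequency

variable {d : ℕ}

/-- The Hilbert space `L²(ℝᵈ)`. -/
abbrev L2 (d : ℕ) : Type := Lp ℂ 2 (volume : Measure (Eu d))

/-- The time-frequency shift `π(z) f (t) = e^{2 π i ξ · t} f (t - x)`, for `z = (x, ξ)`. -/
def tfShift (z : Phase d) (f : Eu d → ℂ) (t : Eu d) : ℂ :=
  Complex.exp (2 * Real.pi * Complex.I * inner ℝ z.2 t) * f (t - z.1)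

theorem memLp_tfShift {f : Eu d → ℂ} (hf : MemLp f 2) (z : Phase d) : MemLp (tfShift z f) 2 := by
  have h1 : MemLp (fun t => f (t - z.1)) 2 :=
    hf.comp_measurePreserving (measurePreserving_sub_right volume z.1)
  have hc : Continuous fun t : Eu d => Complex.exp (2 * Real.pi * Complex.I * inner ℝ z.2 t) := by
    fun_prop
  refine h1.of_le (hc.aestronglyMeasurable.mul h1.1) (ae_of_all _ fun t => ?_)
  have : ‖Complex.exp (2 * Real.pi * Complex.I * inner ℝ z.2 t)‖ = 1 := by
    rw [show (2 * Real.pi * Complex.I * (inner ℝ z.2 t : ℝ) : ℂ) =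
      ((2 * Real.pi * inner ℝ z.2 t : ℝ) : ℂ) * Complex.I by push_cast; ring]
    exact Complex.norm_exp_ofReal_mul_I _
  rw [tfShift, norm_mul, this, one_mul]

/-- The time-frequency shift `π(z) g` as an element of `L²(ℝᵈ)`. -/
def atom (g : L2 d) (z : Phase d) : L2 d := (memLp_tfShift (Lp.memLp g) z).toLp

/-- The short-time Fourier transform `V_g f (z) = ⟨f, π(z) g⟩` on `L²(ℝᵈ)`. -/
def stft (g f : L2 d) (z : Phase d) : ℂ := inner ℂ (atom g z) f

/-- The coefficient operator `f ↦ (⟨f, π(λ) g⟩)_{λ ∈ Λ}`: the restriction of `V_g f` to `Λ`. -/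
def analysis (Λ : Submodule ℤ (Phase d)) (g : L2 d) : L2 d →ₗ[ℂ] (Λ → ℂ) where
  toFun f l := stft g f l
  map_add' _ _ := funext fun _ => inner_add_right _ _ _
  map_smul' _ _ := funext fun _ => inner_smul_right _ _ _

/-- `{π(λ) g : λ ∈ Λ}` is a tight Gabor frame for `L²(ℝᵈ)` with frame constant `1`. -/
def IsTightGaborFrame (Λ : Submodule ℤ (Phase d)) (g : L2 d) : Prop :=
  ∀ f : L2 d, HasSum (fun l : Λ => ‖stft g f l‖ ^ 2) (‖f‖ ^ 2)

end TimeFrequency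

/-! ### Solid Banach spaces of sequences -/

/-- A solid Banach space of complex sequences on the index set `ι`. -/
structure SolidBanachSpace (ι : Type*) where
  carrier : Submodule ℂ (ι → ℂ)
  nrm : Seminorm ℂ carrier
  eq_zero_of_nrm : ∀ a : carrier, nrm a = 0 → a = 0
  complete : ∀ u : ℕ → carrier,
    (∀ ε > 0, ∃ N, ∀ m ≥ N, ∀ n ≥ N, nrm (u m - u n) < ε) →
      ∃ a : carrier, Tendsto (fun n => nrm (u n - a)) atTop (𝓝 0)
  solid : ∀ (a : ι → ℂ) (b : carrier), (∀ i, ‖a i‖ ≤ ‖(b : ι → ℂ) i‖) →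
    ∃ ha : a ∈ carrier, nrm ⟨a, ha⟩ ≤ nrm b

namespace SolidBanachSpace

open Classical in
/-- The norm of a sequence with values in `[0, ∞]`, which is `∞` unless the sequence is finite
everywhere and belongs to the space. -/
def extNorm {ι : Type*} (𝒜 : SolidBanachSpace ι) (s : ι → ℝ≥0∞) : ℝ≥0∞ :=
  if h : (∀ i, s i ≠ ⊤) ∧ (fun i => ((s i).toReal : ℂ)) ∈ 𝒜.carrier then
    ENNReal.ofReal (𝒜.nrm ⟨_, h.2⟩) else ⊤

/-- The finitely supported sequences belong to the space and are dense in it. -/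
structure FinitelySupportedDense {ι : Type*} (𝒴 : SolidBanachSpace ι) : Prop where
  mem : ∀ c : ι → ℂ, c.support.Finite → c ∈ 𝒴.carrier
  dense : ∀ c : 𝒴.carrier, ∀ ε > 0, ∃ b : 𝒴.carrier,
    (b : ι → ℂ).support.Finite ∧ 𝒴.nrm (c - b) < ε

/-- The convolution `(a ∗ b)(λ) = ∑_μ a(μ) b(λ - μ)`. -/
def conv {ι : Type*} [AddCommGroup ι] (a b : ι → ℂ) (l : ι) : ℂ := ∑' m, a m * b (l - m)

/-- Convolution maps `𝒜 × 𝒴` boundedly into `𝒴`, with constant `K`. -/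
def ConvActs {ι : Type*} [AddCommGroup ι] (K : ℝ≥0) (𝒜 𝒴 : SolidBanachSpace ι) : Prop :=
  ∀ (a : 𝒜.carrier) (c : 𝒴.carrier),
    (∀ l, Summable fun m => (a : ι → ℂ) m * (c : ι → ℂ) (l - m)) ∧
      ∃ h : conv (a : ι → ℂ) c ∈ 𝒴.carrier, 𝒴.nrm ⟨_, h⟩ ≤ K * 𝒜.nrm a * 𝒴.nrm c

/-- A solid involutive Banach algebra with respect to convolution, with involution
`a*(λ) = conj a(-λ)`, that contains the finitely supported sequences. -/
structure IsInvolutiveConvAlgebra {ι : Type*} [AddCommGroup ι] (𝒜 : SolidBanachSpace ι) :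
    Prop where
  mem_of_finite_support : ∀ c : ι → ℂ, c.support.Finite → c ∈ 𝒜.carrier
  conv_bound : ConvActs 1 𝒜 𝒜
  star_bound : ∀ a : 𝒜.carrier,
    ∃ h : (fun l => conj ((a : ι → ℂ) (-l))) ∈ 𝒜.carrier, 𝒜.nrm ⟨_, h⟩ ≤ 𝒜.nrm a

/-- The norm `‖A‖_{𝒞_𝒜} = ‖d_A‖_𝒜`, where `d_A(μ) = sup_λ |a_{λ, λ - μ}|`. The matrix belongs to
`𝒞_𝒜` if and only if this is finite. -/
def matrixNorm {ι : Type*} [AddCommGroup ι] (𝒜 : SolidBanachSpace ι) (A : Matrix ι ι ℂ) : ℝ≥0∞ :=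
  𝒜.extNorm fun m => ⨆ l, ‖A l (l - m)‖ₑ

end SolidBanachSpace

/-! ### Amalgam spaces and symbol classes -/

section Symbols

variable {d : ℕ}

/-- A relatively compact fundamental domain of `Λ` that contains the origin; the origin is
not an isolated point of it in the measure-theoretic sense. -/
structure IsFundamentalCell (Λ : Submodule ℤ (Phase d)) (C : Set (Phase d)) : Prop where
  isAddFundamentalDomain : IsAddFundamentalDomain Λ C volume
  isBounded : Bornology.IsBounded C
  zero_mem : (0 : Phase d) ∈ C
  pos_near_zero : ∀ U ∈ 𝓝 (0 : Phase d), 0 < volume (U ∩ C)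

/-- The norm of the amalgam space `W(𝒜)`: the `𝒜`-norm of the essential suprema over the
cells `λ + C`. A function belongs to `W(𝒜)` if and only if this is finite. -/
def amalgamNorm {Λ : Submodule ℤ (Phase d)} (𝒜 : SolidBanachSpace Λ) (C : Set (Phase d))
    (F : Phase d → ℝ≥0∞) : ℝ≥0∞ :=
  𝒜.extNorm fun l => essSup F (volume.restrict {ζ | ζ - (l : Phase d) ∈ C})

/-- The time-frequency shift `M_ζ T_z F` of a function on the phase space. -/
def phaseShift (z ζ : Phase d) (F : Phase d → ℂ) (w : Phase d) : ℂ := phaseChar ζ w * F (w - z)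

/-- The sesquilinear bracket `⟨σ, F⟩` of a tempered distribution and a Schwartz function. -/
def bracket (σ : 𝓢'(Phase d, ℂ)) (F : 𝓢(Phase d, ℂ)) : ℂ := σ (schwartzConj F)

/-- The short-time Fourier transform `⟨σ, M_ζ T_z Ψ⟩` of a tempered distribution with respect to
the Gaussian window `Ψ`. -/
def gaussSTFT (σ : 𝓢'(Phase d, ℂ)) (z ζ : Phase d) : ℂ :=
  bracket σ (schwartzPhaseShift z ζ (gaussian d))

/-- The duality bracket `⟨σ, F⟩ = ∬ 𝒱_Ψ σ(z, ζ) conj (𝒱_Ψ F(z, ζ)) dz dζ` of `M^∞` and `M^1`. The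
Gaussian `Ψ` has `L²`-norm one, so that it extends the bracket with Schwartz functions. -/
def dualBracket (σ : 𝓢'(Phase d, ℂ)) (F : Phase d → ℂ) : ℂ :=
  ∫ p : Phase d × Phase d, gaussSTFT σ p.1 p.2 *
    conj (∫ w : Phase d, F w * conj (phaseShift p.1 p.2 (gaussian d) w))

/-- The short-time Fourier transform `⟨σ, M_ζ T_z Φ⟩` of a symbol with respect to a window
`Φ ∈ M^1`. -/
def windowSTFT (Φ : Phase d → ℂ) (σ : 𝓢'(Phase d, ℂ)) (z ζ : Phase d) : ℂ :=
  dualBracket σ (phaseShift z ζ Φ)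

/-- The map `j(ζ₁, ζ₂) = (ζ₂, -ζ₁)`. -/
def rot (ζ : Phase d) : Phase d := (ζ.2, -ζ.1)

/-- `‖𝒢 ∘ j‖_{W(𝒜)}`, where `𝒢(ζ) = ess sup_z |V(z, ζ)|` is the grand symbol that belongs to the
short-time Fourier transform `V` of a symbol. -/
def grandNorm {Λ : Submodule ℤ (Phase d)} (𝒜 : SolidBanachSpace Λ) (C : Set (Phase d))
    (V : Phase d → Phase d → ℂ) : ℝ≥0∞ :=
  amalgamNorm 𝒜 C fun ζ => essSup (fun z => ‖V z (rot ζ)‖ₑ) volume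

/-- The norm that defines the generalized Sjöstrand class `M̃^{∞,𝒜}` by the Gaussian window. The
symbol belongs to the class if and only if this is finite. -/
def sjostrandNorm {Λ : Submodule ℤ (Phase d)} (𝒜 : SolidBanachSpace Λ) (C : Set (Phase d))
    (σ : 𝓢'(Phase d, ℂ)) : ℝ≥0∞ :=
  grandNorm 𝒜 C (gaussSTFT σ)

/-- The norm of `M̃^{∞,𝒜}` with respect to the window `W(g, g)`. -/
def sjostrandNormWigner {Λ : Submodule ℤ (Phase d)} (𝒜 : SolidBanachSpace Λ) (C : Set (Phase d))
    (g : L2 d) (σ : 𝓢'(Phase d, ℂ)) : ℝ≥0∞ :=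
  grandNorm 𝒜 C (windowSTFT (wigner g g) σ)

/-- The matrix `M(σ)` with the entries
`⟨σ^w π(μ) g, π(λ) g⟩ = ⟨σ, W(π(λ) g, π(μ) g)⟩`. -/
def gaborMatrix (Λ : Submodule ℤ (Phase d)) (g : L2 d) (σ : 𝓢'(Phase d, ℂ)) : Matrix Λ Λ ℂ :=
  fun l m => dualBracket σ (wigner (tfShift l g) (tfShift m g))

/-- `T` is the extension of the Weyl transform `σ^w` to `L²(ℝᵈ)`:
`⟨T f, h⟩ = ⟨σ, W(h, f)⟩` for all Schwartz functions `f` and `h`. -/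
def IsWeylTransform (σ : 𝓢'(Phase d, ℂ)) (T : L2 d →L[ℂ] L2 d) : Prop :=
  ∀ f h : 𝓢(Eu d, ℂ), inner ℂ (h.toLp 2) (T (f.toLp 2)) = bracket σ (schwartzWigner h f)

end Symbols

/-! ### Modulation spaces -/

section ModulationSpace

variable {d : ℕ} {Λ : Submodule ℤ (Phase d)}

/-- The span `ℒ₀` of the time-frequency shifts `π(λ) g`, `λ ∈ Λ`. -/
def gaborSpan (Λ : Submodule ℤ (Phase d)) (g : L2 d) : Submodule ℂ (L2 d) :=
  Submodule.span ℂ (Set.range fun l : Λ => atom g l)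

/-- The elements `f` of `ℒ₀` whose norm `‖V_g f|_Λ‖_𝒴` is finite. -/
def finiteNormSpan (𝒴 : SolidBanachSpace Λ) (g : L2 d) : Submodule ℂ (L2 d) :=
  gaborSpan Λ g ⊓ 𝒴.carrier.comap (analysis Λ g)

/-- The space `finiteNormSpan`, equipped with the `M(𝒴)`-norm instead of the `L²`-norm. -/
def PreModulationSpace (𝒴 : SolidBanachSpace Λ) (g : L2 d) : Type := ↥(finiteNormSpan 𝒴 g)

namespace PreModulationSpace

variable (𝒴 : SolidBanachSpace Λ) (g : L2 d)

instance : AddCommGroup (PreModulationSpace 𝒴 g) :=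
  inferInstanceAs (AddCommGroup ↥(finiteNormSpan 𝒴 g))

instance : Module ℂ (PreModulationSpace 𝒴 g) :=
  inferInstanceAs (Module ℂ ↥(finiteNormSpan 𝒴 g))

variable {𝒴 g}

/-- The underlying element of `L²(ℝᵈ)`. -/
def toL2 : PreModulationSpace 𝒴 g →ₗ[ℂ] L2 d := (finiteNormSpan 𝒴 g).subtype

/-- The coefficient operator, as a map into `𝒴`. -/
def coeff : PreModulationSpace 𝒴 g →ₗ[ℂ] 𝒴.carrier :=
  ((analysis Λ g).comp toL2).codRestrict 𝒴.carrier fun f =>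
    (Submodule.mem_inf.1 (show (f : ↥(finiteNormSpan 𝒴 g)).1 ∈ finiteNormSpan 𝒴 g from f.2)).2

instance : SeminormedAddCommGroup (PreModulationSpace 𝒴 g) :=
  AddGroupSeminorm.toSeminormedAddCommGroup (𝒴.nrm.comp coeff).toAddGroupSeminorm

theorem norm_def (f : PreModulationSpace 𝒴 g) : ‖f‖ = 𝒴.nrm (coeff f) := rfl

instance : NormedSpace ℂ (PreModulationSpace 𝒴 g) where
  norm_smul_le c f := by rw [norm_def, norm_def, map_smul, map_smul_eq_mul]

end PreModulationSpace

/-- The modulation space `M(𝒴)`: the completion with respect to the norm `‖V_g f|_Λ‖_𝒴`. -/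
abbrev ModulationSpace (𝒴 : SolidBanachSpace Λ) (g : L2 d) : Type :=
  UniformSpace.Completion (PreModulationSpace 𝒴 g)

/-- The element `m` of the completion `M(𝒴)` is given by the element `f` of `L²(ℝᵈ)`: some sequence
in `ℒ₀` converges to `m`, and converges to `f` with respect to the norm `‖V_g f|_Λ‖_𝒴`. -/
def Represents {𝒴 : SolidBanachSpace Λ} {g : L2 d} (f : L2 d) (m : ModulationSpace 𝒴 g) : Prop :=
  ∃ (u : ℕ → PreModulationSpace 𝒴 g) (hf : analysis Λ g f ∈ 𝒴.carrier),
    Tendsto (fun n => (u n : ModulationSpace 𝒴 g)) atTop (𝓝 m) ∧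
      Tendsto (fun n => 𝒴.nrm ((u n).coeff - ⟨analysis Λ g f, hf⟩)) atTop (𝓝 0)

end ModulationSpace

end WeylGabor

end

open WeylGabor

noncomputable section

namespace WeylGabor

/-! ### Solid spaces in terms of sequences with values in `[0, ∞]` -/

/-! Write Vf for the short-time Fourier transform with the fixed Gaussian window θ (`thetaLp`), and
G(ζ) = sup_z |𝒱_Ψσ(z, jζ)| for the Gaussian grand symbol. Everything follows from one estimate of
the form (h, f) ↦ ⟨σ, W(h, f)⟩: ∬ |𝒱_Ψσ · 𝒱_ΨW(h, f)| ≤ K ∫ G(ζ) ∫ |Vh(z)| |Vf(z - ζ)| dz dζ. It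
comes from an explicit formula (`funSTFT_wigner`): Ψ is an average of translates of W(θ, θ) in the
position variable, so 𝒱_ΨW(h, f) is, up to a factor of constant modulus, a Gaussian average of
products Vh · conj Vf at points that differ by ζ.

To use the estimate three facts are needed. The algebra 𝒜 embeds into ℓ¹ with norm one
(`tsum_le_extNorm`), by comparing mass and norm of high convolution powers. The amalgam space W(𝒜)
is stable under convolution and reflection and contains Gaussians, because ‖δ_λ‖ grows at most
exponentially. Finally Vg ∈ W(𝒜): a change-of-window identity (`stft_change_window`) bounds |Vg(z₁)|
|Vg(z₀)| by the convolution of |V_g g| with a Gaussian, and z₀ may be any point with Vg(z₀) ≠ 0.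

The operator. Expanding in the tight frame and applying Schur's test gives ‖Vh‖₂ ≤ K‖h‖₂. As G ∈
W(𝒜) ⊂ L¹, the form is bounded on L² and defines T by Riesz. That T is the Weyl transform requires
that the M^∞–M¹ duality agree with the distributional bracket on Schwartz functions
(`bracket_eq_dualBracket`). This is the inversion formula for 𝒱_Ψ, with σ applied under the integral
sign.

The norms. By covariance of the Wigner distribution, |𝒱_{W(g,g)}σ(z, jζ)| = |⟨Tπ(z - ζ/2)g, π(z +
ζ/2)g⟩|. This is continuous, so essential suprema over z are suprema. The matrix entries are the
values with z ± ζ/2 ∈ Λ, and lower semicontinuity together with the condition on C at the origin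
puts d_{M(σ)} below the cell suprema; this is the first inequality. For the second, the basic
estimate with h, f time-frequency shifts of g bounds these values, uniformly in z, by G convolved
with the autocorrelation of |Vg|, which lies in W(𝒜).

The bounds. In the frame, T acts on coefficient sequences as the matrix M(σ), hence is dominated by
convolution with d_{M(σ)}. Schur's test with ‖d‖₁ ≤ ‖d‖_𝒜 gives the L² bound, and the action of 𝒜 on
𝒴 gives the bound on M(𝒴). That Tf lies in M(𝒴) is seen by truncating its coefficients and
synthesizing: the Gram matrix of the frame is itself dominated by convolution with |V_g g|
restricted to Λ, which belongs to 𝒜. -/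

theorem enorm_ofReal_of_nonneg {x : ℝ} (hx : 0 ≤ x) : ‖(x : ℂ)‖ₑ = ENNReal.ofReal x := by
  rw [← ofReal_norm, Complex.norm_of_nonneg hx]

theorem enorm_coe_toReal {x : ℝ≥0∞} (hx : x ≠ ⊤) : ‖(x.toReal : ℂ)‖ₑ = x := by
  rw [enorm_ofReal_of_nonneg ENNReal.toReal_nonneg, ENNReal.ofReal_toReal hx]

namespace SolidBanachSpace

section Solid

variable {ι : Type*} {𝒜 : SolidBanachSpace ι}

theorem extNorm_of_mem {s : ι → ℝ≥0∞} (h1 : ∀ i, s i ≠ ⊤)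
    (h2 : (fun i => ((s i).toReal : ℂ)) ∈ 𝒜.carrier) :
    𝒜.extNorm s = ENNReal.ofReal (𝒜.nrm ⟨_, h2⟩) := by
  rw [extNorm, dif_pos ⟨h1, h2⟩]

theorem extNorm_lt_top_iff {s : ι → ℝ≥0∞} : 𝒜.extNorm s < ⊤ ↔
    (∀ i, s i ≠ ⊤) ∧ (fun i => ((s i).toReal : ℂ)) ∈ 𝒜.carrier := by
  rw [extNorm]; split_ifs with h <;> simp [h]

theorem extNorm_mono {s t : ι → ℝ≥0∞} (h : ∀ i, s i ≤ t i) : 𝒜.extNorm s ≤ 𝒜.extNorm t := by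
  rcases eq_or_ne (𝒜.extNorm t) ⊤ with ht | ht
  · rw [ht]; exact le_top
  obtain ⟨h1, h2⟩ := extNorm_lt_top_iff.1 (lt_top_iff_ne_top.2 ht)
  obtain ⟨h3, h4⟩ := 𝒜.solid (fun i => ((s i).toReal : ℂ)) ⟨_, h2⟩ (fun i => by
    simpa using ENNReal.toReal_mono (h1 i) (h i))
  rw [extNorm_of_mem h1 h2, extNorm_of_mem (fun i => ne_top_of_le_ne_top (h1 i) (h i)) h3]
  exact ENNReal.ofReal_le_ofReal h4

/-- The norm of a complex sequence in terms of its absolute values. -/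
theorem extNorm_enorm (c : 𝒜.carrier) :
    𝒜.extNorm (fun i => ‖(c : ι → ℂ) i‖ₑ) = ENNReal.ofReal (𝒜.nrm c) := by
  obtain ⟨h1, h2⟩ := 𝒜.solid (fun i => ((‖(c : ι → ℂ) i‖ₑ.toReal : ℝ) : ℂ)) c (by simp)
  obtain ⟨h3, h4⟩ := 𝒜.solid (c : ι → ℂ) ⟨_, h1⟩ (by simp)
  rw [extNorm_of_mem (by simp) h1]
  exact congrArg _ (le_antisymm h2 h4)

theorem mem_of_extNorm_lt_top {c : ι → ℂ} (h : 𝒜.extNorm (fun i => ‖c i‖ₑ) < ⊤) :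
    c ∈ 𝒜.carrier :=
  (𝒜.solid c ⟨_, (extNorm_lt_top_iff.1 h).2⟩ (by simp)).1

theorem ofReal_nrm {c : ι → ℂ} (h : c ∈ 𝒜.carrier) :
    ENNReal.ofReal (𝒜.nrm ⟨c, h⟩) = 𝒜.extNorm (fun i => ‖c i‖ₑ) :=
  (extNorm_enorm ⟨c, h⟩).symm

theorem exists_rep {s : ι → ℝ≥0∞} (h : 𝒜.extNorm s < ⊤) :
    ∃ c : 𝒜.carrier, (∀ i, ‖(c : ι → ℂ) i‖ₑ = s i) ∧
      (∀ i, (c : ι → ℂ) i = ((s i).toReal : ℂ)) ∧ 𝒜.extNorm s = ENNReal.ofReal (𝒜.nrm c) := by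
  obtain ⟨h1, h2⟩ := extNorm_lt_top_iff.1 h
  refine ⟨⟨_, h2⟩, fun i => enorm_coe_toReal (h1 i), fun i => rfl, extNorm_of_mem h1 h2⟩

theorem extNorm_zero : 𝒜.extNorm (fun _ => 0) = 0 := by
  have := extNorm_enorm (0 : 𝒜.carrier)
  simpa using this

theorem extNorm_const_mul_le (k : ℝ≥0) (s : ι → ℝ≥0∞) :
    𝒜.extNorm (fun i => k * s i) ≤ k * 𝒜.extNorm s := by
  rcases eq_or_ne (𝒜.extNorm s) ⊤ with hs | hs
  · rcases eq_or_ne k 0 with rfl | hk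
    · simp [extNorm_zero]
    · rw [hs, ENNReal.mul_top (by simpa using hk)]; exact le_top
  obtain ⟨c, hc, -, hn⟩ := exists_rep (lt_top_iff_ne_top.2 hs)
  have h1 := extNorm_enorm ((k : ℂ) • c)
  rw [map_smul_eq_mul, ENNReal.ofReal_mul (norm_nonneg _), ← hn] at h1
  have h2 : ∀ i, ‖(((k : ℂ) • c : 𝒜.carrier) : ι → ℂ) i‖ₑ = k * s i := fun i => by
    rw [Submodule.coe_smul, Pi.smul_apply, enorm_smul, hc]
    congr 1
    simp [← ofReal_norm]
  simp only [h2] at h1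
  rw [h1]
  simp

theorem extNorm_add_le (s t : ι → ℝ≥0∞) :
    𝒜.extNorm (fun i => s i + t i) ≤ 𝒜.extNorm s + 𝒜.extNorm t := by
  rcases eq_or_ne (𝒜.extNorm s) ⊤ with hs | hs
  · simp [hs]
  rcases eq_or_ne (𝒜.extNorm t) ⊤ with ht | ht
  · simp [ht]
  obtain ⟨a, -, ha, ha'⟩ := exists_rep (lt_top_iff_ne_top.2 hs)
  obtain ⟨b, -, hb, hb'⟩ := exists_rep (lt_top_iff_ne_top.2 ht)
  have hs' := (extNorm_lt_top_iff.1 (lt_top_iff_ne_top.2 hs)).1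
  have ht' := (extNorm_lt_top_iff.1 (lt_top_iff_ne_top.2 ht)).1
  rw [ha', hb', ← ENNReal.ofReal_add (apply_nonneg _ _) (apply_nonneg _ _)]
  refine le_trans (le_of_eq ?_) (ENNReal.ofReal_le_ofReal (map_add_le_add 𝒜.nrm a b))
  rw [← extNorm_enorm]
  congr 1
  funext i
  rw [Submodule.coe_add, Pi.add_apply, ha, hb, ← Complex.ofReal_add,
    ← ENNReal.toReal_add (hs' i) (ht' i), enorm_coe_toReal]
  exact ENNReal.add_ne_top.2 ⟨hs' i, ht' i⟩

theorem extNorm_finset_sum_le {κ : Type*} (F : Finset κ) (s : κ → ι → ℝ≥0∞) :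
    𝒜.extNorm (fun i => ∑ k ∈ F, s k i) ≤ ∑ k ∈ F, 𝒜.extNorm (s k) := by
  classical
  induction F using Finset.induction_on with
  | empty => simp [extNorm_zero]
  | insert k F hk ih =>
    simp only [Finset.sum_insert hk]
    exact (extNorm_add_le _ _).trans (by gcongr)

/-- The sequence that is one at a point and zero elsewhere. -/
def delta [DecidableEq ι] (l : ι) : ι → ℝ≥0∞ := Pi.single l 1

theorem extNorm_delta_lt_top [DecidableEq ι] (h : ∀ c : ι → ℂ, c.support.Finite → c ∈ 𝒜.carrier)
    (l : ι) : 𝒜.extNorm (delta l) < ⊤ := by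
  refine extNorm_lt_top_iff.2 ⟨fun i => ?_, h _ ((Set.finite_singleton l).subset fun i hi => ?_)⟩
  · by_cases hi : i = l <;> simp [delta, hi]
  · by_contra hil
    simp [delta, Pi.single_apply, show i ≠ l from hil] at hi

theorem extNorm_delta_pos [DecidableEq ι] (l : ι) : 0 < 𝒜.extNorm (delta l) := by
  rcases eq_or_ne (𝒜.extNorm (delta l)) ⊤ with hs | hs
  · rw [hs]; exact ENNReal.zero_lt_top
  obtain ⟨c, -, hc, hn⟩ := exists_rep (lt_top_iff_ne_top.2 hs)
  rw [hn, ENNReal.ofReal_pos]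
  refine lt_of_le_of_ne (apply_nonneg _ _) fun h0 => ?_
  have := congrArg (fun x : 𝒜.carrier => (x : ι → ℂ) l) (𝒜.eq_zero_of_nrm c h0.symm)
  simp [hc, delta] at this

/-- Solidity applied to s(l) δ_l ≤ s. Since ‖δ_l‖ > 0, point evaluations are bounded. -/
theorem mul_extNorm_delta_le [DecidableEq ι] (s : ι → ℝ≥0∞) (l : ι) :
    s l * 𝒜.extNorm (delta l) ≤ 𝒜.extNorm s := by
  rcases eq_or_ne (𝒜.extNorm s) ⊤ with hs | hs
  · rw [hs]; exact le_top
  have h1 := (extNorm_lt_top_iff.1 (lt_top_iff_ne_top.2 hs)).1 l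
  rcases eq_or_ne (s l) 0 with h0 | h0
  · simp [h0]
  have h2 : 𝒜.extNorm (delta l) ≤ ((s l).toNNReal⁻¹ : ℝ≥0) * 𝒜.extNorm s := by
    refine le_trans (extNorm_mono fun i => ?_) (extNorm_const_mul_le _ _)
    rw [ENNReal.coe_inv (by simp [ENNReal.toNNReal_eq_zero_iff, h0, h1]), ENNReal.coe_toNNReal h1]
    by_cases hi : i = l
    · subst hi; simp [delta, ENNReal.inv_mul_cancel h0 h1]
    · simp [delta, hi]
  calc _ ≤ s l * (((s l).toNNReal⁻¹ : ℝ≥0) * 𝒜.extNorm s) := by gcongr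
    _ = _ := by rw [ENNReal.coe_inv (by simp [ENNReal.toNNReal_eq_zero_iff, h0, h1]), ENNReal.coe_toNNReal h1,
        ← mul_assoc, ENNReal.mul_inv_cancel h0 h1, one_mul]

/-- Absolutely convergent series converge in a solid Banach space. -/
theorem extNorm_tsum_le (hfin : ∀ c : ι → ℂ, c.support.Finite → c ∈ 𝒜.carrier)
    (s : ℕ → ι → ℝ≥0∞) : 𝒜.extNorm (fun i => ∑' n, s n i) ≤ ∑' n, 𝒜.extNorm (s n) := by
  classical
  rcases eq_or_ne (∑' n, 𝒜.extNorm (s n)) ⊤ with hs | hs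
  · rw [hs]; exact le_top
  have hfinite : ∀ n, 𝒜.extNorm (s n) < ⊤ := fun n =>
    lt_top_iff_ne_top.2 (ne_top_of_le_ne_top hs (ENNReal.le_tsum n))
  choose c hc hc' hn using fun n => exists_rep (hfinite n)
  let u : ℕ → 𝒜.carrier := fun n => ∑ k ∈ Finset.range n, c k
  have hr : ∀ n, 𝒜.nrm (c n) = (𝒜.extNorm (s n)).toReal := fun n => by
    rw [hn, ENNReal.toReal_ofReal (apply_nonneg _ _)]
  have hsum : Summable fun n => 𝒜.nrm (c n) := by
    simp only [hr]; exact ENNReal.summable_toReal hs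
  have hdiff : ∀ m n, m ≤ n → 𝒜.nrm (u n - u m) ≤ ∑ k ∈ Finset.Ico m n, 𝒜.nrm (c k) := by
    intro m n hmn
    rw [← Finset.sum_Ico_eq_sub _ hmn]
    exact Finset.le_sum_of_subadditive _ (map_zero 𝒜.nrm).le (map_add_le_add 𝒜.nrm) _ _
  have hcau : CauchySeq fun n => ∑ k ∈ Finset.range n, 𝒜.nrm (c k) :=
    hsum.hasSum.tendsto_sum_nat.cauchySeq
  obtain ⟨a, ha⟩ := 𝒜.complete u (by
    intro ε hε
    obtain ⟨N, hN⟩ := Metric.cauchySeq_iff.1 hcau ε hε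
    have aux : ∀ m ≥ N, ∀ n ≥ N, m ≤ n → 𝒜.nrm (u n - u m) < ε := by
      intro m hm n hn hmn
      refine (hdiff m n hmn).trans_lt ?_
      rw [Finset.sum_Ico_eq_sub _ hmn]
      exact (le_abs_self _).trans_lt (hN n hn m hm)
    refine ⟨N, fun m hm n hn => ?_⟩
    rcases le_total m n with h | h
    · rw [map_sub_rev]; exact aux m hm n hn h
    · exact aux n hn m hm h)
  -- Point evaluations are continuous for the norm, so the limit supplied by completeness is the
  -- pointwise sum of the series.
  have hcoord : ∀ (b : 𝒜.carrier) i, ‖(b : ι → ℂ) i‖ * (𝒜.extNorm (delta i)).toReal ≤ 𝒜.nrm b := by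
    intro b i
    have := mul_extNorm_delta_le (𝒜 := 𝒜) (fun i => ‖(b : ι → ℂ) i‖ₑ) i
    rw [extNorm_enorm] at this
    have := ENNReal.toReal_mono (by simp) this
    simpa [ENNReal.toReal_mul, ENNReal.toReal_ofReal (apply_nonneg 𝒜.nrm b)] using this
  have hdpos : ∀ i, 0 < (𝒜.extNorm (delta i)).toReal := fun i =>
    ENNReal.toReal_pos (extNorm_delta_pos i).ne' (extNorm_delta_lt_top hfin i).ne
  have hlim : ∀ i, Tendsto (fun n => (u n : ι → ℂ) i) atTop (𝓝 ((a : ι → ℂ) i)) := by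
    intro i
    rw [tendsto_iff_norm_sub_tendsto_zero]
    refine squeeze_zero (fun _ => norm_nonneg _) (fun n => ?_)
      (by simpa using ha.div_const (𝒜.extNorm (delta i)).toReal)
    rw [le_div_iff₀ (hdpos i)]
    exact hcoord (u n - a) i
  have hu : ∀ n i, (u n : ι → ℂ) i = ((∑ k ∈ Finset.range n, s k i).toReal : ℂ) := by
    intro n i
    rw [ENNReal.toReal_sum fun k _ => (extNorm_lt_top_iff.1 (hfinite k)).1 i]
    simp [u, hc']
  have hkey : ∀ i, ∑' n, s n i = ‖(a : ι → ℂ) i‖ₑ := by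
    intro i
    have h1 : Tendsto (fun n => ‖(u n : ι → ℂ) i‖ₑ) atTop (𝓝 ‖(a : ι → ℂ) i‖ₑ) :=
      (continuous_enorm.tendsto _).comp (hlim i)
    refine tendsto_nhds_unique ENNReal.summable.hasSum.tendsto_sum_nat (h1.congr fun n => ?_)
    rw [hu, enorm_coe_toReal]
    exact ENNReal.sum_ne_top.2 fun k _ => (extNorm_lt_top_iff.1 (hfinite k)).1 i
  have hua : Tendsto (fun n => 𝒜.nrm (u n)) atTop (𝓝 (𝒜.nrm a)) := by
    rw [tendsto_iff_norm_sub_tendsto_zero]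
    refine squeeze_zero (fun _ => norm_nonneg _) (fun n => ?_) ha
    exact abs_sub_map_le_sub 𝒜.nrm (u n) a
  simp only [hkey, extNorm_enorm]
  refine ENNReal.ofReal_le_of_le_toReal ?_
  rw [ENNReal.tsum_toReal_eq fun n => (hfinite n).ne]
  refine le_of_tendsto hua (Eventually.of_forall fun n => ?_)
  refine (Finset.le_sum_of_subadditive 𝒜.nrm (map_zero 𝒜.nrm).le (map_add_le_add 𝒜.nrm) _ _).trans ?_
  simp only [← hr]
  exact hsum.sum_le_tsum _ fun _ _ => apply_nonneg _ _

end Solid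

/-! ### Convolution algebras and their embedding into ℓ¹ -/

section Conv

variable {ι : Type*} [AddCommGroup ι] {𝒜 𝒴 : SolidBanachSpace ι}

/-- The convolution of sequences with values in `[0, ∞]`. -/
def econv (a b : ι → ℝ≥0∞) (l : ι) : ℝ≥0∞ := ∑' m, a m * b (l - m)

/-- For nonnegative finite sequences the complex convolution series has the same terms as the [0,
∞]-valued one, and the summability contained in `ConvActs` identifies the sums. -/
theorem extNorm_econv_le {K : ℝ≥0} (h : ConvActs K 𝒜 𝒴) {a b : ι → ℝ≥0∞}
    (ha : 𝒜.extNorm a < ⊤) (hb : 𝒴.extNorm b < ⊤) :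
    𝒴.extNorm (econv a b) ≤ K * 𝒜.extNorm a * 𝒴.extNorm b := by
  obtain ⟨α, hα, hα', hαn⟩ := exists_rep ha
  obtain ⟨β, hβ, hβ', hβn⟩ := exists_rep hb
  obtain ⟨h1, h2, h3⟩ := h α β
  have hconv : ∀ l, econv a b l = ‖conv (α : ι → ℂ) β l‖ₑ := by
    intro l
    have hterm : ∀ m, (α : ι → ℂ) m * (β : ι → ℂ) (l - m) =
        ((a m * b (l - m)).toReal : ℂ) := fun m => by
      rw [hα', hβ', ENNReal.toReal_mul]; push_cast; rfl
    have hfin : ∀ m, a m * b (l - m) ≠ ⊤ := fun m =>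
      ENNReal.mul_ne_top ((extNorm_lt_top_iff.1 ha).1 _) ((extNorm_lt_top_iff.1 hb).1 _)
    have h4 := h1 l
    simp only [hterm] at h4
    have h5 : Summable fun m => (a m * b (l - m)).toReal := by exact_mod_cast h4
    rw [conv, econv]
    simp only [hterm]
    rw [← Complex.ofReal_tsum,
      enorm_ofReal_of_nonneg (tsum_nonneg fun _ => ENNReal.toReal_nonneg),
      ENNReal.ofReal_tsum_of_nonneg (fun _ => ENNReal.toReal_nonneg) h5]
    exact tsum_congr fun m => (ENNReal.ofReal_toReal (hfin m)).symm
  rw [hαn, hβn, show econv a b = fun l => ‖conv (α : ι → ℂ) β l‖ₑ from funext hconv,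
    ← ofReal_nrm h2]
  refine (ENNReal.ofReal_le_ofReal h3).trans (le_of_eq ?_)
  rw [ENNReal.ofReal_mul (by positivity), ENNReal.ofReal_mul (by positivity),
    ENNReal.ofReal_coe_nnreal]

theorem extNorm_comp_neg_le (h : 𝒜.IsInvolutiveConvAlgebra) (s : ι → ℝ≥0∞) :
    𝒜.extNorm (fun l => s (-l)) ≤ 𝒜.extNorm s := by
  rcases eq_or_ne (𝒜.extNorm s) ⊤ with hs | hs
  · rw [hs]; exact le_top
  obtain ⟨a, ha, -, hn⟩ := exists_rep (lt_top_iff_ne_top.2 hs)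
  obtain ⟨h1, h2⟩ := h.star_bound a
  rw [hn]
  refine le_trans (le_of_eq ?_) (ENNReal.ofReal_le_ofReal h2)
  rw [ofReal_nrm]
  simp [ha]

theorem econv_delta [DecidableEq ι] (m : ι) (b : ι → ℝ≥0∞) :
    econv (delta m) b = fun l => b (l - m) := by
  funext l
  rw [econv, tsum_eq_single m]
  · simp [delta]
  · intro m' hm'; simp [delta, hm']

theorem econv_comm (a b : ι → ℝ≥0∞) : econv a b = econv b a := by
  funext l
  rw [econv, econv, ← (Equiv.subLeft l).tsum_eq]
  exact tsum_congr fun m => by simp [mul_comm]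

theorem tsum_econv (a b : ι → ℝ≥0∞) : ∑' l, econv a b l = (∑' l, a l) * ∑' l, b l := by
  simp only [econv]
  rw [ENNReal.tsum_comm, ← ENNReal.tsum_mul_right]
  refine tsum_congr fun m => ?_
  rw [ENNReal.tsum_mul_left, ← (Equiv.subRight m).tsum_eq b]
  simp

theorem extNorm_translate_le [DecidableEq ι] (h : 𝒜.IsInvolutiveConvAlgebra) (m : ι)
    (s : ι → ℝ≥0∞) (hs : 𝒜.extNorm s < ⊤) :
    𝒜.extNorm (fun l => s (l - m)) ≤ 𝒜.extNorm (delta m) * 𝒜.extNorm s := by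
  have := extNorm_econv_le h.conv_bound (extNorm_delta_lt_top h.mem_of_finite_support m) hs
  simpa [econv_delta] using this

theorem extNorm_delta_add_le [DecidableEq ι] (h : 𝒜.IsInvolutiveConvAlgebra) (l m : ι) :
    𝒜.extNorm (delta (l + m)) ≤ 𝒜.extNorm (delta l) * 𝒜.extNorm (delta m) := by
  have := extNorm_translate_le h l (delta m) (extNorm_delta_lt_top h.mem_of_finite_support m)
  refine le_trans (le_of_eq ?_) this
  congr 1
  funext i
  simp only [delta, Pi.single_apply]
  congr 1
  rw [sub_eq_iff_eq_add, add_comm m l]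

/-- From δ₀ = δ_l ∗ δ_{-l}, with ‖δ_{-l}‖ ≤ ‖δ_l‖ by the involution. It serves as a lower bound for
‖δ_l‖ that is uniform in l. -/
theorem extNorm_delta_zero_le [DecidableEq ι] (h : 𝒜.IsInvolutiveConvAlgebra) (l : ι) :
    𝒜.extNorm (delta 0) ≤ 𝒜.extNorm (delta l) ^ 2 := by
  have h1 := extNorm_delta_add_le h l (-l)
  have h2 : 𝒜.extNorm (delta (-l)) ≤ 𝒜.extNorm (delta l) := by
    refine le_trans (le_of_eq ?_) (extNorm_comp_neg_le h (delta l))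
    congr 1
    funext i
    simp only [delta, Pi.single_apply]
    congr 1
    rw [neg_eq_iff_eq_neg]
  rw [add_neg_cancel] at h1
  rw [sq]
  exact h1.trans (by gcongr)

/-- If S > A > 0, then (S/A)ⁿ outgrows every polynomial in n. The case A = 0 is already excluded by
n = 1. -/
theorem le_of_forall_pow_le {S A ε : ℝ} (hA : 0 ≤ A) (hε : 0 < ε) (k : ℕ)
    (h : ∀ n : ℕ, 1 ≤ n → S ^ n * ε ≤ (n + 1) ^ k * A ^ n) : S ≤ A := by
  by_contra! hlt
  rcases hA.eq_or_lt with rfl | hA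
  · have := h 1 le_rfl
    simp only [pow_one, mul_zero] at this
    nlinarith [mul_pos hlt hε]
  have hr : 1 < S / A := (one_lt_div hA).2 hlt
  have h1 := tendsto_pow_const_div_const_pow_of_one_lt k hr
  have h2 : ∀ n : ℕ, 1 ≤ n → ε ≤ 2 ^ k * ((n : ℝ) ^ k / (S / A) ^ n) := by
    intro n hn
    have hn' : (1 : ℝ) ≤ n := by exact_mod_cast hn
    have h3 : ((n : ℝ) + 1) ^ k ≤ 2 ^ k * (n : ℝ) ^ k := by
      rw [← mul_pow]; exact pow_le_pow_left₀ (by positivity) (by linarith) _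
    have hSn : 0 < S ^ n := pow_pos (hA.trans hlt) _
    rw [div_pow, div_div_eq_mul_div, ← mul_div_assoc, le_div_iff₀ hSn, ← mul_assoc]
    calc ε * S ^ n = S ^ n * ε := mul_comm _ _
      _ ≤ _ := h n hn
      _ ≤ _ := by gcongr
  have h3 := ge_of_tendsto (h1.const_mul (2 ^ k)) (eventually_atTop.2 ⟨1, h2⟩)
  simp at h3
  linarith

/-- Power trick: under n-fold convolution the mass ∑ a is exactly multiplicative and the norm
submultiplicative. The support of the power has only polynomially many points, and each coefficient
is at most a fixed constant times ‖a‖ⁿ. Thus (∑ a)ⁿ is bounded by a polynomial in n times ‖a‖ⁿ, and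
taking n-th roots removes the polynomial. -/
theorem tsum_le_extNorm_of_finite (h : 𝒜.IsInvolutiveConvAlgebra) (F : Finset ι)
    (a : ι → ℝ≥0∞) (ha : ∀ l ∉ F, a l = 0) (hfin : 𝒜.extNorm a < ⊤) :
    ∑' l, a l ≤ 𝒜.extNorm a := by
  classical
  -- `p n` is the convolution power with n + 1 factors.
  let p : ℕ → ι → ℝ≥0∞ := fun n => Nat.rec a (fun _ q => econv a q) n
  have hp : ∀ n, p (n + 1) = econv a (p n) := fun n => rfl
  have hsum : ∀ n, ∑' l, p n l = (∑' l, a l) ^ (n + 1) := by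
    intro n
    induction n with
    | zero => simp [p]
    | succ n ih => rw [hp, tsum_econv, ih]; ring
  have hnorm : ∀ n, 𝒜.extNorm (p n) ≤ 𝒜.extNorm a ^ (n + 1) := by
    intro n
    induction n with
    | zero => simp [p]
    | succ n ih =>
      have h1 := extNorm_econv_le h.conv_bound hfin
        (ih.trans_lt (ENNReal.pow_lt_top hfin))
      rw [hp, pow_succ, mul_comm]
      refine h1.trans ?_
      rw [ENNReal.coe_one, one_mul]
      gcongr
  -- A sum of n + 1 elements of F is determined by multiplicities between 0 and n + 1, hence there
  -- are at most (n + 2)^|F| such sums, independently of the group.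
  let T : ℕ → Finset ι := fun n =>
    (Fintype.piFinset fun _ : F => Finset.range (n + 2)).image fun k => ∑ f : F, k f • (f : ι)
  have hT : ∀ n, (T n).card ≤ (n + 2) ^ F.card := fun n => by
    refine Finset.card_image_le.trans (le_of_eq ?_)
    simp
  have hsupp : ∀ n, ∀ l ∉ T n, p n l = 0 := by
    intro n
    induction n with
    | zero =>
      intro l hl
      refine ha l fun hlF => hl ?_
      refine Finset.mem_image.2 ⟨Pi.single ⟨l, hlF⟩ 1, ?_, ?_⟩
      · rw [Fintype.mem_piFinset]
        intro f
        by_cases hf : f = ⟨l, hlF⟩ <;> simp [hf]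
      · rw [Finset.sum_eq_single ⟨l, hlF⟩]
        · simp
        · intro f _ hf; simp [hf]
        · simp
    | succ n ih =>
      intro l hl
      rw [hp, econv, ENNReal.tsum_eq_zero]
      intro m
      by_cases hm : m ∈ F
      · rw [ih, mul_zero]
        intro hlm
        obtain ⟨k, hk, hk'⟩ := Finset.mem_image.1 hlm
        refine hl (Finset.mem_image.2 ⟨k + Pi.single ⟨m, hm⟩ 1, ?_, ?_⟩)
        · rw [Fintype.mem_piFinset] at hk ⊢
          intro f
          have := Finset.mem_range.1 (hk f)
          rw [Finset.mem_range, Pi.add_apply, Pi.single_apply]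
          split_ifs <;> omega
        · simp only [Pi.add_apply, add_smul, Finset.sum_add_distrib]
          rw [hk', Finset.sum_eq_single (⟨m, hm⟩ : F) (by
            intro f _ hf; simp [hf]) (by simp)]
          simp
      · rw [ha m hm, zero_mul]
  have hS : ∑' l, a l ≠ ⊤ := by
    rw [tsum_eq_sum (s := F) ha]
    exact ENNReal.sum_ne_top.2 fun l _ => (extNorm_lt_top_iff.1 hfin).1 l
  have hD0 := extNorm_delta_pos (𝒜 := 𝒜) (0 : ι)
  have hD0' := (extNorm_delta_lt_top h.mem_of_finite_support (0 : ι)).ne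
  set D := (𝒜.extNorm (delta (0 : ι))).toReal with hD
  have hDpos : 0 < D := ENNReal.toReal_pos hD0.ne' hD0'
  rw [← ENNReal.toReal_le_toReal hS hfin.ne]
  refine le_of_forall_pow_le ENNReal.toReal_nonneg
    (Real.sqrt_pos.2 hDpos) F.card fun n hn => ?_
  obtain ⟨n, rfl⟩ : ∃ k, n = k + 1 := ⟨n - 1, by omega⟩
  -- Each coefficient is at most ‖p n‖ / ‖δ_l‖, and ‖δ_l‖ ≥ √‖δ₀‖ for all l.
  have hcoeff : ∀ l, (p n l).toReal * √D ≤ (𝒜.extNorm a).toReal ^ (n + 1) := by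
    intro l
    have h1 := (mul_extNorm_delta_le (𝒜 := 𝒜) (p n) l).trans (hnorm n)
    have h2 := ENNReal.toReal_mono (ENNReal.pow_ne_top hfin.ne) h1
    rw [ENNReal.toReal_mul, ENNReal.toReal_pow] at h2
    refine le_trans ?_ h2
    gcongr
    rw [Real.sqrt_le_left ENNReal.toReal_nonneg, ← ENNReal.toReal_pow]
    exact ENNReal.toReal_mono (ENNReal.pow_ne_top
      (extNorm_delta_lt_top h.mem_of_finite_support l).ne) (extNorm_delta_zero_le h l)
  have hpn : ∀ l, p n l ≠ ⊤ := fun l =>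
    (extNorm_lt_top_iff.1 ((hnorm n).trans_lt (ENNReal.pow_lt_top hfin))).1 l
  have h3 : (∑' l, a l).toReal ^ (n + 1) = ∑ l ∈ T n, (p n l).toReal := by
    rw [← ENNReal.toReal_pow, ← hsum, tsum_eq_sum (hsupp n), ENNReal.toReal_sum fun l _ => hpn l]
  rw [h3, Finset.sum_mul]
  refine (Finset.sum_le_card_nsmul _ _ _ fun l _ => hcoeff l).trans ?_
  rw [nsmul_eq_mul]
  gcongr
  have := hT n
  push_cast
  calc ((T n).card : ℝ) ≤ ((n + 2 : ℕ) : ℝ) ^ F.card := by exact_mod_cast this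
    _ = _ := by push_cast; ring

/-- A solid involutive convolution algebra is contained in `ℓ¹`. -/
theorem tsum_le_extNorm (h : 𝒜.IsInvolutiveConvAlgebra) (a : ι → ℝ≥0∞) :
    ∑' l, a l ≤ 𝒜.extNorm a := by
  classical
  rcases eq_or_ne (𝒜.extNorm a) ⊤ with hs | hs
  · rw [hs]; exact le_top
  -- Partial sums over a finite F are handled by truncating a to F, which does not increase the
  -- norm, by solidity.
  rw [ENNReal.tsum_eq_iSup_sum]
  refine iSup_le fun F => ?_
  have h1 : 𝒜.extNorm ((F : Set ι).indicator a) ≤ 𝒜.extNorm a :=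
    extNorm_mono fun l => Set.indicator_le_self _ _ _
  have h2 := tsum_le_extNorm_of_finite h F ((F : Set ι).indicator a)
    (fun l hl => Set.indicator_of_notMem (by simpa using hl) _)
    (h1.trans_lt (lt_top_iff_ne_top.2 hs))
  refine le_trans ?_ (h2.trans h1)
  rw [tsum_eq_sum (s := F) fun l hl => Set.indicator_of_notMem (by simpa using hl) _]
  exact Finset.sum_le_sum fun l hl => by rw [Set.indicator_of_mem (by simpa using hl)]

end Conv

end SolidBanachSpace

end WeylGabor

end

noncomputable section

namespace WeylGabor

open SolidBanachSpace

instance isAddHaarMeasure_phase (d : ℕ) : (volume : Measure (Phase d)).IsAddHaarMeasure :=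
  inferInstanceAs ((volume : Measure (Eu d)).prod (volume : Measure (Eu d))).IsAddHaarMeasure

instance isNegInvariant_phase (d : ℕ) : (volume : Measure (Phase d)).IsNegInvariant :=
  Measure.IsAddHaarMeasure.isNegInvariant_of_regular _

/-! ### Amalgam spaces -/

section Amalgam

variable {d : ℕ} {Λ : Submodule ℤ (Phase d)} {C : Set (Phase d)}

/-- The cell `l + C`. -/
def cell (C : Set (Phase d)) (l : Λ) : Set (Phase d) := {ζ | ζ - (l : Phase d) ∈ C}

/-- The essential supremum of a function over the cell `l + C`. -/
def cellSup (C : Set (Phase d)) (F : Phase d → ℝ≥0∞) (l : Λ) : ℝ≥0∞ :=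
  essSup F (volume.restrict (cell C l))

theorem amalgamNorm_eq (𝒜 : SolidBanachSpace Λ) (C : Set (Phase d)) (F : Phase d → ℝ≥0∞) :
    amalgamNorm 𝒜 C F = 𝒜.extNorm (cellSup C F) := rfl

theorem finite_norm_le [DiscreteTopology Λ] (R : ℝ) : {l : Λ | ‖(l : Phase d)‖ ≤ R}.Finite := by
  have : DiscreteTopology Λ.toAddSubgroup := inferInstanceAs (DiscreteTopology Λ)
  have h := AddSubgroup.tendsto_coe_cofinite_of_discrete Λ.toAddSubgroup ⟨this⟩
  have h2 : (Metric.closedBall (0 : Phase d) R)ᶜ ∈ cocompact (Phase d) :=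
    (isCompact_closedBall _ _).compl_mem_cocompact
  have h3 := h h2
  rw [mem_map, mem_cofinite] at h3
  refine h3.subset fun l hl => ?_
  have hl' : ‖(l : Phase d)‖ ≤ R := hl
  simpa using hl'

theorem nullMeasurableSet_cell (hC : IsFundamentalCell Λ C) (l : Λ) :
    NullMeasurableSet (cell C l) volume :=
  hC.isAddFundamentalDomain.nullMeasurableSet.preimage
    (measurePreserving_sub_right volume (l : Phase d)).quasiMeasurePreserving

theorem volume_cell (hC : IsFundamentalCell Λ C) (l : Λ) : volume (cell C l) = volume C :=
  (measurePreserving_sub_right volume (l : Phase d)).measure_preimage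
    hC.isAddFundamentalDomain.nullMeasurableSet

theorem volume_C_lt_top (hC : IsFundamentalCell Λ C) : volume C < ⊤ := hC.isBounded.measure_lt_top

theorem ae_exists_cell (hC : IsFundamentalCell Λ C) :
    ∀ᵐ ζ : Phase d, ∃ l : Λ, ζ ∈ cell C l := by
  filter_upwards [hC.isAddFundamentalDomain.ae_covers] with ζ ⟨l, hl⟩
  refine ⟨-l, ?_⟩
  have : ζ - ((-l : Λ) : Phase d) = l +ᵥ ζ := by
    rw [Submodule.vadd_def, vadd_eq_add]; push_cast; abel
  change ζ - ((-l : Λ) : Phase d) ∈ C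
  rwa [this]

theorem ae_le_cellSup [Countable Λ] (hC : IsFundamentalCell Λ C) (F : Phase d → ℝ≥0∞) :
    ∀ᵐ ζ : Phase d, ∀ l : Λ, ζ ∈ cell C l → F ζ ≤ cellSup C F l :=
  ae_all_iff.2 fun l => (ae_restrict_iff'₀ (nullMeasurableSet_cell hC l)).1
    (ENNReal.ae_le_essSup F)

theorem cellSup_le (hC : IsFundamentalCell Λ C) {F : Phase d → ℝ≥0∞} {l : Λ} {c : ℝ≥0∞}
    (h : ∀ᵐ ζ : Phase d, ζ ∈ cell C l → F ζ ≤ c) : cellSup C F l ≤ c :=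
  essSup_le_of_ae_le c ((ae_restrict_iff'₀ (nullMeasurableSet_cell hC l)).2 h)

theorem amalgamNorm_mono_ae {𝒜 : SolidBanachSpace Λ} {F G : Phase d → ℝ≥0∞}
    (h : ∀ᵐ ζ, F ζ ≤ G ζ) : amalgamNorm 𝒜 C F ≤ amalgamNorm 𝒜 C G :=
  extNorm_mono fun _ => essSup_mono_ae (ae_restrict_of_ae h)

theorem amalgamNorm_mono {𝒜 : SolidBanachSpace Λ} {F G : Phase d → ℝ≥0∞}
    (h : ∀ ζ, F ζ ≤ G ζ) : amalgamNorm 𝒜 C F ≤ amalgamNorm 𝒜 C G :=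
  amalgamNorm_mono_ae (ae_of_all _ h)

theorem amalgamNorm_const_mul_le {𝒜 : SolidBanachSpace Λ} (k : ℝ≥0) (F : Phase d → ℝ≥0∞) :
    amalgamNorm 𝒜 C (fun ζ => k * F ζ) ≤ k * amalgamNorm 𝒜 C F := by
  refine le_trans (extNorm_mono fun l => ?_) (extNorm_const_mul_le k (cellSup C F))
  exact le_of_eq ENNReal.essSup_const_mul

/-- The cells cover almost everything and all have the volume of C, so the integral is at most |C|
times the ℓ¹-norm of the cell suprema, and 𝒜 embeds into ℓ¹. -/
theorem lintegral_le_amalgamNorm [Countable Λ] (hC : IsFundamentalCell Λ C)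
    {𝒜 : SolidBanachSpace Λ} (h𝒜 : 𝒜.IsInvolutiveConvAlgebra) (F : Phase d → ℝ≥0∞) :
    ∫⁻ ζ, F ζ ≤ volume C * amalgamNorm 𝒜 C F := by
  have h1 : (Set.univ : Set (Phase d)) =ᵐ[volume] ⋃ l : Λ, cell C l := by
    refine (eventuallyEq_univ.2 ?_).symm
    filter_upwards [ae_exists_cell hC] with ζ hζ using Set.mem_iUnion.2 hζ
  calc ∫⁻ ζ, F ζ = ∫⁻ ζ in ⋃ l : Λ, cell C l, F ζ := by
        rw [← setLIntegral_univ, setLIntegral_congr h1]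
    _ ≤ ∑' l : Λ, ∫⁻ ζ in cell C l, F ζ := lintegral_iUnion_le _ _
    _ ≤ ∑' l : Λ, volume C * cellSup C F l := by
        refine ENNReal.tsum_le_tsum fun l => ?_
        calc _ ≤ ∫⁻ ζ in cell C l, cellSup C F l :=
              lintegral_mono_ae (ENNReal.ae_le_essSup F)
          _ = _ := by rw [setLIntegral_const, volume_cell hC, mul_comm]
    _ = volume C * ∑' l : Λ, cellSup C F l := ENNReal.tsum_mul_left
    _ ≤ _ := by gcongr; exact tsum_le_extNorm h𝒜 _

/-- If F(l) exceeded the essential supremum, an open superlevel set around l would meet l + C only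
in a null set; `pos_near_zero`, translated by l, forbids this. -/
theorem le_cellSup_of_lowerSemicontinuous (hC : IsFundamentalCell Λ C) {F : Phase d → ℝ≥0∞}
    (hF : LowerSemicontinuous F) (l : Λ) : F l ≤ cellSup C F l := by
  by_contra! hlt
  have hopen : IsOpen {ξ | cellSup C F l < F ξ} := hF.isOpen_preimage _
  have hU : {ξ : Phase d | cellSup C F l < F (ξ + l)} ∈ 𝓝 (0 : Phase d) := by
    refine (hopen.preimage (continuous_add_const (l : Phase d))).mem_nhds ?_
    simpa using hlt
  have hpos := hC.pos_near_zero _ hU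
  have hpre : {ξ : Phase d | cellSup C F l < F (ξ + l)} ∩ C =
      (fun ξ : Phase d => ξ + l) ⁻¹' ({ξ | cellSup C F l < F ξ} ∩ cell C l) := by
    ext ξ; simp [cell]
  rw [hpre, (measurePreserving_add_right volume (l : Phase d)).measure_preimage
    (hopen.measurableSet.nullMeasurableSet.inter (nullMeasurableSet_cell hC l))] at hpos
  refine hpos.ne' ?_
  have h := (ae_restrict_iff'₀ (nullMeasurableSet_cell hC l)).1
    (ENNReal.ae_le_essSup (μ := volume.restrict (cell C l)) F)
  refine measure_mono_null (fun ξ hξ => ?_) (ae_iff.1 h)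
  exact fun h' => not_le.2 hξ.1 (h' hξ.2)

/-- The convolution of functions with values in `[0, ∞]`. -/
def lconv (F G : Phase d → ℝ≥0∞) (ζ : Phase d) : ℝ≥0∞ := ∫⁻ z, F z * G (ζ - z)

theorem exists_cell_radius (hC : IsFundamentalCell Λ C) :
    ∃ R : ℝ, ∀ (l : Λ) (ζ : Phase d), ζ ∈ cell C l → ‖ζ - l‖ ≤ R := by
  obtain ⟨R, hR⟩ := hC.isBounded.exists_norm_le
  exact ⟨R, fun l ζ h => hR _ h⟩

/-- Translation by ν is convolution with a unit mass, so it is bounded on 𝒜. Such sums absorb the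
fact that sums and reflections of cells overlap several cells. -/
theorem exists_extNorm_sum_translate_le [DiscreteTopology Λ] {𝒜 : SolidBanachSpace Λ}
    (h𝒜 : 𝒜.IsInvolutiveConvAlgebra) (N : Finset Λ) : ∃ K : ℝ≥0, ∀ b : Λ → ℝ≥0∞,
      𝒜.extNorm b < ⊤ → 𝒜.extNorm (fun l => ∑ ν ∈ N, b (l + ν)) ≤ K * 𝒜.extNorm b := by
  classical
  have hD : ∀ l : Λ, 𝒜.extNorm (delta l) ≠ ⊤ := fun l =>
    (extNorm_delta_lt_top h𝒜.mem_of_finite_support l).ne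
  refine ⟨∑ ν ∈ N, (𝒜.extNorm (delta (-ν))).toNNReal, fun b hb => ?_⟩
  push_cast
  rw [Finset.sum_mul]
  refine (extNorm_finset_sum_le N fun ν l => b (l + ν)).trans (Finset.sum_le_sum fun ν _ => ?_)
  rw [ENNReal.coe_toNNReal (hD _)]
  simpa using extNorm_translate_le h𝒜 (-ν) b hb

/-- If ζ ∈ l + C and z ∈ m + C, then ζ - z lies in a cell k + C with k - (l - m) in a fixed finite
set N. So the cell suprema of F ∗ G are dominated by the discrete convolution of those of F with the
sum of the N-translates of those of G. -/
theorem exists_amalgamNorm_lconv_le [DiscreteTopology Λ] [Countable Λ]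
    (hC : IsFundamentalCell Λ C) {𝒜 : SolidBanachSpace Λ} (h𝒜 : 𝒜.IsInvolutiveConvAlgebra) :
    ∃ K : ℝ≥0, ∀ F G : Phase d → ℝ≥0∞, amalgamNorm 𝒜 C F < ⊤ → amalgamNorm 𝒜 C G < ⊤ →
      amalgamNorm 𝒜 C (lconv F G) ≤ K * amalgamNorm 𝒜 C F * amalgamNorm 𝒜 C G := by
  obtain ⟨R, hR⟩ := exists_cell_radius hC
  let N : Finset Λ := (finite_norm_le (Λ := Λ) (3 * R)).toFinset
  obtain ⟨K, hK⟩ := exists_extNorm_sum_translate_le h𝒜 N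
  refine ⟨(volume C).toNNReal * K, fun F G hF hG => ?_⟩
  rw [amalgamNorm_eq] at hF hG ⊢
  set a := cellSup C F with ha
  set b := cellSup C G with hb
  let b' : Λ → ℝ≥0∞ := fun l => ∑ ν ∈ N, b (l + ν)
  have hb' : 𝒜.extNorm b' ≤ K * 𝒜.extNorm b := hK b hG
  have hb'' : 𝒜.extNorm b' < ⊤ := hb'.trans_lt (ENNReal.mul_lt_top ENNReal.coe_lt_top hG)
  have key : ∀ l : Λ, cellSup C (lconv F G) l ≤ (volume C).toNNReal * econv a b' l := by
    intro l
    refine cellSup_le hC (ae_of_all _ fun ζ hζ => ?_)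
    have h1 : (Set.univ : Set (Phase d)) =ᵐ[volume] ⋃ l : Λ, cell C l := by
      refine (eventuallyEq_univ.2 ?_).symm
      filter_upwards [ae_exists_cell hC] with ζ hζ using Set.mem_iUnion.2 hζ
    have h2 : ∀ᵐ z : Phase d, (∃ k : Λ, ζ - z ∈ cell C k) ∧
        ∀ k : Λ, ζ - z ∈ cell C k → G (ζ - z) ≤ b k :=
      (Measure.measurePreserving_sub_left volume ζ).quasiMeasurePreserving.ae
        ((ae_exists_cell hC).and (ae_le_cellSup hC G))
    calc lconv F G ζ = ∫⁻ z in ⋃ m : Λ, cell C m, F z * G (ζ - z) := by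
          rw [lconv, ← setLIntegral_univ, setLIntegral_congr h1]
      _ ≤ ∑' m : Λ, ∫⁻ z in cell C m, F z * G (ζ - z) := lintegral_iUnion_le _ _
      _ ≤ ∑' m : Λ, volume C * (a m * b' (l - m)) := by
          refine ENNReal.tsum_le_tsum fun m => ?_
          calc _ ≤ ∫⁻ z in cell C m, a m * b' (l - m) := by
                refine lintegral_mono_ae ?_
                filter_upwards [ENNReal.ae_le_essSup (μ := volume.restrict (cell C m)) F,
                  ae_restrict_mem₀ (nullMeasurableSet_cell hC m), ae_restrict_of_ae h2]
                  with z hz1 hz2 hz3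
                obtain ⟨⟨k, hk⟩, hz3⟩ := hz3
                refine mul_le_mul' hz1 ((hz3 k hk).trans ?_)
                -- Each of the three cells involved contributes an error of at most R, which
                -- explains the radius 3R.
                have hkN : k - (l - m) ∈ N := by
                  rw [Set.Finite.mem_toFinset]
                  change ‖((k - (l - m) : Λ) : Phase d)‖ ≤ 3 * R
                  push_cast
                  have e1 := hR l ζ hζ
                  have e2 := hR m z hz2
                  have e3 := hR k _ hk
                  rw [show (k : Phase d) - (l - m) = (ζ - l) - (z - m) - (ζ - z - k) by abel]
                  calc _ ≤ ‖ζ - l‖ + ‖z - m‖ + ‖ζ - z - k‖ :=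
                        (norm_sub_le _ _).trans (by gcongr; exact norm_sub_le _ _)
                    _ ≤ _ := by linarith
                refine le_trans (le_of_eq ?_)
                  (Finset.single_le_sum (fun ν _ => zero_le) hkN)
                congr 1; abel
            _ = _ := by rw [setLIntegral_const, volume_cell hC, mul_comm]
      _ = _ := by
          rw [ENNReal.tsum_mul_left, ENNReal.coe_toNNReal (volume_C_lt_top hC).ne, econv]
  refine (extNorm_mono key).trans ((extNorm_const_mul_le _ _).trans ?_)
  have h3 := extNorm_econv_le h𝒜.conv_bound hF hb''
  calc _ ≤ ((volume C).toNNReal : ℝ≥0∞) * (1 * 𝒜.extNorm a * (K * 𝒜.extNorm b)) := by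
        gcongr
        exact h3.trans (by gcongr; simp)
    _ = _ := by push_cast; rw [amalgamNorm_eq, amalgamNorm_eq]; ring

/-- The reflection of a cell meets, up to a null set, only the cells whose indices lie within 2R of
the reflected index; the involution reflects the index. -/
theorem exists_amalgamNorm_comp_neg_le [DiscreteTopology Λ] [Countable Λ]
    (hC : IsFundamentalCell Λ C) {𝒜 : SolidBanachSpace Λ} (h𝒜 : 𝒜.IsInvolutiveConvAlgebra) :
    ∃ K : ℝ≥0, ∀ F : Phase d → ℝ≥0∞, amalgamNorm 𝒜 C F < ⊤ →
      amalgamNorm 𝒜 C (fun ζ => F (-ζ)) ≤ K * amalgamNorm 𝒜 C F := by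
  obtain ⟨R, hR⟩ := exists_cell_radius hC
  let N : Finset Λ := (finite_norm_le (Λ := Λ) (2 * R)).toFinset
  obtain ⟨K, hK⟩ := exists_extNorm_sum_translate_le h𝒜 N
  refine ⟨K, fun F hF => ?_⟩
  rw [amalgamNorm_eq] at hF ⊢
  let b' : Λ → ℝ≥0∞ := fun l => ∑ ν ∈ N, cellSup C F (l + ν)
  refine le_trans ?_ (hK _ hF)
  refine le_trans (extNorm_mono fun l => ?_) (extNorm_comp_neg_le h𝒜 b')
  have h2 : ∀ᵐ z : Phase d, (∃ k : Λ, -z ∈ cell C k) ∧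
      ∀ k : Λ, -z ∈ cell C k → F (-z) ≤ cellSup C F k :=
    (Measure.measurePreserving_neg volume).quasiMeasurePreserving.ae
      ((ae_exists_cell hC).and (ae_le_cellSup hC F))
  refine cellSup_le hC ?_
  filter_upwards [h2] with z hz hzl
  obtain ⟨⟨k, hk⟩, hz3⟩ := hz
  refine (hz3 k hk).trans ?_
  have hkN : k - -l ∈ N := by
    rw [Set.Finite.mem_toFinset]
    change ‖((k - -l : Λ) : Phase d)‖ ≤ 2 * R
    push_cast
    have e1 := hR l z hzl
    have e3 := hR k _ hk
    rw [show (k : Phase d) - (-l) = - (z - l) - (-z - k) by abel]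
    calc _ ≤ ‖-(z - l)‖ + ‖-z - k‖ := norm_sub_le _ _
      _ ≤ _ := by rw [norm_neg]; linarith
  refine le_trans (le_of_eq ?_) (Finset.single_le_sum (fun ν _ => zero_le) hkN)
  congr 1; abel

/-- The weight l ↦ ‖δ_l‖ is submultiplicative on a finitely generated group, hence at most
exponential in the sum of the absolute values of the coordinates of l; these are bounded by a
multiple of ‖l‖. -/
theorem exists_extNorm_delta_le_exp [DiscreteTopology Λ] [IsZLattice ℝ Λ] [DecidableEq Λ]
    {𝒜 : SolidBanachSpace Λ} (h𝒜 : 𝒜.IsInvolutiveConvAlgebra) :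
    ∃ (M κ : ℝ), 0 ≤ M ∧ 0 ≤ κ ∧
      ∀ l : Λ, 𝒜.extNorm (delta l) ≤ ENNReal.ofReal (M * Real.exp (κ * ‖(l : Phase d)‖)) := by
  have : Module.Free ℤ Λ := ZLattice.module_free ℝ Λ
  have : Module.Finite ℤ Λ := ZLattice.module_finite ℝ Λ
  let b := Module.Free.chooseBasis ℤ Λ
  have hD : ∀ l : Λ, 𝒜.extNorm (delta l) ≠ ⊤ := fun l =>
    (extNorm_delta_lt_top h𝒜.mem_of_finite_support l).ne
  let D : Λ → ℝ := fun l => (𝒜.extNorm (delta l)).toReal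
  have hD0 : ∀ l, 0 ≤ D l := fun l => ENNReal.toReal_nonneg
  have hadd : ∀ l m, D (l + m) ≤ D l * D m := fun l m => by
    rw [← ENNReal.toReal_mul]
    exact ENNReal.toReal_mono (ENNReal.mul_ne_top (hD _) (hD _)) (extNorm_delta_add_le h𝒜 l m)
  -- Q dominates the norms of δ at all basis vectors and their negatives; the summand 1 ensures log
  -- Q ≥ 0.
  let Q : ℝ := 1 + ∑ i, (D (b i) + D (-b i))
  have hQ1 : 1 ≤ Q := le_add_of_nonneg_right (Finset.sum_nonneg fun i _ => add_nonneg (hD0 _) (hD0 _))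
  have hQ : ∀ i, D (b i) + D (-b i) ≤ Q := fun i =>
    (Finset.single_le_sum (f := fun i => D (b i) + D (-b i))
      (fun i _ => add_nonneg (hD0 _) (hD0 _)) (Finset.mem_univ i)).trans
      (le_add_of_nonneg_left zero_le_one)
  have hnat : ∀ (x y : Λ) (n : ℕ), D y ≤ Q → D (x + n • y) ≤ D x * Q ^ n := by
    intro x y n hy
    induction n with
    | zero => simp
    | succ n ih =>
      rw [succ_nsmul, ← add_assoc, pow_succ, ← mul_assoc]
      exact (hadd _ _).trans (mul_le_mul ih hy (hD0 _) (by have := hD0 x; positivity))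
  have hint : ∀ (x : Λ) (i) (n : ℤ), D (x + n • b i) ≤ D x * Q ^ n.natAbs := by
    intro x i n
    rcases Int.natAbs_eq n with h | h
    · nth_rewrite 1 [h]
      rw [natCast_zsmul]
      exact hnat _ _ _ (by linarith [hQ i, hD0 (-b i)])
    · nth_rewrite 1 [h]
      rw [neg_smul, ← smul_neg, natCast_zsmul]
      exact hnat _ _ _ (by linarith [hQ i, hD0 (b i)])
  have hsum : ∀ (s : Finset (Module.Free.ChooseBasisIndex ℤ Λ))
      (n : Module.Free.ChooseBasisIndex ℤ Λ → ℤ),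
      D (∑ i ∈ s, n i • b i) ≤ D 0 * Q ^ (∑ i ∈ s, (n i).natAbs) := by
    intro s n
    classical
    induction s using Finset.induction_on with
    | empty => simp
    | insert i s hi ih =>
      rw [Finset.sum_insert hi, Finset.sum_insert hi, add_comm, add_comm (n i).natAbs, pow_add,
        ← mul_assoc]
      refine (hint _ _ _).trans ?_
      gcongr
  set r := (ZLattice.normBound b)⁻¹ with hr
  have hr0 : 0 ≤ r := inv_nonneg.2 (ZLattice.normBound_pos b).le
  let n₀ := Fintype.card (Module.Free.ChooseBasisIndex ℤ Λ)
  refine ⟨D 0, Real.log Q * (n₀ * r), hD0 0, mul_nonneg (Real.log_nonneg hQ1) (by positivity),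
    fun l => ?_⟩
  rw [← ENNReal.ofReal_toReal (hD l)]
  refine ENNReal.ofReal_le_ofReal ?_
  have h1 := hsum Finset.univ fun i => b.repr l i
  rw [b.sum_repr] at h1
  refine h1.trans (mul_le_mul_of_nonneg_left ?_ (hD0 0))
  have hQpos : 0 < Q := by linarith
  rw [← Real.rpow_natCast, Real.rpow_def_of_pos hQpos, mul_assoc (Real.log Q)]
  refine Real.exp_le_exp.2 (mul_le_mul_of_nonneg_left ?_ (Real.log_nonneg hQ1))
  push_cast
  calc ∑ i, ((b.repr l i).natAbs : ℝ) ≤ ∑ i : Module.Free.ChooseBasisIndex ℤ Λ, r * ‖(l : Phase d)‖ := by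
        refine Finset.sum_le_sum fun i _ => ?_
        rw [Nat.cast_natAbs]
        exact_mod_cast ZLattice.abs_repr_le b l i
    _ = _ := by simp [n₀, mul_assoc]

theorem extNorm_tsum_le_of_countable {ι κ : Type*} [Countable κ] {𝒜 : SolidBanachSpace ι}
    (hfin : ∀ c : ι → ℂ, c.support.Finite → c ∈ 𝒜.carrier) (s : κ → ι → ℝ≥0∞) :
    𝒜.extNorm (fun i => ∑' k, s k i) ≤ ∑' k, 𝒜.extNorm (s k) := by
  obtain ⟨e, he⟩ := exists_injective_nat κ
  have h1 := extNorm_tsum_le hfin (𝒜 := 𝒜) (Function.extend e s 0)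
  have h2 : ∀ i, ∑' k, s k i = ∑' n, Function.extend e s 0 n i := by
    intro i
    rw [← tsum_extend_zero he]
    refine tsum_congr fun n => ?_
    by_cases hn : ∃ k, e k = n
    · obtain ⟨k, rfl⟩ := hn; rw [he.extend_apply, he.extend_apply]
    · rw [Function.extend_apply' _ _ _ hn, Function.extend_apply' _ _ _ hn]; rfl
  have h3 : ∑' k, 𝒜.extNorm (s k) = ∑' n, 𝒜.extNorm (Function.extend e s 0 n) := by
    rw [← tsum_extend_zero he]
    refine tsum_congr fun n => ?_
    by_cases hn : ∃ k, e k = n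
    · obtain ⟨k, rfl⟩ := hn; rw [he.extend_apply, he.extend_apply]
    · rw [Function.extend_apply' _ _ _ hn, Function.extend_apply' _ _ _ hn]
      exact extNorm_zero.symm
  simpa only [h2, h3] using h1

theorem exists_exp_mul_pow_le (ρ κ : ℝ) (hρ : 0 < ρ) (n : ℕ) : ∃ B : ℝ, ∀ x : ℝ, 0 ≤ x →
    Real.exp (-ρ * x ^ 2 + κ * x) * x ^ n ≤ B := by
  refine ⟨n.factorial * Real.exp ((κ + 1) ^ 2 / (4 * ρ)), fun x hx => ?_⟩
  have h1 : x ^ n ≤ n.factorial * Real.exp x := by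
    have := Real.pow_div_factorial_le_exp x hx n
    rwa [div_le_iff₀ (by positivity), mul_comm] at this
  calc _ ≤ Real.exp (-ρ * x ^ 2 + κ * x) * (n.factorial * Real.exp x) := by gcongr
    _ = n.factorial * Real.exp (-ρ * x ^ 2 + κ * x + x) := by
        rw [Real.exp_add (-ρ * x ^ 2 + κ * x) x]; ring
    _ ≤ _ := by
        gcongr
        rw [le_div_iff₀ (by positivity)]
        nlinarith [sq_nonneg (2 * ρ * x - (κ + 1))]

/-- Gaussians belong to all amalgam spaces of convolution algebras. -/
theorem amalgamNorm_gaussian_lt_top [DiscreteTopology Λ] [IsZLattice ℝ Λ] [Countable Λ]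
    (hC : IsFundamentalCell Λ C) {𝒜 : SolidBanachSpace Λ} (h𝒜 : 𝒜.IsInvolutiveConvAlgebra)
    (ρ : ℝ) (hρ : 0 < ρ) (z₀ : Phase d) :
    amalgamNorm 𝒜 C (fun z => ENNReal.ofReal (Real.exp (-ρ * ‖z - z₀‖ ^ 2))) < ⊤ := by
  classical
  obtain ⟨R, hR⟩ := exists_cell_radius hC
  obtain ⟨M, κ, hM, hκ, hD⟩ := exists_extNorm_delta_le_exp h𝒜
  set B := Real.exp (ρ * (R + ‖z₀‖) ^ 2) with hB
  let s : Λ → ℝ≥0∞ := fun l => ENNReal.ofReal (B * Real.exp (-(ρ / 2) * ‖(l : Phase d)‖ ^ 2))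
  -- On l + C one has ‖l‖ ≤ ‖z - z₀‖ + (R + ‖z₀‖), hence ‖l‖² ≤ 2‖z - z₀‖² + 2(R + ‖z₀‖)². This is
  -- the origin of the rate ρ/2 and of the constant B.
  have hle : ∀ l : Λ, cellSup C (fun z => ENNReal.ofReal (Real.exp (-ρ * ‖z - z₀‖ ^ 2))) l ≤ s l := by
    intro l
    refine cellSup_le hC (ae_of_all _ fun z hz => ENNReal.ofReal_le_ofReal ?_)
    rw [hB, ← Real.exp_add]
    refine Real.exp_le_exp.2 ?_
    have h1 := hR l z hz
    have h2 : ‖(l : Phase d)‖ ≤ ‖z - z₀‖ + (R + ‖z₀‖) := by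
      rw [show (l : Phase d) = (z - z₀) - (z - l) + z₀ by abel]
      calc _ ≤ ‖z - z₀‖ + ‖z - l‖ + ‖z₀‖ :=
            (norm_add_le _ _).trans (by gcongr; exact norm_sub_le _ _)
        _ ≤ _ := by linarith
    have h3 : ‖(l : Phase d)‖ ^ 2 ≤ (‖z - z₀‖ + (R + ‖z₀‖)) ^ 2 :=
      pow_le_pow_left₀ (norm_nonneg _) h2 2
    nlinarith [sq_nonneg (‖z - z₀‖ - (R + ‖z₀‖))]
  refine (extNorm_mono hle).trans_lt ?_
  have hs : s = fun l => ∑' k : Λ, s k * delta k l := by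
    funext l
    rw [tsum_eq_single l]
    · simp [delta]
    · intro k hk; simp [delta, hk.symm]
  rw [hs]
  refine (extNorm_tsum_le_of_countable h𝒜.mem_of_finite_support _).trans_lt ?_
  have : Module.Finite ℤ Λ := ZLattice.module_finite ℝ Λ
  -- One more than the rank makes ∑ ‖l‖⁻ⁿ converge; the Gaussian beats the exponential growth of
  -- ‖δ_l‖ by any power of ‖l‖.
  let n := Module.finrank ℤ Λ + 1
  obtain ⟨B', hB'⟩ := exists_exp_mul_pow_le (ρ / 2) κ (by positivity) n
  let t : Λ → ℝ := fun l => B * M * Real.exp (-(ρ / 2) * ‖(l : Phase d)‖ ^ 2 + κ * ‖(l : Phase d)‖)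
  have ht : Summable t := by
    have h1 := (ZLattice.summable_norm_pow_inv Λ n (Nat.lt_succ_self _)).mul_left (B * M * B')
    refine h1.of_norm_bounded_eventually ?_
    filter_upwards [(Set.finite_singleton (0 : Λ)).compl_mem_cofinite] with l hl
    have hl0 : 0 < ‖(l : Phase d)‖ := by
      rw [norm_pos_iff]; simpa using hl
    rw [Real.norm_of_nonneg (by positivity)]
    have h2 := hB' ‖(l : Phase d)‖ (norm_nonneg _)
    rw [inv_pow, mul_assoc (B * M)]
    refine mul_le_mul_of_nonneg_left ?_ (by positivity)
    rw [← div_eq_mul_inv]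
    exact (le_div_iff₀ (by positivity)).2 h2
  refine lt_of_le_of_lt (ENNReal.tsum_le_tsum fun k => ?_) (lt_top_iff_ne_top.2 ht.tsum_ofReal_ne_top)
  have h1 := extNorm_const_mul_le (𝒜 := 𝒜) (s k).toNNReal (delta k)
  rw [ENNReal.coe_toNNReal ENNReal.ofReal_ne_top] at h1
  refine h1.trans ((mul_le_mul_right (hD k) _).trans (le_of_eq ?_))
  rw [← ENNReal.ofReal_mul (by positivity)]
  congr 1
  simp only [t, Real.exp_add]
  ring

end Amalgam

end WeylGabor

end

noncomputable section

namespace WeylGabor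

/-! ### Tempered distributions and integrals of Schwartz functions -/

section Interchange

variable {P : Type*} [MeasurableSpace P] {μ : Measure P}
  {E : Type} [NormedAddCommGroup E] [NormedSpace ℝ E]

/-- Differentiation under the integral sign for families of Schwartz functions. -/
theorem iteratedFDeriv_integral_schwartz (n : ℕ) :
    ∀ {V : Type} [NormedAddCommGroup V] [NormedSpace ℝ V] (f : P → 𝓢(E, V)) (F : E → V)
      (b : ℕ → P → ℝ) (_ : ∀ i, Integrable (b i) μ)
      (_ : ∀ i p w, ‖iteratedFDeriv ℝ i (f p) w‖ ≤ b i p)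
      (_ : ∀ i w, AEStronglyMeasurable (fun p => iteratedFDeriv ℝ i (f p) w) μ)
      (_ : ∀ w, F w = ∫ p, f p w ∂μ) (w : E),
      iteratedFDeriv ℝ n F w = ∫ p, iteratedFDeriv ℝ n (f p) w ∂μ := by
  induction n with
  | zero =>
    intro V _ _ f F b hb hle hm hF w
    have := (continuousMultilinearCurryFin0 ℝ E V).symm.toContinuousLinearEquiv.integral_comp_comm
      (fun p => f p w) (μ := μ)
    rw [iteratedFDeriv_zero_eq_comp, Function.comp_apply, hF]
    exact this.symm
  | succ n ih =>
    intro V _ _ f F b hb hle hm hF w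
    have hm1 : ∀ w, AEStronglyMeasurable (fun p => fderiv ℝ (f p) w) μ := by
      intro w
      have h1 := (continuousMultilinearCurryFin1 ℝ E V).continuous.comp_aestronglyMeasurable (hm 1 w)
      refine h1.congr (ae_of_all _ fun p => ?_)
      ext v
      simp
    have hm0 : ∀ w, AEStronglyMeasurable (fun p => f p w) μ := by
      intro w
      have h1 := (continuousMultilinearCurryFin0 ℝ E V).continuous.comp_aestronglyMeasurable (hm 0 w)
      refine h1.congr (ae_of_all _ fun p => ?_)
      simp
    have hder : ∀ w, HasFDerivAt F (∫ p, fderiv ℝ (f p) w ∂μ) w := by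
      intro w
      rw [show F = fun w => ∫ p, f p w ∂μ from funext hF]
      refine hasFDerivAt_integral_of_dominated_of_fderiv_le (s := Set.univ) Filter.univ_mem
        (F' := fun w p => fderiv ℝ (f p) w)
        (Eventually.of_forall hm0) ?_ (hm1 w) (ae_of_all _ fun p w _ => ?_) (hb 1)
        (ae_of_all _ fun p w _ => (f p).hasFDerivAt w)
      · refine Integrable.mono' (hb 0) (hm0 w) (ae_of_all _ fun p => ?_)
        simpa using hle 0 p w
      · simpa using hle 1 p w
    have hfd : fderiv ℝ F = fun w => ∫ p, fderiv ℝ (f p) w ∂μ := funext fun w => (hder w).fderiv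
    have hit : ∀ i p w, iteratedFDeriv ℝ i (SchwartzMap.fderivCLM ℝ E V (f p)) w =
        continuousMultilinearCurryRightEquiv' ℝ i E V (iteratedFDeriv ℝ (i + 1) (f p) w) := by
      intro i p w
      rw [iteratedFDeriv_succ_eq_comp_right, Function.comp_apply, LinearIsometryEquiv.apply_symm_apply]
      rfl
    -- The induction passes to the family of first derivatives, which takes values in a new space;
    -- hence the quantification over V and the shift of the bounds b.
    have h1 := ih (fun p => SchwartzMap.fderivCLM ℝ E V (f p)) (fderiv ℝ F) (fun i => b (i + 1))
      (fun i => hb (i + 1)) (fun i p w => by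
        rw [hit, LinearIsometryEquiv.norm_map]; exact hle _ _ _)
      (fun i w => by
        simp only [hit]
        exact (continuousMultilinearCurryRightEquiv' ℝ i E V).continuous.comp_aestronglyMeasurable
          (hm _ _))
      (fun w => by rw [hfd]; rfl) w
    rw [iteratedFDeriv_succ_eq_comp_right, Function.comp_apply, h1]
    simp only [hit]
    let L : (E [×(n + 1)]→L[ℝ] V) ≃L[ℝ] (E [×n]→L[ℝ] E →L[ℝ] V) :=
      (continuousMultilinearCurryRightEquiv' ℝ n E V).toContinuousLinearEquiv
    have h2 := ContinuousLinearEquiv.integral_comp_comm (𝕜 := ℝ)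
      (F := E [×n]→L[ℝ] E →L[ℝ] V) L
      (fun p => iteratedFDeriv ℝ (n + 1) (f p) w) (μ := μ)
    have h3 : ∫ p, continuousMultilinearCurryRightEquiv' ℝ n E V
        (iteratedFDeriv ℝ (n + 1) (f p) w) ∂μ = continuousMultilinearCurryRightEquiv' ℝ n E V
        (∫ p, iteratedFDeriv ℝ (n + 1) (f p) w ∂μ) := h2
    rw [h3, LinearIsometryEquiv.symm_apply_apply]

/-- The space of the values of the `n`-th derivative of a complex function. -/
def DerivSpace (E : Type) [NormedAddCommGroup E] [NormedSpace ℝ E] (n : ℕ) : Type :=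
  E [×n]→L[ℝ] ℂ

instance (n : ℕ) : NormedAddCommGroup (DerivSpace E n) :=
  inferInstanceAs (NormedAddCommGroup (E [×n]→L[ℝ] ℂ))

instance (n : ℕ) : NormedSpace ℂ (DerivSpace E n) :=
  inferInstanceAs (NormedSpace ℂ (E [×n]→L[ℝ] ℂ))

instance (n : ℕ) : CompleteSpace (DerivSpace E n) :=
  inferInstanceAs (CompleteSpace (E [×n]→L[ℝ] ℂ))

/-- The `n`-th derivative of a Schwartz function. -/
def schwartzDeriv (n : ℕ) (F : 𝓢(E, ℂ)) (w : E) : DerivSpace E n := iteratedFDeriv ℝ n F w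

theorem norm_schwartzDeriv (n : ℕ) (F : 𝓢(E, ℂ)) (w : E) :
    ‖schwartzDeriv n F w‖ = ‖iteratedFDeriv ℝ n F w‖ := rfl

theorem norm_weight_smul (k n : ℕ) (F : 𝓢(E, ℂ)) (w : E) :
    ‖((‖w‖ ^ k : ℝ) : ℂ) • schwartzDeriv n F w‖ = ‖w‖ ^ k * ‖iteratedFDeriv ℝ n F w‖ := by
  rw [norm_smul, Complex.norm_real, norm_pow, norm_norm, norm_schwartzDeriv]

/-- The weighted derivative `‖w‖ᵏ Dⁿ F(w)` of a Schwartz function, as a bounded continuous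
function. -/
def weightedDeriv (E : Type) [NormedAddCommGroup E] [NormedSpace ℝ E] (k n : ℕ) :
    𝓢(E, ℂ) →L[ℂ] BoundedContinuousFunction E (DerivSpace E n) :=
  SchwartzMap.mkCLMtoNormedSpace (D := E) (E := ℂ) (𝕜 := ℂ) (σ := RingHom.id ℂ)
    (G := BoundedContinuousFunction E (DerivSpace E n))
    (fun F => BoundedContinuousFunction.ofNormedAddCommGroup
      (fun w => ((‖w‖ ^ k : ℝ) : ℂ) • schwartzDeriv n F w)
      ((Complex.continuous_ofReal.comp (continuous_norm.pow k)).smul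
        ((F.smooth ⊤).continuous_iteratedFDeriv (mod_cast le_top)))
      (SchwartzMap.seminorm ℂ k n F)
      (fun w => by rw [norm_weight_smul]; exact SchwartzMap.le_seminorm ℂ k n F w))
    (fun F G => by
      ext1 w
      have h : schwartzDeriv n (F + G) w = schwartzDeriv n F w + schwartzDeriv n G w :=
        iteratedFDeriv_add_apply ((F.smooth n).contDiffAt) ((G.smooth n).contDiffAt)
      simp [h])
    (fun a F => by
      ext1 w
      have h : schwartzDeriv n (a • F) w = a • schwartzDeriv n F w :=
        iteratedFDeriv_const_smul_apply ((F.smooth n).contDiffAt)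
      change ((‖w‖ ^ k : ℝ) : ℂ) • schwartzDeriv n (a • F) w =
        a • (((‖w‖ ^ k : ℝ) : ℂ) • schwartzDeriv n F w)
      rw [h, smul_comm])
    ⟨{(k, n)}, 1, zero_le_one, fun F => by
      rw [one_mul, Finset.sup_singleton]
      exact BoundedContinuousFunction.norm_ofNormedAddCommGroup_le _ (apply_nonneg _ _) _⟩

theorem weightedDeriv_apply (k n : ℕ) (F : 𝓢(E, ℂ)) (w : E) :
    weightedDeriv E k n F w = ((‖w‖ ^ k : ℝ) : ℂ) • schwartzDeriv n F w := rfl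

theorem norm_weightedDeriv (k n : ℕ) (F : 𝓢(E, ℂ)) :
    ‖weightedDeriv E k n F‖ = SchwartzMap.seminorm ℂ k n F := by
  refine le_antisymm (BoundedContinuousFunction.norm_ofNormedAddCommGroup_le _ (apply_nonneg _ _)
    fun w => by rw [norm_weight_smul]; exact SchwartzMap.le_seminorm ℂ k n F w)
    (SchwartzMap.seminorm_le_bound ℂ k n F (norm_nonneg _) fun w => ?_)
  have := (weightedDeriv E k n F).norm_coe_le_norm w
  rwa [weightedDeriv_apply, norm_weight_smul] at this

/-- Transport σ to the range of the embedding, where it is bounded, and apply Hahn–Banach. -/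
theorem exists_dual_extension {S X : Type*} [AddCommGroup S] [Module ℂ S] [NormedAddCommGroup X]
    [NormedSpace ℂ X] (ι : S →ₗ[ℂ] X) (hinj : Function.Injective ι) (σ : S →ₗ[ℂ] ℂ) (C : ℝ)
    (h : ∀ G, ‖σ G‖ ≤ C * ‖ι G‖) : ∃ φ : X →L[ℂ] ℂ, ∀ G, φ (ι G) = σ G := by
  let e := LinearEquiv.ofInjective ι hinj
  have he : ∀ G, e.symm ⟨ι G, G, rfl⟩ = G := fun G => e.symm_apply_apply G
  let φ₀ : LinearMap.range ι →L[ℂ] ℂ :=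
    LinearMap.mkContinuous (σ.comp (e.symm : LinearMap.range ι →ₗ[ℂ] S)) C (by
      rintro ⟨x, G, rfl⟩
      change ‖σ (e.symm ⟨ι G, G, rfl⟩)‖ ≤ C * ‖ι G‖
      rw [he]
      exact h G)
  obtain ⟨φ, hφ, -⟩ := exists_extension_norm_eq (LinearMap.range ι) φ₀
  refine ⟨φ, fun G => (hφ ⟨ι G, G, rfl⟩).trans ?_⟩
  change σ (e.symm ⟨ι G, G, rfl⟩) = σ G
  rw [he]

/-- S itself carries no norm in which to integrate. Finitely many maps D k embed it into a Banach
space to which σ extends as a continuous functional, and continuous functionals commute with Bochner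
integrals. -/
theorem linearMap_apply_eq_integral {S κ : Type*} [AddCommGroup S] [Module ℂ S] [Fintype κ]
    {Z : κ → Type*} [∀ k, NormedAddCommGroup (Z k)] [∀ k, NormedSpace ℂ (Z k)]
    [∀ k, CompleteSpace (Z k)] (D : ∀ k, S →ₗ[ℂ] Z k) (hinj : ∀ G, (∀ k, D k G = 0) → G = 0)
    (σ : S →ₗ[ℂ] ℂ) (C : ℝ) (hC : 0 ≤ C) (M : S → ℝ) (hM : ∀ G, ‖σ G‖ ≤ C * M G)
    (hMD : ∀ G r, 0 ≤ r → (∀ k, ‖D k G‖ ≤ r) → M G ≤ r)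
    (f : P → S) (F : S) (hint : ∀ k, Integrable (fun p => D k (f p)) μ)
    (hF : ∀ k, D k F = ∫ p, D k (f p) ∂μ) : σ F = ∫ p, σ (f p) ∂μ := by
  obtain ⟨φ, hφ⟩ := exists_dual_extension (LinearMap.pi D) (by
    rw [← LinearMap.ker_eq_bot, LinearMap.ker_eq_bot']
    exact fun G hG => hinj G fun k => congrFun hG k) σ C (fun G => (hM G).trans (by
      gcongr
      exact hMD _ _ (norm_nonneg _) fun k => norm_le_pi_norm (LinearMap.pi D G) k))
  have h1 : Integrable (fun p => LinearMap.pi D (f p)) μ := Integrable.of_eval hint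
  have h2 : LinearMap.pi D F = ∫ p, LinearMap.pi D (f p) ∂μ := by
    funext k
    exact (hF k).trans (eval_integral (f := fun p => LinearMap.pi D (f p)) hint k).symm
  have h3 := φ.integral_comp_comm h1
  rw [← h2, hφ] at h3
  simpa only [hφ] using h3.symm

/-- A tempered distribution may be applied under the integral sign. -/
theorem apply_eq_integral_of_integrable_seminorm [TopologicalSpace P] [OpensMeasurableSpace P]
    [SecondCountableTopology P] (σ : 𝓢'(E, ℂ)) (f : P → 𝓢(E, ℂ)) (hf : Continuous f)
    (b : ℕ → ℕ → P → ℝ) (hb : ∀ k n, Integrable (b k n) μ)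
    (hle : ∀ k n p, SchwartzMap.seminorm ℂ k n (f p) ≤ b k n p)
    (F : 𝓢(E, ℂ)) (hF : ∀ w, F w = ∫ p, f p w ∂μ) : σ F = ∫ p, σ (f p) ∂μ := by
  obtain ⟨s, C, -, hs⟩ := Seminorm.bound_of_continuous (schwartz_withSeminorms ℂ E ℂ)
    ((normSeminorm ℂ ℂ).comp (σ : 𝓢(E, ℂ) →ₗ[ℂ] ℂ)) (continuous_norm.comp σ.continuous)
  -- The finite set s comes from the continuity of σ. The index (0, 0) is added because the supremum
  -- norm makes the embedding injective.
  let S : Finset (ℕ × ℕ) := insert (0, 0) s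
  have hm : ∀ n w, AEStronglyMeasurable (fun p => iteratedFDeriv ℝ n (f p) w) μ := by
    intro n w
    have h1 : Continuous fun p => weightedDeriv E 0 n (f p) w :=
      (ContinuousEval.continuous_eval.comp (Continuous.prodMk
        ((weightedDeriv E 0 n).continuous.comp hf) continuous_const))
    simp only [weightedDeriv_apply, pow_zero, Complex.ofReal_one, one_smul] at h1
    exact h1.aestronglyMeasurable
  have hint : ∀ k n, Integrable (fun p => weightedDeriv E k n (f p)) μ := fun k n =>
    Integrable.mono' (hb k n) ((weightedDeriv E k n).continuous.comp hf).aestronglyMeasurable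
      (ae_of_all _ fun p => (norm_weightedDeriv k n (f p)).trans_le (hle k n p))
  refine linearMap_apply_eq_integral (S := 𝓢(E, ℂ)) (κ := S)
    (Z := fun m => BoundedContinuousFunction E (DerivSpace E (m : ℕ × ℕ).2))
    (fun m => (weightedDeriv E m.1.1 m.1.2).toLinearMap) (fun G hG => ?_)
    (σ : 𝓢(E, ℂ) →ₗ[ℂ] ℂ) C C.2
    (fun G => s.sup (schwartzSeminormFamily ℂ E ℂ) G) hs
    (fun G r hr h => ?_) f F (fun m => hint m.1.1 m.1.2) (fun m => ?_)
  · ext w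
    have h1 : weightedDeriv E 0 0 G = 0 := hG ⟨(0, 0), Finset.mem_insert_self _ _⟩
    have h2 := norm_weightedDeriv 0 0 G
    rw [h1, norm_zero] at h2
    exact norm_le_zero_iff.1 ((SchwartzMap.norm_le_seminorm ℂ G w).trans h2.ge)
  · refine Seminorm.finset_sup_apply_le hr fun m hm => ?_
    have h1 : ‖weightedDeriv E m.1 m.2 G‖ ≤ r := h ⟨m, Finset.mem_insert_of_mem hm⟩
    rwa [norm_weightedDeriv] at h1
  · change weightedDeriv E m.1.1 m.1.2 F = ∫ p, weightedDeriv E m.1.1 m.1.2 (f p) ∂μ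
    ext1 w
    have h1 := ContinuousLinearMap.integral_comp_comm
      (BoundedContinuousFunction.evalCLM ℂ w) (hint m.1.1 m.1.2)
    refine Eq.trans ?_ h1
    simp only [BoundedContinuousFunction.evalCLM_apply, weightedDeriv_apply]
    rw [integral_smul]
    refine congrArg (fun x => ((‖w‖ ^ m.1.1 : ℝ) : ℂ) • x) ?_
    exact iteratedFDeriv_integral_schwartz m.1.2 f F (fun n => b 0 n) (fun n => hb 0 n)
      (fun n p w => by
        have := SchwartzMap.le_seminorm ℂ 0 n (f p) w
        rw [pow_zero, one_mul] at this
        exact this.trans (hle 0 n p)) hm hF w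

end Interchange

end WeylGabor

end

noncomputable section

namespace WeylGabor

/-! ### Time-frequency shifts of Schwartz functions -/

section PhaseShift

variable {d : ℕ}

theorem norm_phaseChar (ζ z : Phase d) : ‖phaseChar ζ z‖ = 1 := by
  rw [phaseChar, show (2 * Real.pi * Complex.I * (phaseDot ζ z : ℝ) : ℂ) =
    ((2 * Real.pi * phaseDot ζ z : ℝ) : ℂ) * Complex.I by push_cast; ring]
  exact Complex.norm_exp_ofReal_mul_I _

/-- The linear functional `z ↦ ζ · z`. -/
def phaseDotCLM (ζ : Phase d) : Phase d →L[ℝ] ℝ :=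
  (innerSL ℝ ζ.1).comp (ContinuousLinearMap.fst ℝ (Eu d) (Eu d)) +
    (innerSL ℝ ζ.2).comp (ContinuousLinearMap.snd ℝ (Eu d) (Eu d))

theorem abs_phaseDot_le (ζ z : Phase d) : |phaseDot ζ z| ≤ 2 * ‖ζ‖ * ‖z‖ := by
  have h1 := abs_real_inner_le_norm ζ.1 z.1
  have h2 := abs_real_inner_le_norm ζ.2 z.2
  have h3 : ‖ζ.1‖ * ‖z.1‖ ≤ ‖ζ‖ * ‖z‖ :=
    mul_le_mul (norm_fst_le ζ) (norm_fst_le z) (norm_nonneg _) (norm_nonneg _)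
  have h4 : ‖ζ.2‖ * ‖z.2‖ ≤ ‖ζ‖ * ‖z‖ :=
    mul_le_mul (norm_snd_le ζ) (norm_snd_le z) (norm_nonneg _) (norm_nonneg _)
  calc _ ≤ |inner ℝ ζ.1 z.1| + |inner ℝ ζ.2 z.2| := abs_add_le _ _
    _ ≤ _ := by linarith

theorem norm_phaseDotCLM_le (ζ : Phase d) : ‖phaseDotCLM ζ‖ ≤ 2 * ‖ζ‖ :=
  ContinuousLinearMap.opNorm_le_bound _ (by positivity) fun z => abs_phaseDot_le ζ z

theorem iteratedDeriv_cexp_I (n : ℕ) :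
    iteratedDeriv n (fun s : ℝ => Complex.exp (2 * Real.pi * Complex.I * s))
      = fun s : ℝ => (2 * Real.pi * Complex.I) ^ n * Complex.exp (2 * Real.pi * Complex.I * s) := by
  induction n with
  | zero => simp
  | succ n ih =>
    rw [iteratedDeriv_succ, ih]
    funext s
    have h1 : HasDerivAt (fun s : ℝ => 2 * Real.pi * Complex.I * (s : ℂ))
        (2 * Real.pi * Complex.I) s := by
      simpa using (Complex.ofRealCLM.hasDerivAt (x := s)).const_mul (2 * Real.pi * Complex.I)
    rw [(h1.cexp.const_mul _).deriv]
    ring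

theorem norm_iteratedFDeriv_phaseChar_le (ζ : Phase d) (i : ℕ) (w : Phase d) :
    ‖iteratedFDeriv ℝ i (phaseChar ζ) w‖ ≤ (4 * Real.pi * ‖ζ‖) ^ i := by
  have h0 : phaseChar ζ = (fun s : ℝ => Complex.exp (2 * Real.pi * Complex.I * s)) ∘
    phaseDotCLM ζ := rfl
  have hsm : ContDiff ℝ ∞ fun s : ℝ => Complex.exp (2 * Real.pi * Complex.I * s) :=
    hasTemperateGrowth_cexp_I.1
  rw [h0, (phaseDotCLM ζ).iteratedFDeriv_comp_right hsm w (i := i) (mod_cast le_top)]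
  refine (ContinuousMultilinearMap.norm_compContinuousLinearMap_le _ _).trans ?_
  rw [norm_iteratedFDeriv_eq_norm_iteratedDeriv, iteratedDeriv_cexp_I, norm_mul, norm_pow]
  have h1 : ‖Complex.exp (2 * Real.pi * Complex.I * (phaseDotCLM ζ w : ℝ))‖ = 1 :=
    norm_phaseChar ζ w
  have h2 : ‖(2 * Real.pi * Complex.I : ℂ)‖ = 2 * Real.pi := by
    simp [abs_of_pos Real.pi_pos]
  rw [h1, h2, mul_one, Finset.prod_const, Finset.card_univ, Fintype.card_fin, ← mul_pow]
  have := norm_phaseDotCLM_le ζ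
  refine pow_le_pow_left₀ (by positivity) ?_ _
  nlinarith [Real.pi_pos]

theorem norm_phaseChar_sub_one_le (ζ w : Phase d) :
    ‖phaseChar ζ w - 1‖ ≤ 4 * Real.pi * ‖ζ‖ * ‖w‖ := by
  rw [phaseChar, show (2 * Real.pi * Complex.I * (phaseDot ζ w : ℝ) : ℂ) =
    Complex.I * ((2 * Real.pi * phaseDot ζ w : ℝ) : ℂ) by push_cast; ring]
  refine (Real.norm_exp_I_mul_ofReal_sub_one_le).trans ?_
  rw [Real.norm_eq_abs, abs_mul, abs_of_pos (by positivity)]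
  nlinarith [abs_phaseDot_le ζ w, Real.pi_pos]

/-- A constant that controls weighted derivatives. -/
def schwartzBound (k n : ℕ) (Φ : 𝓢(Phase d, ℂ)) : ℝ :=
  2 ^ k * (Finset.Iic (k, n)).sup (fun m => SchwartzMap.seminorm ℂ m.1 m.2) Φ

theorem schwartzBound_nonneg (k n : ℕ) (Φ : 𝓢(Phase d, ℂ)) : 0 ≤ schwartzBound k n Φ := by
  unfold schwartzBound; positivity

theorem le_schwartzBound (k n i : ℕ) (hi : i ≤ n) (Φ : 𝓢(Phase d, ℂ)) (w : Phase d) :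
    (1 + ‖w‖) ^ k * ‖iteratedFDeriv ℝ i Φ w‖ ≤ schwartzBound k n Φ :=
  SchwartzMap.one_add_le_sup_seminorm_apply (𝕜 := ℂ) (m := (k, n)) le_rfl hi Φ w

/-- Leibniz rule. The admitted linear growth of the derivatives of g costs one power of the weight,
and the binomial coefficients sum to 2ⁿ. -/
theorem seminorm_le_of_mul {g : Phase d → ℂ} (hg : g.HasTemperateGrowth) {A : ℝ} (hA : 0 ≤ A)
    (k n : ℕ) (h : ∀ i ≤ n, ∀ w, ‖iteratedFDeriv ℝ i g w‖ ≤ A * (1 + ‖w‖))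
    (Φ F : 𝓢(Phase d, ℂ)) (hF : ∀ w, F w = g w * Φ w) :
    SchwartzMap.seminorm ℂ k n F ≤ A * (2 ^ n * schwartzBound (k + 1) n Φ) := by
  refine SchwartzMap.seminorm_le_bound ℂ k n F
    (mul_nonneg hA (mul_nonneg (by positivity) (schwartzBound_nonneg _ _ _))) fun w => ?_
  rw [show (F : Phase d → ℂ) = fun w => g w * Φ w from funext hF]
  have key := norm_iteratedFDeriv_mul_le (𝕜 := ℝ) (n := n) (N := ∞) hg.1 (Φ.smooth ⊤) w
    (mod_cast le_top)
  calc _ ≤ ‖w‖ ^ k * ∑ i ∈ Finset.range (n + 1), (n.choose i : ℝ) *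
        ‖iteratedFDeriv ℝ i g w‖ * ‖iteratedFDeriv ℝ (n - i) Φ w‖ := by gcongr
    _ ≤ ∑ i ∈ Finset.range (n + 1), (n.choose i : ℝ) * (A * schwartzBound (k + 1) n Φ) := by
        rw [Finset.mul_sum]
        refine Finset.sum_le_sum fun i hi => ?_
        have h1 := h i (Nat.lt_succ_iff.1 (Finset.mem_range.1 hi)) w
        have h2 := le_schwartzBound (k + 1) n (n - i) (Nat.sub_le _ _) Φ w
        have h3 : ‖w‖ ^ k ≤ (1 + ‖w‖) ^ k := pow_le_pow_left₀ (norm_nonneg _) (by linarith) _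
        calc _ ≤ (1 + ‖w‖) ^ k * ((n.choose i : ℝ) * (A * (1 + ‖w‖)) *
              ‖iteratedFDeriv ℝ (n - i) Φ w‖) := by gcongr
          _ = (n.choose i : ℝ) * (A * ((1 + ‖w‖) ^ (k + 1) *
              ‖iteratedFDeriv ℝ (n - i) Φ w‖)) := by ring
          _ ≤ _ := by gcongr
    _ = _ := by
        rw [← Finset.sum_mul]
        have : (∑ i ∈ Finset.range (n + 1), (n.choose i : ℝ)) = 2 ^ n := by
          exact_mod_cast Nat.sum_range_choose n
        rw [this]; ring

/-- Modulation of a Schwartz function. -/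
def schwartzMod (ζ : Phase d) : 𝓢(Phase d, ℂ) →L[ℂ] 𝓢(Phase d, ℂ) :=
  SchwartzMap.smulLeftCLM ℂ (phaseChar ζ)

theorem schwartzMod_apply (ζ : Phase d) (Φ : 𝓢(Phase d, ℂ)) (w : Phase d) :
    schwartzMod ζ Φ w = phaseChar ζ w * Φ w := by
  simp [schwartzMod, SchwartzMap.smulLeftCLM_apply_apply (hasTemperateGrowth_phaseChar ζ)]

/-- Translation of a Schwartz function. -/
def schwartzTrans (z : Phase d) : 𝓢(Phase d, ℂ) →L[ℂ] 𝓢(Phase d, ℂ) :=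
  SchwartzMap.compSubConstCLM ℂ z

theorem schwartzPhaseShift_eq (z ζ : Phase d) (Φ : 𝓢(Phase d, ℂ)) :
    schwartzPhaseShift z ζ Φ = schwartzMod ζ (schwartzTrans z Φ) := rfl

theorem seminorm_schwartzMod_le (k n : ℕ) (ζ : Phase d) (Φ : 𝓢(Phase d, ℂ)) :
    SchwartzMap.seminorm ℂ k n (schwartzMod ζ Φ) ≤
      (1 + 4 * Real.pi * ‖ζ‖) ^ n * (2 ^ n * schwartzBound (k + 1) n Φ) := by
  have hpi := Real.pi_pos
  refine seminorm_le_of_mul (hasTemperateGrowth_phaseChar ζ) (by positivity) k n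
    (fun i hi w => ?_) Φ _ (schwartzMod_apply ζ Φ)
  refine (norm_iteratedFDeriv_phaseChar_le ζ i w).trans ?_
  calc _ ≤ (1 + 4 * Real.pi * ‖ζ‖) ^ i := pow_le_pow_left₀ (by positivity) (by linarith) _
    _ ≤ (1 + 4 * Real.pi * ‖ζ‖) ^ n :=
        pow_le_pow_right₀ (le_add_of_nonneg_right (by positivity)) hi
    _ ≤ _ := le_mul_of_one_le_right (by positivity) (le_add_of_nonneg_right (norm_nonneg _))

/-- The factor ‖ζ‖ is the point: it gives continuity of modulation at ζ = 0. -/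
theorem seminorm_schwartzMod_sub_le (k n : ℕ) (ζ : Phase d) (Φ : 𝓢(Phase d, ℂ)) :
    SchwartzMap.seminorm ℂ k n (schwartzMod ζ Φ - Φ) ≤
      4 * Real.pi * ‖ζ‖ * (1 + 4 * Real.pi * ‖ζ‖) ^ n *
        (2 ^ n * schwartzBound (k + 1) n Φ) := by
  have hpi := Real.pi_pos
  have hone : (fun _ : Phase d => (1 : ℂ)).HasTemperateGrowth := Function.HasTemperateGrowth.const _
  refine seminorm_le_of_mul (g := fun w => phaseChar ζ w - 1)
    ((hasTemperateGrowth_phaseChar ζ).sub hone) (by positivity) k n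
    (fun i hi w => ?_) Φ _ (fun w => by
      rw [_root_.sub_apply, schwartzMod_apply]; ring)
  set a := 4 * Real.pi * ‖ζ‖ with ha
  have ha0 : 0 ≤ a := by positivity
  have h1n : 1 ≤ (1 + a) ^ n := one_le_pow₀ (le_add_of_nonneg_right ha0)
  -- For i = 0 the factor ‖ζ‖ comes from |e^{is} - 1| ≤ |s|, at the price of a factor ‖w‖. For i ≥ 1
  -- the constant 1 disappears and the derivative of the character already contains ‖ζ‖.
  rcases i with _ | i
  · rw [norm_iteratedFDeriv_zero]
    refine (norm_phaseChar_sub_one_le ζ w).trans ?_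
    calc a * ‖w‖ ≤ a * (1 + ‖w‖) := by gcongr; linarith
      _ ≤ a * (1 + a) ^ n * (1 + ‖w‖) := by
          gcongr; exact le_mul_of_one_le_right ha0 h1n
  · have h1 : iteratedFDeriv ℝ (i + 1) (fun w => phaseChar ζ w - 1) w =
        iteratedFDeriv ℝ (i + 1) (phaseChar ζ) w := by
      have hs := iteratedFDeriv_sub_apply (𝕜 := ℝ) (i := i + 1) (x := w)
        ((hasTemperateGrowth_phaseChar ζ).1.contDiffAt.of_le (mod_cast le_top))
        (hone.1.contDiffAt.of_le (mod_cast le_top))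
      refine hs.trans ?_
      rw [iteratedFDeriv_const_of_ne (Nat.succ_ne_zero i)]
      simp
    rw [h1]
    refine (norm_iteratedFDeriv_phaseChar_le ζ _ w).trans ?_
    calc a ^ (i + 1) = a * a ^ i := by ring
      _ ≤ a * (1 + a) ^ i := by gcongr; linarith
      _ ≤ a * (1 + a) ^ n := by
          gcongr
          · exact le_add_of_nonneg_right ha0
          · omega
      _ ≤ _ := le_mul_of_one_le_right (by positivity) (le_add_of_nonneg_right (norm_nonneg _))

theorem schwartzBound_schwartzTrans_le (k n : ℕ) (z : Phase d) (Φ : 𝓢(Phase d, ℂ)) :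
    schwartzBound k n (schwartzTrans z Φ) ≤ (1 + ‖z‖) ^ k * (2 ^ k * schwartzBound k n Φ) := by
  have h0 := schwartzBound_nonneg k n Φ
  rw [schwartzBound, mul_left_comm]
  refine mul_le_mul_of_nonneg_left ?_ (by positivity)
  refine Seminorm.finset_sup_apply_le (by positivity) fun m hm => ?_
  obtain ⟨hm1, hm2⟩ := Prod.le_def.1 (Finset.mem_Iic.1 hm)
  refine SchwartzMap.seminorm_le_bound ℂ _ _ _ (by positivity) fun w => ?_
  rw [show (schwartzTrans z Φ : Phase d → ℂ) = fun w => Φ (w - z) from rfl,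
    iteratedFDeriv_comp_sub]
  have h1 := le_schwartzBound k n m.2 hm2 Φ (w - z)
  have h2 : ‖w‖ ≤ (1 + ‖z‖) * (1 + ‖w - z‖) := by
    have := norm_sub_norm_le w z
    nlinarith [norm_nonneg z, norm_nonneg (w - z), mul_nonneg (norm_nonneg z) (norm_nonneg (w - z))]
  calc _ ≤ ((1 + ‖z‖) * (1 + ‖w - z‖)) ^ m.1 * ‖iteratedFDeriv ℝ m.2 Φ (w - z)‖ := by gcongr
    _ ≤ ((1 + ‖z‖) * (1 + ‖w - z‖)) ^ k * ‖iteratedFDeriv ℝ m.2 Φ (w - z)‖ := by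
        gcongr
        nlinarith [norm_nonneg z, norm_nonneg (w - z), mul_nonneg (norm_nonneg z) (norm_nonneg (w - z))]
    _ = (1 + ‖z‖) ^ k * ((1 + ‖w - z‖) ^ k * ‖iteratedFDeriv ℝ m.2 Φ (w - z)‖) := by
        rw [mul_pow]; ring
    _ ≤ _ := by gcongr

theorem seminorm_schwartzTrans_sub_le (k n : ℕ) (z : Phase d) (Φ : 𝓢(Phase d, ℂ)) :
    SchwartzMap.seminorm ℂ k n (schwartzTrans z Φ - Φ) ≤
      (1 + ‖z‖) ^ k * schwartzBound k (n + 1) Φ * ‖z‖ := by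
  have h0 := schwartzBound_nonneg k (n + 1) Φ
  refine SchwartzMap.seminorm_le_bound ℂ _ _ _ (by positivity) fun w => ?_
  have hs := iteratedFDeriv_sub_apply (𝕜 := ℝ) (i := n) (x := w) (f := schwartzTrans z Φ) (g := Φ)
    ((schwartzTrans z Φ).smooth n).contDiffAt (Φ.smooth n).contDiffAt
  rw [show ((schwartzTrans z Φ - Φ : 𝓢(Phase d, ℂ)) : Phase d → ℂ) = ⇑(schwartzTrans z Φ) - ⇑Φ
    from rfl, hs, show (schwartzTrans z Φ : Phase d → ℂ) = fun w => Φ (w - z) from rfl,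
    iteratedFDeriv_comp_sub]
  have hdiff : ∀ y : Phase d, DifferentiableAt ℝ (iteratedFDeriv ℝ n Φ) y := fun y =>
    ((Φ.smooth ⊤).differentiable_iteratedFDeriv (mod_cast WithTop.coe_lt_top n)) y
  -- Mean value inequality on the segment from w to w - z. The weight is frozen at w; there ‖w‖ ≤ (1
  -- + ‖z‖)(1 + ‖y‖) for every y on the segment.
  have key := (convex_segment w (w - z)).norm_image_sub_le_of_norm_fderiv_le (𝕜 := ℝ)
    (f := fun y => ‖w‖ ^ k • iteratedFDeriv ℝ n Φ y)
    (C := (1 + ‖z‖) ^ k * schwartzBound k (n + 1) Φ)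
    (fun y _ => (hdiff y).fun_const_smul _) (fun y hy => by
      rw [fderiv_fun_const_smul (hdiff y), norm_smul, norm_pow, norm_norm, norm_fderiv_iteratedFDeriv]
      have h1 := le_schwartzBound k (n + 1) (n + 1) le_rfl Φ y
      have h2 : ‖w - y‖ ≤ ‖z‖ := by
        rw [segment_eq_image'] at hy
        obtain ⟨t, ht, rfl⟩ := hy
        rw [show w - (w + t • (w - z - w)) = t • z by module, norm_smul, Real.norm_of_nonneg ht.1]
        exact mul_le_of_le_one_left (norm_nonneg _) ht.2
      have h3 : ‖w‖ ≤ (1 + ‖z‖) * (1 + ‖y‖) := by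
        have := norm_sub_norm_le w y
        nlinarith [norm_nonneg z, norm_nonneg y, mul_nonneg (norm_nonneg z) (norm_nonneg y)]
      calc _ ≤ ((1 + ‖z‖) * (1 + ‖y‖)) ^ k * ‖iteratedFDeriv ℝ (n + 1) Φ y‖ := by gcongr
        _ = (1 + ‖z‖) ^ k * ((1 + ‖y‖) ^ k * ‖iteratedFDeriv ℝ (n + 1) Φ y‖) := by
          rw [mul_pow]; ring
        _ ≤ _ := by gcongr) (left_mem_segment ℝ _ _) (right_mem_segment ℝ _ _)
  rw [← smul_sub, norm_smul, norm_pow, norm_norm] at key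
  refine key.trans (le_of_eq ?_)
  rw [show w - z - w = -z by abel, norm_neg]

theorem seminorm_schwartzPhaseShift_le (k n : ℕ) (z ζ : Phase d) (Φ : 𝓢(Phase d, ℂ)) :
    SchwartzMap.seminorm ℂ k n (schwartzPhaseShift z ζ Φ) ≤
      (1 + 4 * Real.pi * ‖ζ‖) ^ n * (1 + ‖z‖) ^ (k + 1) *
        (2 ^ n * (2 ^ (k + 1) * schwartzBound (k + 1) n Φ)) := by
  have hpi := Real.pi_pos
  rw [schwartzPhaseShift_eq]
  refine (seminorm_schwartzMod_le k n ζ _).trans ?_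
  have h := schwartzBound_schwartzTrans_le (k + 1) n z Φ
  calc _ ≤ (1 + 4 * Real.pi * ‖ζ‖) ^ n * (2 ^ n *
        ((1 + ‖z‖) ^ (k + 1) * (2 ^ (k + 1) * schwartzBound (k + 1) n Φ))) := by gcongr
    _ = _ := by ring

theorem tendsto_schwartzPhaseShift_zero (Φ : 𝓢(Phase d, ℂ)) :
    Tendsto (fun p : Phase d × Phase d => schwartzPhaseShift p.1 p.2 Φ) (𝓝 0) (𝓝 Φ) := by
  rw [(schwartz_withSeminorms ℂ (Phase d) ℂ).tendsto_nhds]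
  rintro ⟨k, n⟩ ε hε
  let B : Phase d × Phase d → ℝ := fun p =>
    (4 * Real.pi * ‖p.2‖ * (1 + 4 * Real.pi * ‖p.2‖) ^ n *
      (2 ^ n * ((1 + ‖p.1‖) ^ (k + 1) * (2 ^ (k + 1) * schwartzBound (k + 1) n Φ)))) +
      (1 + ‖p.1‖) ^ k * schwartzBound k (n + 1) Φ * ‖p.1‖
  have hB : Tendsto B (𝓝 0) (𝓝 0) := by
    have hc : Continuous B := by fun_prop
    have := hc.tendsto 0
    simpa [B] using this
  filter_upwards [hB.eventually (gt_mem_nhds hε)] with p hp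
  refine lt_of_le_of_lt ?_ hp
  have hpi := Real.pi_pos
  rw [schwartzPhaseShift_eq]
  have h1 := seminorm_schwartzMod_sub_le k n p.2 (schwartzTrans p.1 Φ)
  have h2 := seminorm_schwartzTrans_sub_le k n p.1 Φ
  have h3 := schwartzBound_schwartzTrans_le (k + 1) n p.1 Φ
  calc SchwartzMap.seminorm ℂ k n (schwartzMod p.2 (schwartzTrans p.1 Φ) - Φ)
      = SchwartzMap.seminorm ℂ k n ((schwartzMod p.2 (schwartzTrans p.1 Φ) - schwartzTrans p.1 Φ) +
        (schwartzTrans p.1 Φ - Φ)) := by congr 1; abel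
    _ ≤ _ := map_add_le_add _ _ _
    _ ≤ _ := by
      refine add_le_add (h1.trans ?_) h2
      gcongr

/-- Time-frequency shifts compose up to a phase, which reduces continuity in (z, ζ) to continuity at
the origin. -/
theorem schwartzPhaseShift_add (z₀ ζ₀ z ζ : Phase d) (Φ : 𝓢(Phase d, ℂ)) :
    schwartzPhaseShift (z₀ + z) (ζ₀ + ζ) Φ =
      phaseChar ζ z₀ • schwartzPhaseShift z₀ ζ₀ (schwartzPhaseShift z ζ Φ) := by
  ext w
  simp only [_root_.smul_apply, schwartzPhaseShift_apply, smul_eq_mul]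
  rw [show w - (z₀ + z) = w - z₀ - z by abel, ← mul_assoc, ← mul_assoc]
  congr 1
  simp only [phaseChar, ← Complex.exp_add]
  congr 1
  have : phaseDot (ζ₀ + ζ) w = phaseDot ζ z₀ + phaseDot ζ₀ w + phaseDot ζ (w - z₀) := by
    simp [phaseDot, inner_add_left, inner_sub_right]; ring
  rw [this]; push_cast; ring

theorem continuous_schwartzPhaseShift (Φ : 𝓢(Phase d, ℂ)) :
    Continuous fun p : Phase d × Phase d => schwartzPhaseShift p.1 p.2 Φ := by
  refine continuous_iff_continuousAt.2 fun p₀ => ?_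
  have h1 : Tendsto (fun p : Phase d × Phase d => p - p₀) (𝓝 p₀) (𝓝 0) := by
    have : Continuous fun p : Phase d × Phase d => p - p₀ := by fun_prop
    simpa using this.tendsto p₀
  have h2 := (tendsto_schwartzPhaseShift_zero Φ).comp h1
  have h3 : Tendsto (fun p : Phase d × Phase d =>
      schwartzMod p₀.2 (schwartzTrans p₀.1 (schwartzPhaseShift (p - p₀).1 (p - p₀).2 Φ))) (𝓝 p₀)
      (𝓝 (schwartzMod p₀.2 (schwartzTrans p₀.1 Φ))) :=
    (((schwartzMod p₀.2).continuous.comp (schwartzTrans p₀.1).continuous).tendsto _).comp h2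
  have h4 : Tendsto (fun p : Phase d × Phase d => phaseChar (p - p₀).2 p₀.1) (𝓝 p₀) (𝓝 1) := by
    have : Continuous fun p : Phase d × Phase d => phaseChar (p - p₀).2 p₀.1 := by
      unfold phaseChar phaseDot; fun_prop
    simpa [phaseChar, phaseDot] using this.tendsto p₀
  have h5 := h4.smul h3
  rw [one_smul] at h5
  refine h5.congr fun p => ?_
  have := schwartzPhaseShift_add p₀.1 p₀.2 (p.1 - p₀.1) (p.2 - p₀.2) Φ
  rw [add_sub_cancel, add_sub_cancel] at this
  exact this.symm

theorem conj_phaseChar (ζ w : Phase d) : conj (phaseChar ζ w) = phaseChar (-ζ) w := by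
  have h : ∀ ξ : Phase d, phaseChar ξ w =
      Complex.exp (((2 * Real.pi * phaseDot ξ w : ℝ) : ℂ) * Complex.I) := fun ξ => by
    rw [phaseChar]; congr 1; push_cast; ring
  have h2 : phaseDot (-ζ) w = -phaseDot ζ w := by simp [phaseDot, inner_neg_left]; ring
  rw [h, h, ← Complex.exp_conj, h2, map_mul, Complex.conj_ofReal, Complex.conj_I]
  congr 1; push_cast; ring

theorem schwartzConj_phaseShift_gaussian (z ζ : Phase d) :
    schwartzConj (schwartzPhaseShift z ζ (gaussian d)) = schwartzPhaseShift z (-ζ) (gaussian d) := by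
  ext w
  rw [schwartzConj_apply, schwartzPhaseShift_apply, schwartzPhaseShift_apply, map_mul,
    conj_phaseChar]
  congr 1
  exact Complex.conj_ofReal _

theorem gaussSTFT_eq (σ : 𝓢'(Phase d, ℂ)) (z ζ : Phase d) :
    gaussSTFT σ z ζ = σ (schwartzPhaseShift z (-ζ) (gaussian d)) := by
  rw [gaussSTFT, bracket, schwartzConj_phaseShift_gaussian]

theorem continuous_schwartzPhaseShift_neg (Φ : 𝓢(Phase d, ℂ)) :
    Continuous fun p : Phase d × Phase d => schwartzPhaseShift p.1 (-p.2) Φ := by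
  have h1 : Continuous fun p : Phase d × Phase d => ((p.1, -p.2) : Phase d × Phase d) := by
    fun_prop
  have h2 := (continuous_schwartzPhaseShift Φ).comp h1
  simpa only [Function.comp_def] using h2

theorem continuous_gaussSTFT (σ : 𝓢'(Phase d, ℂ)) :
    Continuous fun p : Phase d × Phase d => gaussSTFT σ p.1 p.2 := by
  simp only [gaussSTFT_eq]
  have h1 : Continuous fun G : 𝓢(Phase d, ℂ) => σ G := σ.continuous
  exact h1.comp (continuous_schwartzPhaseShift_neg (gaussian d))

end PhaseShift

end WeylGabor

end

noncomputable section

namespace WeylGabor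

/-! ### The duality bracket of Schwartz functions -/

section Duality

variable {d : ℕ}

/-- The identification of the phase space with a Euclidean space. -/
def phaseEquiv (d : ℕ) : Phase d ≃L[ℝ] Eu (d + d) :=
  (WithLp.prodContinuousLinearEquiv 2 ℝ (Eu d) (Eu d)).symm.trans
    (((stdOrthonormalBasis ℝ (WithLp 2 (Eu d × Eu d))).reindex
      (finCongr (by
        rw [(WithLp.linearEquiv 2 ℝ (Eu d × Eu d)).finrank_eq]; simp))).repr).toContinuousLinearEquiv

/-- `Phase d` carries the maximum norm and no inner product. This identity, together with
preservation of measure, transfers Fourier inversion and Gaussian integrals from `Eu (d + d)`. -/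
theorem inner_phaseEquiv (z w : Phase d) :
    inner ℝ (phaseEquiv d z) (phaseEquiv d w) = phaseDot z w := by
  simp only [phaseEquiv, ContinuousLinearEquiv.trans_apply,
    LinearIsometryEquiv.coe_toContinuousLinearEquiv, LinearIsometryEquiv.inner_map_map]
  rfl

theorem measurePreserving_phaseEquiv (d : ℕ) : MeasurePreserving (phaseEquiv d) := by
  have h1 : MeasurePreserving (fun z : Phase d => (WithLp.toLp 2 z : WithLp 2 (Eu d × Eu d))) :=
    WithLp.volume_preserving_toLp (Eu d) (Eu d)
  exact (LinearIsometryEquiv.measurePreserving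
    ((stdOrthonormalBasis ℝ (WithLp 2 (Eu d × Eu d))).reindex
      (finCongr (by
        rw [(WithLp.linearEquiv 2 ℝ (Eu d × Eu d)).finrank_eq]; simp))).repr).comp h1

theorem measurableEmbedding_phaseEquiv (d : ℕ) : MeasurableEmbedding (phaseEquiv d) :=
  (phaseEquiv d).toHomeomorph.measurableEmbedding

theorem gaussian_apply (z : Phase d) :
    gaussian d z = (Real.exp (-(Real.pi / 2) * phaseDot z z) : ℂ) := rfl

theorem gaussian_phaseEquiv_symm (y : Eu (d + d)) :
    gaussian d ((phaseEquiv d).symm y) = (Real.exp (-(Real.pi / 2) * ‖y‖ ^ 2) : ℂ) := by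
  rw [gaussian_apply, ← inner_phaseEquiv, ContinuousLinearEquiv.apply_symm_apply,
    real_inner_self_eq_norm_sq]

/-- The short-time Fourier transform of a function with respect to the Gaussian window. -/
def funSTFT (F : Phase d → ℂ) (p : Phase d × Phase d) : ℂ :=
  ∫ w, F w * conj (phaseShift p.1 p.2 (gaussian d) w)

/-- The change of coordinates `(x, t) ↦ (t, t - x)`. -/
def shiftCoords (n : ℕ) : Phase n ≃L[ℝ] Phase n :=
  ContinuousLinearEquiv.equivOfInverse
    ((ContinuousLinearMap.snd ℝ (Eu n) (Eu n)).prod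
      (ContinuousLinearMap.snd ℝ (Eu n) (Eu n) - ContinuousLinearMap.fst ℝ (Eu n) (Eu n)))
    ((ContinuousLinearMap.fst ℝ (Eu n) (Eu n) - ContinuousLinearMap.snd ℝ (Eu n) (Eu n)).prod
      (ContinuousLinearMap.fst ℝ (Eu n) (Eu n)))
    (by intro z; ext1 <;> simp) (by intro z; ext1 <;> simp)

/-- The function `(x, t) ↦ F(t) Ψ(t - x)`. -/
def windowed (F : 𝓢(Phase d, ℂ)) : 𝓢(Phase (d + d), ℂ) :=
  SchwartzMap.compCLMOfContinuousLinearEquiv ℂ (shiftCoords (d + d))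
    (tensorConj (SchwartzMap.compCLMOfContinuousLinearEquiv ℂ (phaseEquiv d).symm F)
      (SchwartzMap.compCLMOfContinuousLinearEquiv ℂ (phaseEquiv d).symm (gaussian d)))

theorem windowed_apply (F : 𝓢(Phase d, ℂ)) (x t : Eu (d + d)) :
    windowed F (x, t) = F ((phaseEquiv d).symm t) *
      conj (gaussian d ((phaseEquiv d).symm (t - x))) := rfl

/-- The partial Fourier transform as a Schwartz function. -/
def schwartzPartialFourier {n : ℕ} (G : 𝓢(Phase n, ℂ)) : 𝓢(Phase n, ℂ) where
  toFun := partialFourier G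
  smooth' := contDiff_infty.2 fun m => (partialFourier_schwartz m G).1
  decay' := fun k m => (partialFourier_schwartz m G).2 k

theorem schwartzPartialFourier_apply {n : ℕ} (G : 𝓢(Phase n, ℂ)) (z : Phase n) :
    schwartzPartialFourier G z = partialFourier G z := rfl

/-- The short-time Fourier transform is the partial Fourier transform of F(t)Ψ(t - x), a Schwartz
function; so it decays rapidly in both variables and Fourier inversion applies slice by slice. -/
theorem funSTFT_schwartz (F : 𝓢(Phase d, ℂ)) (p : Phase d × Phase d) :
    funSTFT F p = schwartzPartialFourier (windowed F) (phaseEquiv d p.1, phaseEquiv d p.2) := by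
  rw [schwartzPartialFourier_apply, partialFourier, funSTFT,
    ← (measurePreserving_phaseEquiv d).integral_comp (measurableEmbedding_phaseEquiv d)]
  refine integral_congr_ae (ae_of_all _ fun w => ?_)
  simp only [windowed_apply, ContinuousLinearEquiv.symm_apply_apply, ← map_sub, inner_phaseEquiv,
    phaseShift, map_mul, smul_eq_mul]
  rw [conj_phaseChar, phaseChar]
  have h : phaseDot (-p.2) w = -phaseDot w p.2 := by
    simp [phaseDot, inner_neg_left, real_inner_comm]; ring
  rw [h]
  push_cast
  rw [show (2 * Real.pi * Complex.I * -(phaseDot w p.2 : ℂ)) =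
    -2 * Real.pi * Complex.I * (phaseDot w p.2 : ℂ) by ring]
  ring

theorem fourier_slice {n : ℕ} (G : 𝓢(Phase n, ℂ)) (x ξ : Eu n) :
    FourierTransform.fourier (fun t : Eu n => G (x, t)) ξ = schwartzPartialFourier G (x, ξ) := by
  rw [Real.fourier_eq', schwartzPartialFourier_apply, partialFourier]
  refine integral_congr_ae (ae_of_all _ fun t => ?_)
  simp only
  congr 2
  push_cast; ring

theorem integral_schwartzPartialFourier {n : ℕ} (G : 𝓢(Phase n, ℂ)) (x t : Eu n) :
    ∫ ξ : Eu n, Complex.exp (2 * Real.pi * Complex.I * inner ℝ ξ t) *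
      schwartzPartialFourier G (x, ξ) = G (x, t) := by
  have hc : Continuous fun t : Eu n => G (x, t) := G.continuous.comp (by fun_prop)
  have hF : FourierTransform.fourier (fun t : Eu n => G (x, t)) =
      fun ξ => schwartzPartialFourier G (x, ξ) := funext (fourier_slice G x)
  have h := congrFun (hc.fourierInv_fourier_eq (integrable_slice G x)
    (by rw [hF]; exact integrable_slice _ x)) t
  rw [hF, Real.fourierInv_eq'] at h
  rw [← h]
  refine integral_congr_ae (ae_of_all _ fun ξ => ?_)
  simp only [smul_eq_mul]
  congr 2
  push_cast; ring

theorem measurePreserving_phaseEquiv_prod (d : ℕ) : MeasurePreserving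
    (fun p : Phase d × Phase d => ((phaseEquiv d p.1, phaseEquiv d p.2) : Phase (d + d))) :=
  (measurePreserving_phaseEquiv d).prod (measurePreserving_phaseEquiv d)

theorem measurableEmbedding_phaseEquiv_prod (d : ℕ) : MeasurableEmbedding
    (fun p : Phase d × Phase d => ((phaseEquiv d p.1, phaseEquiv d p.2) : Phase (d + d))) :=
  ((phaseEquiv d).toHomeomorph.prodCongr (phaseEquiv d).toHomeomorph).measurableEmbedding

theorem norm_cexp_I (a : ℝ) : ‖Complex.exp (2 * Real.pi * Complex.I * a)‖ = 1 := by
  rw [show (2 * Real.pi * Complex.I * a : ℂ) = ((2 * Real.pi * a : ℝ) : ℂ) * Complex.I by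
    push_cast; ring]
  exact Complex.norm_exp_ofReal_mul_I _

/-- The inversion formula for the short-time Fourier transform of a Schwartz function. -/
theorem funSTFT_inversion (F : 𝓢(Phase d, ℂ)) (w : Phase d) :
    F w = ∫ p : Phase d × Phase d, funSTFT F p * phaseShift p.1 p.2 (gaussian d) w := by
  set e := phaseEquiv d with he
  set PG := schwartzPartialFourier (windowed F) with hPG
  let γ : Eu (d + d) → ℂ := fun y => (Real.exp (-(Real.pi / 2) * ‖y‖ ^ 2) : ℂ)
  have hγc : Continuous γ := by fun_prop
  have hγ1 : ∀ y, ‖γ y‖ ≤ 1 := fun y => by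
    rw [Complex.norm_real, Real.norm_of_nonneg (Real.exp_pos _).le, Real.exp_le_one_iff]
    have := mul_nonneg Real.pi_pos.le (sq_nonneg ‖y‖)
    linarith
  have hgauss : ∀ y, gaussian d (e.symm y) = γ y := gaussian_phaseEquiv_symm
  let H : Phase (d + d) → ℂ := fun q =>
    γ (e w - q.1) * (Complex.exp (2 * Real.pi * Complex.I * inner ℝ q.2 (e w)) * PG q)
  have hH : ∀ p : Phase d × Phase d, funSTFT F p * phaseShift p.1 p.2 (gaussian d) w =
      H (e p.1, e p.2) := by
    intro p
    simp only [H]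
    rw [funSTFT_schwartz, phaseShift, phaseChar, ← hgauss, ← map_sub,
      ContinuousLinearEquiv.symm_apply_apply, inner_phaseEquiv]
    ring
  have hHint : Integrable H := by
    refine (PG.integrable (μ := volume)).norm.mono' ?_ (ae_of_all _ fun q => ?_)
    · refine Continuous.aestronglyMeasurable ?_
      have := PG.continuous
      fun_prop
    · simp only [H]
      rw [norm_mul, norm_mul, norm_cexp_I, one_mul]
      exact mul_le_of_le_one_left (norm_nonneg _) (hγ1 _)
  simp only [hH]
  rw [(measurePreserving_phaseEquiv_prod d).integral_comp (measurableEmbedding_phaseEquiv_prod d) H,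
    Measure.volume_eq_prod, integral_prod H hHint]
  -- Fourier inversion in the frequency variable leaves F(w)Ψ(w - x)². The remaining integral over x
  -- is 1 because Ψ has L²-norm one.
  have h1 : ∀ x : Eu (d + d), ∫ ξ : Eu (d + d), H (x, ξ) = F w * (γ (e w - x) * γ (e w - x)) := by
    intro x
    simp only [H]
    rw [integral_const_mul, integral_schwartzPartialFourier, windowed_apply, hgauss,
      ContinuousLinearEquiv.symm_apply_apply]
    have : conj (γ (e w - x)) = γ (e w - x) := Complex.conj_ofReal _
    rw [this]; ring
  simp only [h1]
  rw [integral_const_mul, integral_sub_left_eq_self (fun y => γ y * γ y) volume (e w)]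
  have h2 : ∫ y : Eu (d + d), γ y * γ y = 1 := by
    have h3 : ∀ y : Eu (d + d), γ y * γ y = ((Real.exp (-Real.pi * ‖y‖ ^ 2) : ℝ) : ℂ) := fun y => by
      simp only [γ]
      rw [← Complex.ofReal_mul, ← Real.exp_add]
      congr 2; ring
    simp only [h3]
    rw [integral_complex_ofReal, GaussianFourier.integral_rexp_neg_mul_sq_norm Real.pi_pos,
      div_self Real.pi_ne_zero, Real.one_rpow, Complex.ofReal_one]
  rw [h2, mul_one]

theorem integrable_weight_mul_norm_schwartz {n : ℕ} (G : 𝓢(Phase n, ℂ)) (c : ℝ) (hc : 0 ≤ c)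
    (m : ℕ) : Integrable fun q : Phase n => (1 + c * ‖q‖) ^ m * ‖G q‖ := by
  have h1 : Integrable fun q : Phase n =>
      2 ^ (m - 1) * (‖q‖ ^ 0 * ‖G q‖ + c ^ m * (‖q‖ ^ m * ‖G q‖)) :=
    ((G.integrable_pow_mul volume 0).add ((G.integrable_pow_mul volume m).const_mul _)).const_mul _
  refine h1.mono' ?_ (ae_of_all _ fun q => ?_)
  · have := G.continuous
    exact Continuous.aestronglyMeasurable (by fun_prop)
  · rw [Real.norm_of_nonneg (by positivity)]
    have h2 := add_pow_le (zero_le_one' ℝ) (mul_nonneg hc (norm_nonneg q)) m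
    calc _ ≤ (2 ^ (m - 1) * (1 ^ m + (c * ‖q‖) ^ m)) * ‖G q‖ := by gcongr
      _ = _ := by rw [mul_pow]; ring

/-- The duality bracket of `M^∞` and `M¹` extends the bracket with Schwartz functions. -/
theorem bracket_eq_dualBracket (σ : 𝓢'(Phase d, ℂ)) (F : 𝓢(Phase d, ℂ)) :
    bracket σ F = dualBracket σ F := by
  set PG := schwartzPartialFourier (windowed F) with hPG
  have hVc : Continuous fun p : Phase d × Phase d => funSTFT F p := by
    simp only [funSTFT_schwartz]
    have := (schwartzPartialFourier (windowed F)).continuous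
    fun_prop
  -- The conjugated inversion formula writes conj F as a superposition of time-frequency shifted
  -- Gaussians. Their seminorms grow polynomially while the coefficients decay rapidly, so σ may be
  -- applied under the integral.
  let f : Phase d × Phase d → 𝓢(Phase d, ℂ) := fun p =>
    conj (funSTFT F p) • schwartzPhaseShift p.1 (-p.2) (gaussian d)
  have hf : Continuous f :=
    (Complex.continuous_conj.comp hVc).smul (continuous_schwartzPhaseShift_neg (gaussian d))
  have hpi := Real.pi_pos
  let K : ℕ → ℕ → ℝ := fun k n => 2 ^ n * (2 ^ (k + 1) * schwartzBound (k + 1) n (gaussian d))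
  have hK : ∀ k n, 0 ≤ K k n := fun k n => by
    have := schwartzBound_nonneg (k + 1) n (gaussian d); positivity
  let b : ℕ → ℕ → Phase d × Phase d → ℝ := fun k n p =>
    ‖funSTFT F p‖ * ((1 + 4 * Real.pi * ‖p.2‖) ^ n * (1 + ‖p.1‖) ^ (k + 1) * K k n)
  have hle : ∀ k n p, SchwartzMap.seminorm ℂ k n (f p) ≤ b k n p := by
    intro k n p
    simp only [f, b]
    rw [map_smul_eq_mul, RCLike.norm_conj]
    gcongr
    have := seminorm_schwartzPhaseShift_le k n p.1 (-p.2) (gaussian d)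
    rwa [norm_neg] at this
  have hb : ∀ k n, Integrable (b k n) := by
    intro k n
    set N := ‖((phaseEquiv d).symm : Eu (d + d) →L[ℝ] Phase d)‖ with hN
    have hz : ∀ z : Phase d, ‖z‖ ≤ N * ‖phaseEquiv d z‖ := fun z => by
      have := ((phaseEquiv d).symm : Eu (d + d) →L[ℝ] Phase d).le_opNorm (phaseEquiv d z)
      simpa using this
    have h1 := (integrable_weight_mul_norm_schwartz PG (4 * Real.pi * N) (by positivity)
      (n + (k + 1))).const_mul (K k n)
    have h2 := ((measurePreserving_phaseEquiv_prod d).integrable_comp_emb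
      (measurableEmbedding_phaseEquiv_prod d)).2 h1
    refine h2.mono' ?_ (ae_of_all _ fun p => ?_)
    · exact Continuous.aestronglyMeasurable (by fun_prop)
    · have hKk := hK k n
      rw [Real.norm_of_nonneg (by positivity)]
      simp only [b, Function.comp_apply]
      rw [funSTFT_schwartz, ← hPG]
      set q : Phase (d + d) := (phaseEquiv d p.1, phaseEquiv d p.2) with hq
      have h3 : ‖p.1‖ ≤ N * ‖q‖ := (hz _).trans (by
        gcongr; exact norm_fst_le q)
      have h4 : ‖p.2‖ ≤ N * ‖q‖ := (hz _).trans (by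
        gcongr; exact norm_snd_le q)
      have h5 : (1 + 4 * Real.pi * ‖p.2‖) ^ n ≤ (1 + 4 * Real.pi * N * ‖q‖) ^ n := by
        rw [mul_assoc _ N]; gcongr
      have h6 : (1 + ‖p.1‖) ^ (k + 1) ≤ (1 + 4 * Real.pi * N * ‖q‖) ^ (k + 1) := by
        gcongr
        refine h3.trans ?_
        have : 1 ≤ 4 * Real.pi := by linarith [Real.pi_gt_three]
        rw [mul_assoc _ N]
        exact le_mul_of_one_le_left (by positivity) this
      calc _ ≤ ‖PG q‖ * ((1 + 4 * Real.pi * N * ‖q‖) ^ n *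
            (1 + 4 * Real.pi * N * ‖q‖) ^ (k + 1) * K k n) := by gcongr
        _ = _ := by rw [pow_add]; ring
  have hF : ∀ w, schwartzConj F w = ∫ p, f p w := by
    intro w
    rw [schwartzConj_apply, funSTFT_inversion F w, ← integral_conj]
    refine integral_congr_ae (ae_of_all _ fun p => ?_)
    simp only [f, phaseShift, map_mul]
    rw [_root_.smul_apply, smul_eq_mul, ← schwartzConj_phaseShift_gaussian,
      schwartzConj_apply, schwartzPhaseShift_apply, map_mul]
  rw [bracket, apply_eq_integral_of_integrable_seminorm σ f hf b hb hle _ hF, dualBracket]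
  refine integral_congr_ae (ae_of_all _ fun p => ?_)
  simp only [f]
  rw [map_smul, smul_eq_mul, mul_comm, gaussSTFT_eq]
  rfl

end Duality

end WeylGabor

end

noncomputable section

namespace WeylGabor

/-! ### Time-frequency shifts and the short-time Fourier transform on `L²` -/

section STFT

variable {d : ℕ}

/-- The character `e^{2 π i ξ · t}` of `ℝᵈ`. -/
def chi (ξ t : Eu d) : ℂ := Complex.exp (2 * Real.pi * Complex.I * inner ℝ ξ t)

theorem norm_chi (ξ t : Eu d) : ‖chi ξ t‖ = 1 := norm_cexp_I _

theorem chi_add_left (ξ η t : Eu d) : chi (ξ + η) t = chi ξ t * chi η t := by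
  rw [chi, chi, chi, ← Complex.exp_add, inner_add_left]; push_cast; ring_nf

theorem chi_add_right (ξ s t : Eu d) : chi ξ (s + t) = chi ξ s * chi ξ t := by
  rw [chi, chi, chi, ← Complex.exp_add, inner_add_right]; push_cast; ring_nf

theorem conj_chi (ξ t : Eu d) : conj (chi ξ t) = chi (-ξ) t := by
  rw [chi, chi, ← Complex.exp_conj, inner_neg_left]
  simp only [map_mul, Complex.conj_ofReal, Complex.conj_I, map_ofNat]
  push_cast; ring_nf

theorem chi_neg_right (ξ t : Eu d) : chi ξ (-t) = chi (-ξ) t := by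
  rw [chi, chi, inner_neg_left, inner_neg_right]

theorem chi_comm (ξ t : Eu d) : chi ξ t = chi t ξ := by
  rw [chi, chi, real_inner_comm]

theorem continuous_chi : Continuous fun p : Eu d × Eu d => chi p.1 p.2 := by
  unfold chi; fun_prop

theorem continuous_chi_right (ξ : Eu d) : Continuous (chi ξ) := by
  unfold chi; fun_prop

theorem continuous_chi_left (t : Eu d) : Continuous fun ξ => chi ξ t := by
  unfold chi; fun_prop

theorem tfShift_apply (z : Phase d) (f : Eu d → ℂ) (t : Eu d) :
    tfShift z f t = chi z.2 t * f (t - z.1) := rfl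

theorem atom_ae (g : L2 d) (z : Phase d) : atom g z =ᵐ[volume] tfShift z g :=
  MemLp.coeFn_toLp _

theorem norm_atom (g : L2 d) (z : Phase d) : ‖atom g z‖ = ‖g‖ := by
  rw [atom, Lp.norm_toLp, Lp.norm_def]
  congr 1
  rw [eLpNorm_congr_norm_ae (g := fun t => g (t - z.1))]
  · exact eLpNorm_comp_measurePreserving (Lp.aestronglyMeasurable g)
      (measurePreserving_sub_right volume z.1)
  · exact ae_of_all _ fun t => by rw [tfShift_apply, norm_mul, norm_chi, one_mul]

theorem inner_eq_integral (f h : L2 d) : inner ℂ f h = ∫ t, h t * conj (f t) := rfl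

theorem norm_sq_eq_integral (f : L2 d) : ‖f‖ ^ 2 = ∫ t, ‖f t‖ ^ 2 := by
  have h := inner_self_eq_norm_sq_to_K (𝕜 := ℂ) f
  have h2 : (inner ℂ f f : ℂ) = ((∫ t, ‖f t‖ ^ 2 : ℝ) : ℂ) := by
    rw [inner_eq_integral, ← integral_complex_ofReal]
    refine integral_congr_ae (ae_of_all _ fun t => ?_)
    simp only [Complex.mul_conj, Complex.normSq_eq_norm_sq]
  rw [h2] at h
  exact (Complex.ofReal_injective (by simpa using h)).symm

theorem stft_eq_integral (γ h : L2 d) (z : Phase d) :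
    stft γ h z = ∫ t, h t * (conj (chi z.2 t) * conj (γ (t - z.1))) := by
  rw [stft, inner_eq_integral]
  refine integral_congr_ae ?_
  filter_upwards [atom_ae γ z] with t ht
  rw [ht, tfShift_apply, map_mul]

theorem norm_stft_le (γ h : L2 d) (z : Phase d) : ‖stft γ h z‖ ≤ ‖γ‖ * ‖h‖ := by
  rw [stft, ← norm_atom γ z]
  exact norm_inner_le_norm _ _

/-- Covariance of the short-time Fourier transform: substitute t ↦ t + l.1 and collect the
characters. -/
theorem stft_atom (γ g : L2 d) (l z : Phase d) :
    stft γ (atom g l) z = chi (l.2 - z.2) l.1 * stft γ g (z - l) := by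
  rw [stft_eq_integral, stft_eq_integral, ← integral_const_mul,
    ← integral_add_right_eq_self _ l.1]
  refine integral_congr_ae ?_
  have h := (measurePreserving_add_right (volume : Measure (Eu d)) l.1).quasiMeasurePreserving.ae
    (atom_ae g l)
  filter_upwards [h] with t ht
  rw [ht, tfShift_apply, add_sub_cancel_right, Prod.snd_sub, Prod.fst_sub,
    show t + l.1 - z.1 = t - (z.1 - l.1) by abel, conj_chi, conj_chi, chi_add_right, chi_add_right,
    neg_sub, sub_eq_add_neg l.2 z.2, chi_add_left, chi_add_left]
  ring

theorem norm_stft_atom (γ g : L2 d) (l z : Phase d) :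
    ‖stft γ (atom g l) z‖ = ‖stft γ g (z - l)‖ := by
  rw [stft_atom, norm_mul, norm_chi, one_mul]

theorem norm_inner_atom_atom (γ g : L2 d) (l m : Phase d) :
    ‖(inner ℂ (atom γ l) (atom g m) : ℂ)‖ = ‖stft γ g (l - m)‖ :=
  norm_stft_atom γ g m l

/-- Multiplication by a character. -/
theorem memLp_chi_mul (f : L2 d) (ξ : Eu d) : MemLp (fun t => chi ξ t * f t) 2 :=
  (Lp.memLp f).of_le ((continuous_chi_right ξ).aestronglyMeasurable.mul
    (Lp.aestronglyMeasurable f)) (ae_of_all _ fun t => by rw [norm_mul, norm_chi, one_mul])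

theorem norm_toLp_chi_mul_sub (f h : L2 d) (ξ : Eu d) :
    ‖(memLp_chi_mul f ξ).toLp - (memLp_chi_mul h ξ).toLp‖ = ‖f - h‖ := by
  rw [← MemLp.toLp_sub, Lp.norm_toLp, Lp.norm_def]
  congr 1
  refine eLpNorm_congr_norm_ae ?_
  filter_upwards [Lp.coeFn_sub f h] with t ht
  rw [ht, Pi.sub_apply, Pi.sub_apply, ← mul_sub, norm_mul, norm_chi, one_mul]

/-- Dominated convergence for the squared L² distance, with majorant 4|f|². -/
theorem continuous_toLp_chi_mul (f : L2 d) :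
    Continuous fun ξ : Eu d => (memLp_chi_mul f ξ).toLp := by
  refine continuous_iff_continuousAt.2 fun ξ₀ => ?_
  rw [ContinuousAt, tendsto_iff_norm_sub_tendsto_zero]
  have hsq : ∀ ξ, ‖(memLp_chi_mul f ξ).toLp - (memLp_chi_mul f ξ₀).toLp‖ ^ 2 =
      ∫ t, ‖chi ξ t - chi ξ₀ t‖ ^ 2 * ‖f t‖ ^ 2 := by
    intro ξ
    rw [← MemLp.toLp_sub, norm_sq_eq_integral]
    refine integral_congr_ae ?_
    filter_upwards [MemLp.coeFn_toLp ((memLp_chi_mul f ξ).sub (memLp_chi_mul f ξ₀))] with t ht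
    rw [ht, Pi.sub_apply, ← sub_mul, norm_mul, mul_pow]
  have hlim : Tendsto (fun ξ => ∫ t, ‖chi ξ t - chi ξ₀ t‖ ^ 2 * ‖f t‖ ^ 2) (𝓝 ξ₀)
      (𝓝 (∫ t, ‖chi ξ₀ t - chi ξ₀ t‖ ^ 2 * ‖f t‖ ^ 2)) := by
    have hint : Integrable fun t => 4 * ‖f t‖ ^ 2 :=
      (((memLp_two_iff_integrable_sq_norm (Lp.aestronglyMeasurable f)).1 (Lp.memLp f))).const_mul 4
    refine tendsto_integral_filter_of_dominated_convergence _ (Eventually.of_forall fun ξ => ?_)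
      (Eventually.of_forall fun ξ => ae_of_all _ fun t => ?_) hint (ae_of_all _ fun t => ?_)
    · exact (((continuous_chi_right ξ).sub (continuous_chi_right ξ₀)).norm.pow
        2).aestronglyMeasurable.mul ((Lp.aestronglyMeasurable f).norm.pow 2)
    · rw [Real.norm_of_nonneg (by positivity)]
      have h : ‖chi ξ t - chi ξ₀ t‖ ≤ 2 := (norm_sub_le _ _).trans (by rw [norm_chi, norm_chi]; norm_num)
      have : ‖chi ξ t - chi ξ₀ t‖ ^ 2 ≤ 4 := by nlinarith [norm_nonneg (chi ξ t - chi ξ₀ t)]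
      gcongr
    · have hc := ((((continuous_chi_left t).sub continuous_const).norm.pow 2).mul
        (continuous_const (y := ‖f t‖ ^ 2))).tendsto (x := ξ₀) (f := fun ξ => ‖chi ξ t - chi ξ₀ t‖ ^ 2 * ‖f t‖ ^ 2)
      exact hc
  simp only [sub_self, norm_zero, ne_eq, OfNat.ofNat_ne_zero, not_false_eq_true, zero_pow, zero_mul,
    integral_zero, ← hsq] at hlim
  have := hlim.sqrt
  simpa using this

theorem exists_continuous_translation (g : L2 d) : ∃ T : Eu d → L2 d, Continuous T ∧
    ∀ x, T x =ᵐ[volume] fun t => g (t - x) := by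
  let τ : Eu d → C(Eu d, Eu d) := fun x => ⟨fun t => t - x, by fun_prop⟩
  have hτ : Continuous τ := ContinuousMap.continuous_of_continuous_uncurry _ (by
    change Continuous fun p : Eu d × Eu d => p.2 - p.1
    fun_prop)
  have hτm : ∀ x, MeasurePreserving (τ x) := fun x => measurePreserving_sub_right volume x
  exact ⟨fun x => Lp.compMeasurePreserving (τ x) (hτm x) g,
      continuous_const.compMeasurePreservingLp hτ hτm (by simp),
      fun x => Lp.coeFn_compMeasurePreserving g (hτm x)⟩

theorem exists_modulation (d : ℕ) : ∃ M : Eu d → L2 d → L2 d,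
    (∀ f, Continuous fun ξ => M ξ f) ∧ (∀ ξ f h, ‖M ξ f - M ξ h‖ = ‖f - h‖) ∧
      ∀ ξ f, M ξ f =ᵐ[volume] fun t => chi ξ t * f t :=
  ⟨fun ξ f => (memLp_chi_mul f ξ).toLp, continuous_toLp_chi_mul,
    fun ξ f h => norm_toLp_chi_mul_sub f h ξ, fun ξ f => (memLp_chi_mul f ξ).coeFn_toLp⟩

/-- Joint continuity holds because modulations are isometries: the change of T is measured
independently of the modulation, and only the fixed vector T z₀.1 is modulated variably. -/
theorem continuous_of_modulation {M : Eu d → L2 d → L2 d} (hM : ∀ f, Continuous fun ξ => M ξ f)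
    (hM2 : ∀ ξ f h, ‖M ξ f - M ξ h‖ = ‖f - h‖) {T : Eu d → L2 d} (hT : Continuous T) :
    Continuous fun z : Phase d => M z.2 (T z.1) := by
  refine continuous_iff_continuousAt.2 fun z₀ => ?_
  rw [ContinuousAt, tendsto_iff_norm_sub_tendsto_zero]
  have h1 : Tendsto (fun z : Phase d => ‖T z.1 - T z₀.1‖ + ‖M z.2 (T z₀.1) - M z₀.2 (T z₀.1)‖)
      (𝓝 z₀) (𝓝 0) := by
    have hc : Continuous fun z : Phase d =>
        ‖T z.1 - T z₀.1‖ + ‖M z.2 (T z₀.1) - M z₀.2 (T z₀.1)‖ :=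
      ((hT.comp continuous_fst).sub continuous_const).norm.add
        (((hM (T z₀.1)).comp continuous_snd).sub continuous_const).norm
    simpa using hc.tendsto z₀
  refine squeeze_zero (fun _ => norm_nonneg _) (fun z => ?_) h1
  rw [← hM2 z.2 (T z.1)]
  exact norm_sub_le_norm_sub_add_norm_sub _ _ _

theorem continuous_atom (g : L2 d) : Continuous fun z : Phase d => atom g z := by
  obtain ⟨T, hT, hTae⟩ := exists_continuous_translation g
  obtain ⟨M, hM, hM2, hM3⟩ := exists_modulation d
  have hatom : (fun z : Phase d => atom g z) = fun z => M z.2 (T z.1) := by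
    funext z
    refine Lp.ext ?_
    filter_upwards [hTae z.1, hM3 z.2 (T z.1), atom_ae g z] with t h1 h2 h3
    rw [h3, h2, tfShift_apply, h1]
  rw [hatom]
  exact continuous_of_modulation hM hM2 hT

theorem continuous_stft (γ h : L2 d) : Continuous (stft γ h) :=
  (continuous_atom γ).inner continuous_const

end STFT

end WeylGabor

end

noncomputable section

namespace WeylGabor

/-! ### Gaussian integrals and the Wigner distribution of square-integrable functions -/

section Gaussian

variable {d : ℕ}

/-- The integral of the Gaussian `e^{-β |y|²}`. -/
def gaussConst (d : ℕ) (β : ℝ) : ℝ := (Real.pi / β) ^ ((d : ℝ) / 2)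

theorem gaussConst_pos {β : ℝ} (hβ : 0 < β) : 0 < gaussConst d β := by
  have := Real.pi_pos
  unfold gaussConst; positivity

theorem integrable_gaussian {β : ℝ} (hβ : 0 < β) :
    Integrable fun y : Eu d => Real.exp (-β * ‖y‖ ^ 2) := by
  have h := (GaussianFourier.integrable_cexp_neg_mul_sq_norm_add (V := Eu d) (b := β)
    (by simpa using hβ) 0 0).norm
  refine h.congr (ae_of_all _ fun y => ?_)
  simp only [zero_mul, add_zero]
  rw [show (-(β : ℂ) * (‖y‖ : ℂ) ^ 2) = ((-β * ‖y‖ ^ 2 : ℝ) : ℂ) by push_cast; ring,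
    Complex.norm_exp_ofReal]

theorem integral_gaussian {β : ℝ} (hβ : 0 < β) :
    ∫ y : Eu d, Real.exp (-β * ‖y‖ ^ 2) = gaussConst d β := by
  have := GaussianFourier.integral_rexp_neg_mul_sq_norm (V := Eu d) hβ
  simpa [gaussConst] using this

/-- The Fourier transform of a Gaussian. -/
theorem integral_gaussian_mul_chi {β : ℝ} (hβ : 0 < β) (s : Eu d) :
    ∫ y : Eu d, (Real.exp (-β * ‖y‖ ^ 2) : ℂ) * chi s y =
      gaussConst d β * Real.exp (-(Real.pi ^ 2 / β) * ‖s‖ ^ 2) := by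
  have h := GaussianFourier.integral_cexp_neg_mul_sq_norm_add (V := Eu d) (b := β)
    (by simpa using hβ) (2 * Real.pi * Complex.I) s
  have h2 : ((Real.pi : ℂ) / β) ^ ((Module.finrank ℝ (Eu d) : ℂ) / 2) = gaussConst d β := by
    rw [gaussConst, Complex.ofReal_cpow (by have := Real.pi_pos; positivity)]
    simp
  rw [h2] at h
  have h3 : ∀ y : Eu d, (Real.exp (-β * ‖y‖ ^ 2) : ℂ) * chi s y =
      Complex.exp (-β * ‖y‖ ^ 2 + 2 * Real.pi * Complex.I * inner ℝ s y) := by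
    intro y
    rw [chi, Complex.ofReal_exp, ← Complex.exp_add]
    push_cast; rfl
  simp only [h3]
  rw [h]
  congr 1
  · rw [Complex.ofReal_exp]
    congr 1
    have hb : (β : ℂ) ≠ 0 := by exact_mod_cast hβ.ne'
    push_cast
    rw [mul_pow, mul_pow, Complex.I_sq]
    field_simp
    ring

/-- The Fourier transform of a time-frequency shifted Gaussian. -/
theorem integral_shifted_gaussian_mul_chi {β : ℝ} (hβ : 0 < β) (c m t : Eu d) :
    ∫ ξ : Eu d, (Real.exp (-β * ‖ξ - c‖ ^ 2) * chi m (ξ - c)) * conj (chi ξ t) =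
      gaussConst d β * (conj (chi c t) * Real.exp (-(Real.pi ^ 2 / β) * ‖m - t‖ ^ 2)) := by
  rw [← integral_add_right_eq_self _ c]
  have h : ∀ y : Eu d, (Real.exp (-β * ‖y + c - c‖ ^ 2) * chi m (y + c - c)) *
      conj (chi (y + c) t) = conj (chi c t) * (Real.exp (-β * ‖y‖ ^ 2) * chi (m - t) y) := by
    intro y
    rw [add_sub_cancel_right, chi_add_left, map_mul, sub_eq_add_neg m t, chi_add_left,
      ← conj_chi t y, chi_comm t y]
    ring
  simp only [h]
  rw [integral_const_mul, integral_gaussian_mul_chi hβ]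
  ring

theorem integrable_shifted_gaussian {β : ℝ} (hβ : 0 < β) (c m : Eu d) :
    Integrable fun ξ : Eu d => (Real.exp (-β * ‖ξ - c‖ ^ 2) : ℂ) * chi m (ξ - c) := by
  refine ((integrable_gaussian hβ).comp_sub_right c).mono' ?_ (ae_of_all _ fun ξ => ?_)
  · have := continuous_chi_right m
    exact Continuous.aestronglyMeasurable (by fun_prop)
  · rw [norm_mul, norm_chi, mul_one, Complex.norm_real, Real.norm_of_nonneg (Real.exp_pos _).le]

/-- The multiplication formula for the Fourier transform. -/
theorem integral_fourier_mul {p q : Eu d → ℂ} (hp : Integrable p) (hq : Integrable q) :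
    ∫ ξ, (∫ t, p t * conj (chi ξ t)) * q ξ = ∫ t, p t * ∫ ξ, q ξ * conj (chi ξ t) := by
  have hint : Integrable fun x : Eu d × Eu d => (q x.1 * p x.2) * conj (chi x.1 x.2) := by
    refine (hq.mul_prod hp).mono ((hq.mul_prod hp).1.mul
      (Complex.continuous_conj.comp continuous_chi).aestronglyMeasurable) (ae_of_all _ fun x => ?_)
    rw [norm_mul (q x.1 * p x.2), RCLike.norm_conj, norm_chi, mul_one]
  have h1 : ∀ ξ, (∫ t, p t * conj (chi ξ t)) * q ξ = ∫ t, (q ξ * p t) * conj (chi ξ t) := by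
    intro ξ
    rw [← integral_mul_const]
    exact integral_congr_ae (ae_of_all _ fun t => by ring)
  have h2 : ∀ t, p t * ∫ ξ, q ξ * conj (chi ξ t) = ∫ ξ, (q ξ * p t) * conj (chi ξ t) := by
    intro t
    rw [← integral_const_mul]
    exact integral_congr_ae (ae_of_all _ fun t => by ring)
  simp only [h1, h2]
  exact integral_integral_swap hint

/-- The Gaussian `e^{-4 π |t|²}` on `ℝᵈ`. -/
def theta (t : Eu d) : ℝ := Real.exp (-(4 * Real.pi) * ‖t‖ ^ 2)

theorem theta_pos (t : Eu d) : 0 < theta t := Real.exp_pos _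

theorem continuous_theta : Continuous (theta (d := d)) := by unfold theta; fun_prop

theorem theta_sq (t : Eu d) : theta t ^ 2 = Real.exp (-(8 * Real.pi) * ‖t‖ ^ 2) := by
  rw [theta, ← Real.exp_nat_mul]; congr 1; push_cast; ring

theorem integrable_theta_sq : Integrable fun t : Eu d => theta t ^ 2 := by
  simp only [theta_sq]
  exact integrable_gaussian (by positivity)

theorem memLp_theta : MemLp (fun t : Eu d => (theta t : ℂ)) 2 := by
  refine (memLp_two_iff_integrable_sq_norm
    (Complex.continuous_ofReal.comp continuous_theta).aestronglyMeasurable).2 ?_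
  simpa using integrable_theta_sq

/-- The Gaussian `e^{-4 π |t|²}` as an element of `L²(ℝᵈ)`. -/
def thetaLp (d : ℕ) : L2 d := memLp_theta.toLp

theorem stft_thetaLp (h : L2 d) (z : Phase d) :
    stft (thetaLp d) h z = ∫ t, h t * (conj (chi z.2 t) * theta (t - z.1)) := by
  rw [stft_eq_integral]
  refine integral_congr_ae ?_
  have h1 := (measurePreserving_sub_right (volume : Measure (Eu d)) z.1).quasiMeasurePreserving.ae
    (memLp_theta (d := d)).coeFn_toLp
  filter_upwards [h1] with t ht
  rw [thetaLp, ht, Complex.conj_ofReal]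

theorem measurable_L2 (h : L2 d) : Measurable h := (Lp.stronglyMeasurable h).measurable

theorem integrable_sq_L2 (h : L2 d) : Integrable fun t => ‖h t‖ ^ 2 :=
  (memLp_two_iff_integrable_sq_norm (Lp.aestronglyMeasurable h)).1 (Lp.memLp h)

/-- From ab ≤ a² + b². The bound does not depend on the centre c, so it can later be integrated
against γ. -/
theorem integrable_norm_mul_theta (h : L2 d) (c : Eu d) :
    Integrable (fun a => ‖h a‖ * theta (a - c)) ∧
      ∫ a, ‖h a‖ * theta (a - c) ≤ ‖h‖ ^ 2 + ∫ t : Eu d, theta t ^ 2 := by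
  have hle : ∀ a, ‖h a‖ * theta (a - c) ≤ ‖h a‖ ^ 2 + theta (a - c) ^ 2 := fun a => by
    nlinarith [sq_nonneg (‖h a‖ - theta (a - c)), sq_nonneg (‖h a‖), sq_nonneg (theta (a - c))]
  have hi2 : Integrable fun a => theta (a - c) ^ 2 := integrable_theta_sq.comp_sub_right c
  have hi := (integrable_sq_L2 h).add hi2
  have hI : Integrable (fun a => ‖h a‖ * theta (a - c)) := by
    refine hi.mono' ?_ (ae_of_all _ fun a => ?_)
    · exact ((measurable_L2 h).norm.mul
        (continuous_theta.measurable.comp (measurable_sub_const c))).aestronglyMeasurable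
    · rw [Real.norm_of_nonneg (mul_nonneg (norm_nonneg _) (theta_pos _).le)]
      exact hle a
  refine ⟨hI, (integral_mono hI hi hle).trans (le_of_eq ?_)⟩
  rw [Pi.add_def, integral_add (integrable_sq_L2 h) hi2, norm_sq_eq_integral,
    integral_sub_right_eq_self (fun t : Eu d => theta t ^ 2) c]

theorem integrable_mul_chi_theta (h : L2 d) (ξ c : Eu d) :
    Integrable fun a => h a * (conj (chi ξ a) * theta (a - c)) := by
  refine (integrable_norm_mul_theta h c).1.mono' ?_ (ae_of_all _ fun a => ?_)
  · have h1 := (continuous_chi_right ξ)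
    have h2 : Continuous fun a : Eu d => conj (chi ξ a) * (theta (a - c) : ℂ) :=
      (Complex.continuous_conj.comp h1).mul
        (Complex.continuous_ofReal.comp (continuous_theta.comp (continuous_sub_right c)))
    exact ((measurable_L2 h).mul h2.measurable).aestronglyMeasurable
  · rw [norm_mul, norm_mul, RCLike.norm_conj, norm_chi, one_mul, Complex.norm_real,
      Real.norm_of_nonneg (theta_pos _).le]

end Gaussian

end WeylGabor

end

noncomputable section

namespace WeylGabor

/-! ### The Wigner distribution of square-integrable functions -/

section WignerL2

variable {d : ℕ}

theorem ae_comp_affine {P : Eu d → Prop} (hP : ∀ᵐ s, P s) (x : Eu d) {r : ℝ} (hr : r ≠ 0) :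
    ∀ᵐ t : Eu d, P (x + r • t) := by
  have h1 : Measure.QuasiMeasurePreserving (fun t : Eu d => r • t) volume volume := by
    refine ⟨measurable_const_smul r, ?_⟩
    rw [Measure.map_addHaar_smul _ hr]
    exact Measure.smul_absolutelyContinuous
  exact h1.ae ((measurePreserving_add_left volume x).quasiMeasurePreserving.ae hP)

theorem ae_comp_affine_sub {P : Eu d → Prop} (hP : ∀ᵐ s, P s) (x : Eu d) {r : ℝ} (hr : r ≠ 0) :
    ∀ᵐ t : Eu d, P (x - r • t) := by
  have := ae_comp_affine hP x (neg_ne_zero.2 hr)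
  simpa [sub_eq_add_neg] using this

theorem wigner_eq (h f : Eu d → ℂ) (z : Phase d) : wigner h f z =
    ∫ t : Eu d, h (z.1 + (1 / 2 : ℝ) • t) * conj (f (z.1 - (1 / 2 : ℝ) • t)) *
      conj (chi z.2 t) := by
  refine integral_congr_ae (ae_of_all _ fun t => ?_)
  simp only
  rw [conj_chi, chi, inner_neg_left, real_inner_comm]
  congr 2
  push_cast; ring

theorem wigner_congr {h h' f f' : Eu d → ℂ} (hh : h =ᵐ[volume] h') (hf : f =ᵐ[volume] f') :
    wigner h f = wigner h' f' := by
  funext z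
  refine integral_congr_ae ?_
  filter_upwards [ae_comp_affine hh z.1 (r := 1 / 2) (by norm_num),
    ae_comp_affine_sub hf z.1 (r := 1 / 2) (by norm_num)] with t h1 h2
  rw [h1, h2]

/-- Again ab ≤ a² + b²; the dilation by 1/2 produces the factor 2^d. The bound is uniform in x. -/
theorem integrable_wigner_integrand (h f : L2 d) (x : Eu d) :
    Integrable (fun t : Eu d => h (x + (1 / 2 : ℝ) • t) * conj (f (x - (1 / 2 : ℝ) • t))) ∧
      ∫ t : Eu d, ‖h (x + (1 / 2 : ℝ) • t) * conj (f (x - (1 / 2 : ℝ) • t))‖ ≤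
        2 ^ d * (‖h‖ ^ 2 + ‖f‖ ^ 2) := by
  have hfin : Module.finrank ℝ (Eu d) = d := by simp
  have h1 : Integrable (fun t : Eu d => ‖h (x + (1 / 2 : ℝ) • t)‖ ^ 2) :=
    ((integrable_sq_L2 h).comp_add_left x).comp_smul (by norm_num : (1 / 2 : ℝ) ≠ 0)
  have h2 : Integrable (fun t : Eu d => ‖f (x - (1 / 2 : ℝ) • t)‖ ^ 2) :=
    ((integrable_sq_L2 f).comp_sub_left x).comp_smul (by norm_num : (1 / 2 : ℝ) ≠ 0)
  have e1 : ∫ t : Eu d, ‖h (x + (1 / 2 : ℝ) • t)‖ ^ 2 = 2 ^ d * ‖h‖ ^ 2 := by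
    rw [Measure.integral_comp_smul volume (fun t : Eu d => ‖h (x + t)‖ ^ 2),
      integral_add_left_eq_self (fun t : Eu d => ‖h t‖ ^ 2), ← norm_sq_eq_integral, hfin]
    simp
  have e2 : ∫ t : Eu d, ‖f (x - (1 / 2 : ℝ) • t)‖ ^ 2 = 2 ^ d * ‖f‖ ^ 2 := by
    rw [Measure.integral_comp_smul volume (fun t : Eu d => ‖f (x - t)‖ ^ 2),
      integral_sub_left_eq_self (fun t : Eu d => ‖f t‖ ^ 2), ← norm_sq_eq_integral, hfin]
    simp
  have hle : ∀ t : Eu d, ‖h (x + (1 / 2 : ℝ) • t) * conj (f (x - (1 / 2 : ℝ) • t))‖ ≤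
      ‖h (x + (1 / 2 : ℝ) • t)‖ ^ 2 + ‖f (x - (1 / 2 : ℝ) • t)‖ ^ 2 := fun t => by
    rw [norm_mul, RCLike.norm_conj]
    nlinarith [sq_nonneg (‖h (x + (1 / 2 : ℝ) • t)‖ - ‖f (x - (1 / 2 : ℝ) • t)‖),
      sq_nonneg (‖h (x + (1 / 2 : ℝ) • t)‖), sq_nonneg (‖f (x - (1 / 2 : ℝ) • t)‖)]
  have hm : AEStronglyMeasurable
      (fun t : Eu d => h (x + (1 / 2 : ℝ) • t) * conj (f (x - (1 / 2 : ℝ) • t))) := by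
    have m1 : Measurable fun t : Eu d => h (x + (1 / 2 : ℝ) • t) :=
      (measurable_L2 h).comp (by fun_prop)
    have m2 : Measurable fun t : Eu d => f (x - (1 / 2 : ℝ) • t) :=
      (measurable_L2 f).comp (by fun_prop)
    exact (m1.mul (Complex.continuous_conj.measurable.comp m2)).aestronglyMeasurable
  have hI := (h1.add h2).mono' hm (ae_of_all _ hle)
  refine ⟨hI, (integral_mono hI.norm (h1.add h2) hle).trans (le_of_eq ?_)⟩
  rw [Pi.add_def, integral_add h1 h2, e1, e2]; ring

theorem norm_wigner_le (h f : L2 d) (z : Phase d) :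
    ‖wigner h f z‖ ≤ 2 ^ d * (‖h‖ ^ 2 + ‖f‖ ^ 2) := by
  rw [wigner_eq]
  refine (norm_integral_le_integral_norm _).trans (le_trans (le_of_eq ?_)
    (integrable_wigner_integrand h f z.1).2)
  refine integral_congr_ae (ae_of_all _ fun t => ?_)
  simp only
  rw [norm_mul _ (conj (chi z.2 t)), RCLike.norm_conj, norm_chi, mul_one]

theorem integrable_wigner_integrand_mul_chi (h f : L2 d) (z : Phase d) :
    Integrable fun t : Eu d => h (z.1 + (1 / 2 : ℝ) • t) * conj (f (z.1 - (1 / 2 : ℝ) • t)) *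
      conj (chi z.2 t) := by
  have h1 := (integrable_wigner_integrand h f z.1).1
  refine h1.mono (h1.1.mul (Complex.continuous_conj.comp
    (continuous_chi_right z.2)).aestronglyMeasurable) (ae_of_all _ fun t => ?_)
  rw [norm_mul _ (conj (chi z.2 t)), RCLike.norm_conj, norm_chi, mul_one]

theorem stronglyMeasurable_wigner (h f : L2 d) : StronglyMeasurable (wigner h f) := by
  have : wigner h f = fun z => ∫ t : Eu d, h (z.1 + (1 / 2 : ℝ) • t) *
      conj (f (z.1 - (1 / 2 : ℝ) • t)) * conj (chi z.2 t) := funext (wigner_eq h f)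
  rw [this]
  refine StronglyMeasurable.integral_prod_right (f := fun (z : Phase d) (t : Eu d) =>
    h (z.1 + (1 / 2 : ℝ) • t) * conj (f (z.1 - (1 / 2 : ℝ) • t)) * conj (chi z.2 t)) ?_
  have m1 : Measurable fun p : Phase d × Eu d => h (p.1.1 + (1 / 2 : ℝ) • p.2) :=
    (measurable_L2 h).comp (by fun_prop)
  have m2 : Measurable fun p : Phase d × Eu d => conj (f (p.1.1 - (1 / 2 : ℝ) • p.2)) :=
    Complex.continuous_conj.measurable.comp ((measurable_L2 f).comp (by fun_prop))
  have m3 : Measurable fun p : Phase d × Eu d => conj (chi p.1.2 p.2) :=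
    (Complex.continuous_conj.comp (continuous_chi.comp
      (by fun_prop : Continuous fun p : Phase d × Eu d => (p.1.2, p.2)))).measurable
  exact ((m1.mul m2).mul m3).stronglyMeasurable

theorem wigner_add_left (h h' f : L2 d) (z : Phase d) :
    wigner (h + h' : L2 d) f z = wigner h f z + wigner h' f z := by
  rw [wigner_congr (Lp.coeFn_add h h') (ae_eq_refl _), wigner_eq, wigner_eq, wigner_eq,
    ← integral_add (integrable_wigner_integrand_mul_chi h f z)
      (integrable_wigner_integrand_mul_chi h' f z)]
  refine integral_congr_ae (ae_of_all _ fun t => ?_)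
  simp only [Pi.add_apply]; ring

theorem wigner_add_right (h f f' : L2 d) (z : Phase d) :
    wigner h (f + f' : L2 d) z = wigner h f z + wigner h f' z := by
  rw [wigner_congr (ae_eq_refl _) (Lp.coeFn_add f f'), wigner_eq, wigner_eq, wigner_eq,
    ← integral_add (integrable_wigner_integrand_mul_chi h f z)
      (integrable_wigner_integrand_mul_chi h f' z)]
  refine integral_congr_ae (ae_of_all _ fun t => ?_)
  simp only [Pi.add_apply, map_add]; ring

theorem wigner_smul_left (c : ℂ) (h f : L2 d) (z : Phase d) :
    wigner (c • h : L2 d) f z = c * wigner h f z := by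
  rw [wigner_congr (Lp.coeFn_smul c h) (ae_eq_refl _), wigner_eq, wigner_eq, ← integral_const_mul]
  refine integral_congr_ae (ae_of_all _ fun t => ?_)
  simp only [Pi.smul_apply, smul_eq_mul]; ring

theorem wigner_smul_right (c : ℂ) (h f : L2 d) (z : Phase d) :
    wigner h (c • f : L2 d) z = conj c * wigner h f z := by
  rw [wigner_congr (ae_eq_refl _) (Lp.coeFn_smul c f), wigner_eq, wigner_eq, ← integral_const_mul]
  refine integral_congr_ae (ae_of_all _ fun t => ?_)
  simp only [Pi.smul_apply, smul_eq_mul, map_mul]; ring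

/-- Covariance of the Wigner distribution. -/
theorem wigner_tfShift (g : Eu d → ℂ) (l m w : Phase d) :
    wigner (tfShift l g) (tfShift m g) w =
      chi ((1 / 2 : ℝ) • (l.2 + m.2)) (l.1 - m.1) *
        phaseShift ((1 / 2 : ℝ) • (l + m)) (rot (l - m)) (wigner g g) w := by
  -- After translating t by l.1 - m.1 both arguments of g are centred at w - (l + m)/2; what remains
  -- is to compare the phases (`key`).
  rw [phaseShift, wigner_eq, wigner_eq, ← integral_const_mul, ← integral_const_mul,
    ← integral_add_right_eq_self _ (l.1 - m.1)]
  refine integral_congr_ae (ae_of_all _ fun t => ?_)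
  have e1 : w.1 + (1 / 2 : ℝ) • (t + (l.1 - m.1)) - l.1 =
      (w - (1 / 2 : ℝ) • (l + m)).1 + (1 / 2 : ℝ) • t := by
    simp only [Prod.fst_sub, Prod.smul_fst, Prod.fst_add]; module
  have e2 : w.1 - (1 / 2 : ℝ) • (t + (l.1 - m.1)) - m.1 =
      (w - (1 / 2 : ℝ) • (l + m)).1 - (1 / 2 : ℝ) • t := by
    simp only [Prod.fst_sub, Prod.smul_fst, Prod.fst_add]; module
  simp only [tfShift_apply, e1, e2, map_mul]
  have key : chi l.2 (w.1 + (1 / 2 : ℝ) • (t + (l.1 - m.1))) *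
      conj (chi m.2 (w.1 - (1 / 2 : ℝ) • (t + (l.1 - m.1)))) * conj (chi w.2 (t + (l.1 - m.1))) =
      chi ((1 / 2 : ℝ) • (l.2 + m.2)) (l.1 - m.1) * phaseChar (rot (l - m)) w *
        conj (chi (w - (1 / 2 : ℝ) • (l + m)).2 t) := by
    simp only [conj_chi]
    simp only [chi, phaseChar, ← Complex.exp_add, ← mul_add, ← Complex.ofReal_add]
    congr 3
    simp only [phaseDot, rot, inner_add_left, inner_add_right, inner_sub_left, inner_sub_right,
      inner_neg_left, real_inner_smul_left, real_inner_smul_right, Prod.fst_sub, Prod.snd_sub,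
      Prod.smul_snd, Prod.snd_add]
    rw [real_inner_comm l.1 w.2, real_inner_comm m.1 w.2]
    ring
  linear_combination (g ((w - (1 / 2 : ℝ) • (l + m)).1 + (1 / 2 : ℝ) • t) *
    conj (g ((w - (1 / 2 : ℝ) • (l + m)).1 - (1 / 2 : ℝ) • t))) * key

end WignerL2

end WeylGabor

end

noncomputable section

namespace WeylGabor

/-! ### The short-time Fourier transform of the Wigner distribution -/

section WignerSTFT

variable {d : ℕ}

/-- The map factors into the shear (x, t) ↦ (x + t/2, t) and the map (a, t) ↦ (a, a - t). -/
theorem measurePreserving_wignerCoords (d : ℕ) : MeasurePreserving (wignerCoords d) := by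
  have h1 : MeasurePreserving (fun z : Eu d × Eu d => (z.1 + (1 / 2 : ℝ) • z.2, z.2)) := by
    have := (MeasurePreserving.id (volume : Measure (Eu d))).skew_product
      (g := fun t x : Eu d => x + (1 / 2 : ℝ) • t) (by fun_prop)
      (ae_of_all _ fun t => (measurePreserving_add_right volume ((1 / 2 : ℝ) • t)).map_eq)
    exact (Measure.measurePreserving_swap.comp this).comp Measure.measurePreserving_swap
  have h2 : MeasurePreserving (fun z : Eu d × Eu d => (z.1, z.1 - z.2)) :=
    (MeasurePreserving.id (volume : Measure (Eu d))).skew_product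
      (g := fun a t : Eu d => a - t) (by fun_prop)
      (ae_of_all _ fun a => (Measure.measurePreserving_sub_left volume a).map_eq)
  have h3 : (wignerCoords d : Phase d → Phase d) =
      (fun z : Eu d × Eu d => (z.1, z.1 - z.2)) ∘
        fun z : Eu d × Eu d => (z.1 + (1 / 2 : ℝ) • z.2, z.2) := by
    funext z
    refine Prod.ext rfl ?_
    change z.1 - (1 / 2 : ℝ) • z.2 = z.1 + (1 / 2 : ℝ) • z.2 - z.2
    module
  rw [h3]
  exact h2.comp h1

/-- The Gaussian `e^{-8 π |v|² / 15}`. -/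
def gammaGauss (v : Eu d) : ℝ := Real.exp (-(8 * Real.pi / 15) * ‖v‖ ^ 2)

/-- Completing the square in v, with centre 15(p + q)/32. The constants of θ and γ are chosen for
this: W(θ, θ) is a multiple of e^{-8π|x|²} e^{-π|ξ|²/2}, correct in ξ but too narrow in x, and
convolution with γ in x widens e^{-8π|x|²} to a multiple of e^{-π|x|²/2}, since 1/8 + 15/8 = 2. The
right-hand side is the result in the coordinates (p + q)/2 and p - q. -/
theorem integral_gamma_theta_theta (p q : Eu d) :
    ∫ v, gammaGauss v * (theta (p - v) * theta (q - v)) = gaussConst d (128 * Real.pi / 15) *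
      (Real.exp (-(Real.pi / 2) * ‖(1 / 2 : ℝ) • (p + q)‖ ^ 2) *
        Real.exp (-(2 * Real.pi) * ‖p - q‖ ^ 2)) := by
  have h : ∀ v : Eu d, gammaGauss v * (theta (p - v) * theta (q - v)) =
      (Real.exp (-(Real.pi / 2) * ‖(1 / 2 : ℝ) • (p + q)‖ ^ 2) *
        Real.exp (-(2 * Real.pi) * ‖p - q‖ ^ 2)) *
        Real.exp (-(128 * Real.pi / 15) * ‖v - (15 / 32 : ℝ) • (p + q)‖ ^ 2) := by
    intro v
    simp only [gammaGauss, theta, ← Real.exp_add]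
    congr 1
    simp only [← real_inner_self_eq_norm_sq, inner_add_left, inner_add_right, inner_sub_left,
      inner_sub_right, real_inner_smul_left, real_inner_smul_right]
    rw [real_inner_comm v p, real_inner_comm v q, real_inner_comm q p]
    ring
  simp only [h]
  rw [integral_const_mul,
    integral_sub_right_eq_self (fun v : Eu d => Real.exp (-(128 * Real.pi / 15) * ‖v‖ ^ 2)),
    integral_gaussian (by positivity), mul_comm]

/-- The integrand `h(a) conj(chi ξ a) θ(a - x)` of a short-time Fourier transform. -/
def stftIntegrand (h : L2 d) (x ξ a : Eu d) : ℂ := h a * (conj (chi ξ a) * theta (a - x))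

theorem norm_stftIntegrand (h : L2 d) (x ξ a : Eu d) :
    ‖stftIntegrand h x ξ a‖ = ‖h a‖ * theta (a - x) := by
  rw [stftIntegrand, norm_mul, norm_mul, RCLike.norm_conj, norm_chi, one_mul, Complex.norm_real,
    Real.norm_of_nonneg (theta_pos _).le]

theorem measurable_stftIntegrand {X : Type*} [MeasurableSpace X] (h : L2 d) (ξ : Eu d)
    {a x : X → Eu d} (ha : Measurable a) (hx : Measurable x) :
    Measurable fun p => stftIntegrand h (x p) ξ (a p) :=
  ((measurable_L2 h).comp ha).mul
    ((Complex.continuous_conj.measurable.comp ((continuous_chi_right ξ).measurable.comp ha)).mul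
      (Complex.continuous_ofReal.measurable.comp
        (continuous_theta.measurable.comp (ha.sub hx))))

/-- The product integrand in the formula for the short-time Fourier transform of `W(h, f)`. -/
def wignerIntegrand (h f : L2 d) (A B ξ η : Eu d) (p : (Eu d × Eu d) × Eu d) : ℂ :=
  gammaGauss p.2 * (stftIntegrand h (A + p.2) ξ p.1.1 * conj (stftIntegrand f (B + p.2) η p.1.2))

/-- Justifies Fubini in (a, b, v): for fixed v the integrals over a and b are bounded independently
of v, and γ is integrable. -/
theorem integrable_wignerIntegrand (h f : L2 d) (A B ξ η : Eu d) :
    Integrable (wignerIntegrand h f A B ξ η) := by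
  have hm : Measurable (wignerIntegrand h f A B ξ η) := by
    have h0 : Measurable fun p : (Eu d × Eu d) × Eu d => (gammaGauss p.2 : ℂ) := by
      unfold gammaGauss
      exact Continuous.measurable (by fun_prop)
    exact h0.mul ((measurable_stftIntegrand h ξ (by fun_prop) (by fun_prop)).mul
      (Complex.continuous_conj.measurable.comp
        (measurable_stftIntegrand f η (by fun_prop) (by fun_prop))))
  have hn : ∀ v a b, ‖wignerIntegrand h f A B ξ η ((a, b), v)‖ =
      gammaGauss v * ((‖h a‖ * theta (a - (A + v))) * (‖f b‖ * theta (b - (B + v)))) := by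
    intro v a b
    have hg : ‖gammaGauss v‖ = gammaGauss v := Real.norm_of_nonneg (Real.exp_pos _).le
    rw [wignerIntegrand, norm_mul, norm_mul, RCLike.norm_conj, norm_stftIntegrand,
      norm_stftIntegrand, Complex.norm_real]
    simp only [hg]
  refine (integrable_prod_iff' hm.aestronglyMeasurable).2 ⟨ae_of_all _ fun v => ?_, ?_⟩
  · refine ((((integrable_norm_mul_theta h (A + v)).1.mul_prod
      (integrable_norm_mul_theta f (B + v)).1)).const_mul (gammaGauss v)).mono'
      (hm.comp (by fun_prop)).aestronglyMeasurable (ae_of_all _ fun p => ?_)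
    exact (hn v p.1 p.2).le
  · set Th := ∫ t : Eu d, theta t ^ 2 with hTh
    have hTh0 : 0 ≤ Th := integral_nonneg fun t => sq_nonneg _
    refine ((integrable_gaussian (d := d) (β := 8 * Real.pi / 15) (by positivity)).mul_const
      ((‖h‖ ^ 2 + Th) * (‖f‖ ^ 2 + Th))).mono' ?_ (ae_of_all _ fun v => ?_)
    · exact (hm.norm.stronglyMeasurable.integral_prod_left'
        (μ := (volume : Measure (Eu d × Eu d)))).aestronglyMeasurable
    · have h1 : ∫ p : Eu d × Eu d, ‖wignerIntegrand h f A B ξ η (p, v)‖ =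
          gammaGauss v * ((∫ a, ‖h a‖ * theta (a - (A + v))) *
            ∫ b, ‖f b‖ * theta (b - (B + v))) := by
        rw [← integral_prod_mul, ← integral_const_mul]
        exact integral_congr_ae (ae_of_all _ fun p => hn v p.1 p.2)
      rw [h1]
      have hh := integrable_norm_mul_theta h (A + v)
      have hf := integrable_norm_mul_theta f (B + v)
      have n1 : 0 ≤ ∫ a, ‖h a‖ * theta (a - (A + v)) :=
        integral_nonneg fun a => mul_nonneg (norm_nonneg _) (theta_pos _).le
      have n2 : 0 ≤ ∫ a, ‖f a‖ * theta (a - (B + v)) :=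
        integral_nonneg fun a => mul_nonneg (norm_nonneg _) (theta_pos _).le
      have n3 : 0 ≤ gammaGauss v := (Real.exp_pos _).le
      rw [Real.norm_of_nonneg (mul_nonneg n3 (mul_nonneg n1 n2))]
      refine mul_le_mul_of_nonneg_left ?_ n3
      exact mul_le_mul hh.2 hf.2 n2 (by positivity)

/-- Integrating over (a, b) first splits the integrand into a product of two short-time Fourier
transforms with window θ. -/
theorem integral_wignerIntegrand (h f : L2 d) (A B ξ η : Eu d) :
    ∫ p : Eu d × Eu d, ∫ v, wignerIntegrand h f A B ξ η (p, v) =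
      ∫ v, (gammaGauss v : ℂ) *
        (stft (thetaLp d) h (A + v, ξ) * conj (stft (thetaLp d) f (B + v, η))) := by
  rw [integral_integral_swap (f := fun p v => wignerIntegrand h f A B ξ η (p, v))
    (integrable_wignerIntegrand h f A B ξ η)]
  refine integral_congr_ae (ae_of_all _ fun v => ?_)
  simp only [wignerIntegrand]
  rw [integral_const_mul, stft_thetaLp, stft_thetaLp, ← integral_conj]
  congr 1
  exact integral_prod_mul (stftIntegrand h (A + v) ξ) fun b => conj (stftIntegrand f (B + v) η b)

theorem phaseChar_mk (ζ w : Phase d) : phaseChar ζ w = chi ζ.1 w.1 * chi ζ.2 w.2 := by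
  rw [phaseChar, chi, chi, ← Complex.exp_add, phaseDot]
  push_cast; ring_nf

theorem gaussian_eq_mul (w : Phase d) : gaussian d w =
    (Real.exp (-(Real.pi / 2) * ‖w.1‖ ^ 2) : ℂ) * Real.exp (-(Real.pi / 2) * ‖w.2‖ ^ 2) := by
  rw [gaussian_apply, ← Complex.ofReal_mul, ← Real.exp_add, phaseDot, real_inner_self_eq_norm_sq,
    real_inner_self_eq_norm_sq]
  congr 2; ring

/-- Both sides are the integral over the plane of (a, b) = (x + t/2, x - t/2). On the right,
integrating over v turns γ, θ, θ into a Gaussian in x times a Gaussian in t. On the left,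
integrating over the frequency y of W(h, f)(x, y) against the Gaussian produces the same Gaussian in
t. -/
theorem funSTFT_wigner (h f : L2 d) (u η : Phase d) : funSTFT (wigner h f) (u, η) =
    gaussConst d (Real.pi / 2) * conj (chi η.2 u.2) * (gaussConst d (128 * Real.pi / 15))⁻¹ *
      ∫ v, (gammaGauss v : ℂ) *
        (stft (thetaLp d) h (u.1 - (1 / 2 : ℝ) • η.2 + v, u.2 + (1 / 2 : ℝ) • η.1) *
          conj (stft (thetaLp d) f (u.1 + (1 / 2 : ℝ) • η.2 + v, u.2 - (1 / 2 : ℝ) • η.1))) := by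
  set A := u.1 - (1 / 2 : ℝ) • η.2
  set B := u.1 + (1 / 2 : ℝ) • η.2
  set Θ := wignerIntegrand h f A B (u.2 + (1 / 2 : ℝ) • η.1) (u.2 - (1 / 2 : ℝ) • η.1) with hΘ
  have hΘi : Integrable Θ := integrable_wignerIntegrand _ _ _ _ _ _
  let Φ : Eu d × Eu d → ℂ := fun p => ∫ v, Θ (p, v)
  have hΦi : Integrable Φ := hΘi.integral_prod_left
  rw [← integral_wignerIntegrand, ← hΘ]
  change _ = _ * ∫ p, Φ p
  let γ₀ : Eu d → ℂ := fun y => (Real.exp (-(Real.pi / 2) * ‖y‖ ^ 2) : ℂ)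
  -- The right-hand integrand in Wigner coordinates, after the v-integral.
  have hΦ : ∀ x t : Eu d, Φ (wignerCoords d (x, t)) = gaussConst d (128 * Real.pi / 15) *
      (conj (chi η.1 x) * γ₀ (x - u.1) * (h (x + (1 / 2 : ℝ) • t) *
        conj (f (x - (1 / 2 : ℝ) • t)) *
        (conj (chi u.2 t) * Real.exp (-(2 * Real.pi) * ‖t + η.2‖ ^ 2)))) := by
    intro x t
    set a := x + (1 / 2 : ℝ) • t with ha
    set b := x - (1 / 2 : ℝ) • t with hb
    have h1 : ∀ v, Θ ((a, b), v) = (h a * conj (f b) * (conj (chi (u.2 + (1 / 2 : ℝ) • η.1) a) *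
        chi (u.2 - (1 / 2 : ℝ) • η.1) b)) *
        ((gammaGauss v * (theta (a - A - v) * theta (b - B - v)) : ℝ) : ℂ) := by
      intro v
      simp only [hΘ, wignerIntegrand, stftIntegrand, map_mul, Complex.conj_conj, Complex.conj_ofReal,
        sub_sub]
      push_cast; ring
    change ∫ v, Θ ((a, b), v) = _
    simp only [h1]
    rw [integral_const_mul, integral_complex_ofReal, integral_gamma_theta_theta]
    have h2 : (1 / 2 : ℝ) • (a - A + (b - B)) = x - u.1 := by
      simp only [ha, hb, A, B]; module
    have h3 : a - A - (b - B) = t + η.2 := by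
      simp only [ha, hb, A, B]; module
    have h4 : conj (chi (u.2 + (1 / 2 : ℝ) • η.1) a) * chi (u.2 - (1 / 2 : ℝ) • η.1) b =
        conj (chi η.1 x) * conj (chi u.2 t) := by
      simp only [conj_chi]
      simp only [chi, ← Complex.exp_add, ← mul_add, ← Complex.ofReal_add]
      congr 3
      simp only [ha, hb, inner_add_left, inner_add_right, inner_sub_left, inner_sub_right,
        inner_neg_left, real_inner_smul_left, real_inner_smul_right]
      ring
    rw [h2, h3, h4]
    simp only [γ₀]
    push_cast; ring
  have hγi : Integrable γ₀ := (integrable_gaussian (d := d) (β := Real.pi / 2) (by positivity)).ofReal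
  have hγc : Continuous γ₀ := by fun_prop
  have hF : ∀ w : Phase d, wigner h f w * conj (phaseShift u η (gaussian d) w) =
      (conj (chi η.1 w.1) * γ₀ (w.1 - u.1)) *
        (wigner h f w * (conj (chi η.2 w.2) * γ₀ (w.2 - u.2))) := by
    intro w
    rw [phaseShift, phaseChar_mk, gaussian_eq_mul]
    simp only [γ₀, map_mul, Complex.conj_ofReal, Prod.fst_sub, Prod.snd_sub]
    ring
  have hint : Integrable fun w : Phase d => (conj (chi η.1 w.1) * γ₀ (w.1 - u.1)) *
        (wigner h f w * (conj (chi η.2 w.2) * γ₀ (w.2 - u.2))) := by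
    have hg := ((hγi.comp_sub_right u.1).mul_prod (hγi.comp_sub_right u.2)).norm.const_mul
      (2 ^ d * (‖h‖ ^ 2 + ‖f‖ ^ 2))
    refine hg.mono' ?_ (ae_of_all _ fun w => ?_)
    · have c1 : Continuous fun w : Phase d => conj (chi η.1 w.1) * γ₀ (w.1 - u.1) :=
        (Complex.continuous_conj.comp ((continuous_chi_right _).comp continuous_fst)).mul
          (hγc.comp (by fun_prop))
      have c2 : Continuous fun w : Phase d => conj (chi η.2 w.2) * γ₀ (w.2 - u.2) :=
        (Complex.continuous_conj.comp ((continuous_chi_right _).comp continuous_snd)).mul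
          (hγc.comp (by fun_prop))
      exact c1.aestronglyMeasurable.mul
        ((stronglyMeasurable_wigner h f).aestronglyMeasurable.mul c2.aestronglyMeasurable)
    · simp only [norm_mul, RCLike.norm_conj, norm_chi, one_mul]
      have := norm_wigner_le h f w
      calc _ = ‖wigner h f w‖ * (‖γ₀ (w.1 - u.1)‖ * ‖γ₀ (w.2 - u.2)‖) := by ring
        _ ≤ _ := by gcongr
  rw [funSTFT]
  simp only [hF]
  rw [Measure.volume_eq_prod, integral_prod _ hint]
  -- For fixed x, the multiplication formula moves the Fourier transform from h(x + t/2) conj f(x -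
  -- t/2) to the shifted Gaussian. The rate π/2 becomes π²/(π/2) = 2π, which matches
  -- `integral_gamma_theta_theta`.
  have hinner : ∀ x : Eu d, ∫ y : Eu d, (conj (chi η.1 x) * γ₀ (x - u.1)) *
      (wigner h f (x, y) * (conj (chi η.2 y) * γ₀ (y - u.2))) =
      (gaussConst d (Real.pi / 2) * conj (chi η.2 u.2) * (gaussConst d (128 * Real.pi / 15))⁻¹) *
        ∫ t, Φ (wignerCoords d (x, t)) := by
    intro x
    have hc0 : (gaussConst d (128 * Real.pi / 15) : ℂ) ≠ 0 := by
      exact_mod_cast (gaussConst_pos (by positivity)).ne'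
    have hq : ∀ y : Eu d, conj (chi η.2 y) * γ₀ (y - u.2) = conj (chi η.2 u.2) *
        (Real.exp (-(Real.pi / 2) * ‖y - u.2‖ ^ 2) * chi (-η.2) (y - u.2)) := by
      intro y
      have : chi (-η.2) y = chi (-η.2) u.2 * chi (-η.2) (y - u.2) := by
        rw [← chi_add_right]; congr 1; abel
      rw [conj_chi, conj_chi, this]
      ring
    have hqi : Integrable fun y : Eu d => conj (chi η.2 y) * γ₀ (y - u.2) := by
      simp only [hq]
      exact (integrable_shifted_gaussian (by positivity) _ _).const_mul _
    rw [integral_const_mul]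
    have e1 : ∀ y, wigner h f (x, y) * (conj (chi η.2 y) * γ₀ (y - u.2)) =
        (∫ t : Eu d, h (x + (1 / 2 : ℝ) • t) * conj (f (x - (1 / 2 : ℝ) • t)) * conj (chi y t)) *
          (conj (chi η.2 y) * γ₀ (y - u.2)) := fun y => by rw [wigner_eq]
    simp only [e1]
    rw [integral_fourier_mul (integrable_wigner_integrand h f x).1 hqi, ← integral_const_mul,
      ← integral_const_mul]
    refine integral_congr_ae (ae_of_all _ fun t => ?_)
    have e2 : ∫ ξ : Eu d, conj (chi η.2 ξ) * γ₀ (ξ - u.2) * conj (chi ξ t) = conj (chi η.2 u.2) *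
        (gaussConst d (Real.pi / 2) * (conj (chi u.2 t) *
          Real.exp (-(2 * Real.pi) * ‖t + η.2‖ ^ 2))) := by
      simp only [hq, mul_assoc (conj (chi η.2 u.2))]
      rw [integral_const_mul, integral_shifted_gaussian_mul_chi (by positivity)]
      have n1 : ‖-η.2 - t‖ = ‖t + η.2‖ := by rw [← norm_neg]; congr 1; abel
      have n2 : Real.pi ^ 2 / (Real.pi / 2) = 2 * Real.pi := by field_simp
      rw [n1, n2]
    simp only
    rw [e2, hΦ, Complex.ofReal_inv]
    generalize (gaussConst d (128 * Real.pi / 15) : ℂ) = G at hc0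
    field_simp
  simp only [hinner]
  rw [integral_const_mul]
  congr 1
  have hΦw : Integrable fun p : Phase d => Φ (wignerCoords d p) :=
    ((measurePreserving_wignerCoords d).integrable_comp_emb
      (wignerCoords d).toHomeomorph.measurableEmbedding).2 hΦi
  calc _ = ∫ p : Phase d, Φ (wignerCoords d p) := (integral_prod _ hΦw).symm
    _ = _ := (measurePreserving_wignerCoords d).integral_comp
      (wignerCoords d).toHomeomorph.measurableEmbedding Φ

end WignerSTFT

end WeylGabor

end

noncomputable section

namespace WeylGabor

/-! ### Pointwise bounds for short-time Fourier transforms -/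

section STFTBounds

variable {d : ℕ}

/-- Take absolute values in `funSTFT_wigner` and integrate over u first: translation invariance
removes v, and the integral of γ goes into K. -/
theorem exists_lintegral_funSTFT_wigner_le (d : ℕ) : ∃ K : ℝ≥0, ∀ (h f : L2 d) (ζ : Phase d),
    ∫⁻ u : Phase d, ‖funSTFT (wigner h f) (u, rot ζ)‖ₑ ≤
      K * ∫⁻ z : Phase d, ‖stft (thetaLp d) h z‖ₑ * ‖stft (thetaLp d) f (z - ζ)‖ₑ := by
  set c : ℝ := gaussConst d (Real.pi / 2) * (gaussConst d (128 * Real.pi / 15))⁻¹ with hc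
  have hc0 : 0 ≤ c := mul_nonneg (gaussConst_pos (by positivity)).le
    (inv_nonneg.2 (gaussConst_pos (by positivity)).le)
  have hfin : ∫⁻ v : Eu d, ‖(gammaGauss v : ℂ)‖ₑ ≠ ⊤ :=
    ((integrable_gaussian (d := d) (β := 8 * Real.pi / 15) (by positivity)).ofReal (𝕜 := ℂ)).2.ne
  refine ⟨c.toNNReal * (∫⁻ v : Eu d, ‖(gammaGauss v : ℂ)‖ₑ).toNNReal, fun h f ζ => ?_⟩
  push_cast
  rw [ENNReal.coe_toNNReal hfin]
  let k : Phase d → ℝ≥0∞ := fun z => ‖stft (thetaLp d) h z‖ₑ * ‖stft (thetaLp d) f (z - ζ)‖ₑ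
  have hk : Measurable k := by
    have m1 : Measurable fun z => ‖stft (thetaLp d) h z‖ₑ :=
      (continuous_stft (thetaLp d) h).measurable.enorm
    have m2 : Measurable fun z => ‖stft (thetaLp d) f z‖ₑ :=
      (continuous_stft (thetaLp d) f).measurable.enorm
    exact m1.mul (m2.comp (measurable_sub_const ζ))
  -- At frequency j ζ the two transforms are evaluated at u + w(v) and u + w(v) - ζ. This is why j
  -- enters the symbol class.
  let w : Eu d → Phase d := fun v => ((1 / 2 : ℝ) • ζ.1 + v, (1 / 2 : ℝ) • ζ.2)
  have hw : Measurable w := by fun_prop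
  have hpt : ∀ u : Phase d, ‖funSTFT (wigner h f) (u, rot ζ)‖ₑ ≤
      c.toNNReal * ∫⁻ v, ‖(gammaGauss v : ℂ)‖ₑ * k (u + w v) := by
    intro u
    rw [funSTFT_wigner, enorm_mul]
    have h1 : ‖(gaussConst d (Real.pi / 2) : ℂ) * conj (chi (rot ζ).2 u.2) *
        ((gaussConst d (128 * Real.pi / 15) : ℝ)⁻¹ : ℝ)‖ₑ = c.toNNReal := by
      rw [← ofReal_norm, norm_mul, norm_mul, RCLike.norm_conj, norm_chi, mul_one,
        Complex.norm_real, Complex.norm_real, Real.norm_of_nonneg (gaussConst_pos (by positivity)).le,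
        Real.norm_of_nonneg (inv_nonneg.2 (gaussConst_pos (by positivity)).le)]
      rfl
    rw [h1]
    gcongr
    refine (enorm_integral_le_lintegral_enorm _).trans (le_of_eq ?_)
    refine lintegral_congr fun v => ?_
    have e1 : (u.1 - (1 / 2 : ℝ) • (rot ζ).2 + v, u.2 + (1 / 2 : ℝ) • (rot ζ).1) = u + w v := by
      refine Prod.ext ?_ ?_ <;> simp only [rot, w, Prod.fst_add, Prod.snd_add]; module
    have e2 : (u.1 + (1 / 2 : ℝ) • (rot ζ).2 + v, u.2 - (1 / 2 : ℝ) • (rot ζ).1) = u + w v - ζ := by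
      refine Prod.ext ?_ ?_ <;>
        simp only [rot, w, Prod.fst_add, Prod.snd_add, Prod.fst_sub, Prod.snd_sub] <;> module
    rw [e1, e2, enorm_mul, enorm_mul, RCLike.enorm_conj]
  calc _ ≤ ∫⁻ u : Phase d, c.toNNReal * ∫⁻ v, ‖(gammaGauss v : ℂ)‖ₑ * k (u + w v) :=
        lintegral_mono hpt
    _ = c.toNNReal * ∫⁻ u : Phase d, ∫⁻ v, ‖(gammaGauss v : ℂ)‖ₑ * k (u + w v) :=
        lintegral_const_mul' _ _ (by simp)
    _ = c.toNNReal * ∫⁻ v, ∫⁻ u : Phase d, ‖(gammaGauss v : ℂ)‖ₑ * k (u + w v) := by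
        rw [lintegral_lintegral_swap]
        have hg : Measurable fun v : Eu d => ‖(gammaGauss v : ℂ)‖ₑ := by
          unfold gammaGauss
          exact Continuous.measurable (by fun_prop)
        exact ((hg.comp measurable_snd).mul (hk.comp
          (measurable_fst.add (hw.comp measurable_snd)))).aemeasurable
    _ = c.toNNReal * ∫⁻ v : Eu d, ‖(gammaGauss v : ℂ)‖ₑ * ∫⁻ z, k z := by
        congr 1
        refine lintegral_congr fun v => ?_
        rw [lintegral_const_mul' _ _ (by simp), lintegral_add_right_eq_self k]
    _ = _ := by
        rw [lintegral_mul_const'']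
        · ring
        · unfold gammaGauss
          exact (Continuous.measurable (by fun_prop)).aemeasurable

/-- The Gaussian kernel of the change-of-window formula. -/
def windowKernel (z₀ z₁ z : Phase d) : ℂ :=
  (gaussConst d (Real.pi / 8) : ℂ)⁻¹ * (conj (chi z₀.2 z.1) *
    Real.exp (-(2 * Real.pi) * ‖z₁.1 - z.1 - z₀.1‖ ^ 2)) *
    (Real.exp (-(Real.pi / 8) * ‖z.2 - (z₁.2 - z₀.2)‖ ^ 2) *
      chi ((1 / 2 : ℝ) • (z.1 + z₀.1 + z₁.1)) (z.2 - (z₁.2 - z₀.2)))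

theorem norm_windowKernel (z₀ z₁ z : Phase d) : ‖windowKernel z₀ z₁ z‖ =
    (gaussConst d (Real.pi / 8))⁻¹ * (Real.exp (-(2 * Real.pi) * ‖z₁.1 - z.1 - z₀.1‖ ^ 2) *
      Real.exp (-(Real.pi / 8) * ‖z.2 - (z₁.2 - z₀.2)‖ ^ 2)) := by
  rw [windowKernel, norm_mul, norm_mul, norm_mul, norm_mul, RCLike.norm_conj, norm_chi, norm_chi,
    one_mul, mul_one, norm_inv, Complex.norm_real, Complex.norm_real, Complex.norm_real,
    Real.norm_of_nonneg (gaussConst_pos (by positivity)).le,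
    Real.norm_of_nonneg (Real.exp_pos _).le, Real.norm_of_nonneg (Real.exp_pos _).le]
  ring

theorem norm_windowKernel_le (z₀ z₁ z : Phase d) : ‖windowKernel z₀ z₁ z‖ ≤
    (gaussConst d (Real.pi / 8))⁻¹ * Real.exp (-(Real.pi / 8) * ‖z₁ - z - z₀‖ ^ 2) := by
  rw [norm_windowKernel, ← Real.exp_add]
  have hG : 0 < gaussConst d (Real.pi / 8) := gaussConst_pos (by positivity)
  gcongr
  have h1 : ‖z.2 - (z₁.2 - z₀.2)‖ = ‖z₁.2 - z.2 - z₀.2‖ := by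
    rw [← norm_neg]; congr 1; abel
  rw [h1, Prod.norm_def]
  simp only [Prod.fst_sub, Prod.snd_sub]
  have hp := Real.pi_pos
  have a1 := mul_nonneg hp.le (sq_nonneg ‖z₁.1 - z.1 - z₀.1‖)
  have a2 := mul_nonneg hp.le (sq_nonneg ‖z₁.2 - z.2 - z₀.2‖)
  rcases max_cases ‖z₁.1 - z.1 - z₀.1‖ ‖z₁.2 - z.2 - z₀.2‖ with ⟨h, _⟩ | ⟨h, _⟩ <;> rw [h] <;>
    linarith

theorem continuous_windowKernel (z₀ z₁ : Phase d) : Continuous (windowKernel z₀ z₁) := by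
  have c1 : Continuous fun z : Phase d => conj (chi z₀.2 z.1) :=
    Complex.continuous_conj.comp ((continuous_chi_right _).comp continuous_fst)
  have c2 : Continuous fun z : Phase d =>
      chi ((1 / 2 : ℝ) • (z.1 + z₀.1 + z₁.1)) (z.2 - (z₁.2 - z₀.2)) :=
    continuous_chi.comp (f := fun z : Phase d =>
      ((1 / 2 : ℝ) • (z.1 + z₀.1 + z₁.1), z.2 - (z₁.2 - z₀.2))) (by fun_prop)
  unfold windowKernel
  fun_prop

theorem integrable_windowKernel (z₀ z₁ : Phase d) : Integrable (windowKernel z₀ z₁) := by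
  have h1 := (((integrable_gaussian (d := d) (β := 2 * Real.pi) (by positivity)).comp_sub_left
    (z₁.1 - z₀.1)).mul_prod ((integrable_gaussian (d := d) (β := Real.pi / 8)
      (by positivity)).comp_sub_right (z₁.2 - z₀.2))).const_mul (gaussConst d (Real.pi / 8))⁻¹
  refine h1.mono' (continuous_windowKernel z₀ z₁).aestronglyMeasurable (ae_of_all _ fun z => ?_)
  rw [norm_windowKernel]
  refine le_of_eq ?_
  rw [show z₁.1 - z.1 - z₀.1 = z₁.1 - z₀.1 - z.1 by abel]

theorem integrable_stftIntegrand (h : L2 d) (x ξ : Eu d) : Integrable (stftIntegrand h x ξ) :=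
  integrable_mul_chi_theta h ξ x

theorem integrable_mul_conj_translate (g : L2 d) (x : Eu d) :
    Integrable fun t => g t * conj (g (t - x)) := by
  have hm : AEStronglyMeasurable (fun t => g t * conj (g (t - x))) :=
    ((measurable_L2 g).mul (Complex.continuous_conj.measurable.comp
      ((measurable_L2 g).comp (measurable_sub_const x)))).aestronglyMeasurable
  refine ((integrable_sq_L2 g).add ((integrable_sq_L2 g).comp_sub_right x)).mono' hm
    (ae_of_all _ fun t => ?_)
  rw [norm_mul, RCLike.norm_conj, Pi.add_apply]
  nlinarith [sq_nonneg (‖g t‖ - ‖g (t - x)‖), sq_nonneg ‖g t‖, sq_nonneg ‖g (t - x)‖]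

/-- The change of the window. -/
theorem stft_change_window (g : L2 d) (z₀ z₁ : Phase d) :
    ∫ z, stft g g z * windowKernel z₀ z₁ z =
      stft (thetaLp d) g z₁ * conj (stft (thetaLp d) g z₀) := by
  set G : ℝ := gaussConst d (Real.pi / 8) with hG
  have hG0 : (G : ℂ) ≠ 0 := by exact_mod_cast (gaussConst_pos (by positivity)).ne'
  have hint : Integrable fun z => stft g g z * windowKernel z₀ z₁ z := by
    refine ((integrable_windowKernel z₀ z₁).norm.const_mul (‖g‖ * ‖g‖)).mono'
      ((continuous_stft g g).mul (continuous_windowKernel z₀ z₁)).aestronglyMeasurable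
      (ae_of_all _ fun z => ?_)
    rw [norm_mul]
    exact mul_le_mul_of_nonneg_right (norm_stft_le g g z) (norm_nonneg _)
  rw [Measure.volume_eq_prod, integral_prod _ hint]
  have hinner : ∀ x : Eu d, ∫ ξ : Eu d, stft g g (x, ξ) * windowKernel z₀ z₁ (x, ξ) =
      ∫ t, stftIntegrand g z₁.1 z₁.2 t * conj (stftIntegrand g z₀.1 z₀.2 (t - x)) := by
    intro x
    set c := z₁.2 - z₀.2 with hc
    set m := (1 / 2 : ℝ) • (x + z₀.1 + z₁.1) with hm
    set E : ℂ := (G : ℂ)⁻¹ * (conj (chi z₀.2 x) *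
      Real.exp (-(2 * Real.pi) * ‖z₁.1 - x - z₀.1‖ ^ 2)) with hE
    have e1 : ∀ ξ : Eu d, stft g g (x, ξ) * windowKernel z₀ z₁ (x, ξ) =
        E * ((∫ t, (g t * conj (g (t - x))) * conj (chi ξ t)) *
          (Real.exp (-(Real.pi / 8) * ‖ξ - c‖ ^ 2) * chi m (ξ - c))) := by
      intro ξ
      rw [stft_eq_integral, windowKernel]
      have : ∫ t, g t * (conj (chi ξ t) * conj (g (t - x))) =
          ∫ t, (g t * conj (g (t - x))) * conj (chi ξ t) :=
        integral_congr_ae (ae_of_all _ fun t => by ring)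
      simp only [this]
      ring
    simp only [e1]
    rw [integral_const_mul, integral_fourier_mul (integrable_mul_conj_translate g x)
      (integrable_shifted_gaussian (by positivity) c m), ← integral_const_mul]
    refine integral_congr_ae (ae_of_all _ fun t => ?_)
    simp only
    rw [integral_shifted_gaussian_mul_chi (by positivity), ← hG]
    have h8 : Real.pi ^ 2 / (Real.pi / 8) = 8 * Real.pi := by field_simp
    -- Parallelogram law: with m the midpoint of z₁.1 and x + z₀.1, the product of the two shifted
    -- windows is a Gaussian in m - t times one in z₁.1 - x - z₀.1. The kernel contains the second
    -- factor, and its frequency Gaussian of rate π/8 has the first one, of rate 8π, as Fourier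
    -- transform.
    have hθ : ((Real.exp (-(2 * Real.pi) * ‖z₁.1 - x - z₀.1‖ ^ 2) : ℝ) : ℂ) *
        (Real.exp (-(8 * Real.pi) * ‖m - t‖ ^ 2) : ℝ) =
        theta (t - z₁.1) * theta (t - x - z₀.1) := by
      simp only [theta, ← Complex.ofReal_mul, ← Real.exp_add]
      congr 2
      simp only [hm, ← real_inner_self_eq_norm_sq, inner_add_left, inner_add_right, inner_sub_left,
        inner_sub_right, real_inner_smul_left, real_inner_smul_right]
      rw [real_inner_comm x t, real_inner_comm z₀.1 t, real_inner_comm z₁.1 t,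
        real_inner_comm z₀.1 x, real_inner_comm z₁.1 x, real_inner_comm z₁.1 z₀.1]
      ring
    have hχ : conj (chi z₀.2 x) * conj (chi c t) = conj (chi z₁.2 t) * chi z₀.2 (t - x) := by
      rw [hc, sub_eq_add_neg t x, chi_add_right, chi_neg_right, sub_eq_add_neg, chi_add_left,
        map_mul, conj_chi (-z₀.2), neg_neg, conj_chi z₀.2 x]
      ring
    rw [h8, hE, stftIntegrand, stftIntegrand]
    simp only [map_mul, Complex.conj_conj, Complex.conj_ofReal]
    calc _ = (G : ℂ)⁻¹ * G * (g t * conj (g (t - x))) * (conj (chi z₀.2 x) * conj (chi c t)) *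
          (((Real.exp (-(2 * Real.pi) * ‖z₁.1 - x - z₀.1‖ ^ 2) : ℝ) : ℂ) *
            (Real.exp (-(8 * Real.pi) * ‖m - t‖ ^ 2) : ℝ)) := by ring
      _ = _ := by rw [hθ, hχ, inv_mul_cancel₀ hG0]; ring
  simp only [hinner]
  set P := stftIntegrand g z₁.1 z₁.2 with hP
  set R := stftIntegrand g z₀.1 z₀.2 with hR
  have hPi : Integrable P := integrable_stftIntegrand _ _ _
  have hRi : Integrable R := integrable_stftIntegrand _ _ _
  have hR' : Integrable fun y => conj (R (-y)) := by
    have := (Complex.conjCLE : ℂ →L[ℝ] ℂ).integrable_comp hRi.comp_neg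
    exact this
  have hconv := hPi.convolution_integrand (ContinuousLinearMap.mul ℝ ℂ) hR'
  simp only [ContinuousLinearMap.mul_apply', neg_sub] at hconv
  -- What remains is a convolution integral; integrating over x first separates it into a product.
  rw [integral_integral_swap (f := fun x t => P t * conj (R (t - x))) hconv]
  have e3 : ∀ t, ∫ x, P t * conj (R (t - x)) = P t * conj (∫ x, R x) := by
    intro t
    rw [integral_const_mul, integral_conj, integral_sub_left_eq_self R volume t]
  simp only [e3]
  rw [integral_mul_const, stft_thetaLp, stft_thetaLp]
  rfl

theorem enorm_stft_mul_le (g : L2 d) (z₀ z₁ : Phase d) :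
    ‖stft (thetaLp d) g z₁‖ₑ * ‖stft (thetaLp d) g z₀‖ₑ ≤
      ENNReal.ofReal (gaussConst d (Real.pi / 8))⁻¹ * lconv (fun z => ‖stft g g z‖ₑ)
        (fun z => ENNReal.ofReal (Real.exp (-(Real.pi / 8) * ‖z - z₀‖ ^ 2))) z₁ := by
  have hG : 0 < gaussConst d (Real.pi / 8) := gaussConst_pos (by positivity)
  rw [← RCLike.enorm_conj (stft (thetaLp d) g z₀), ← enorm_mul, ← stft_change_window, lconv,
    ← lintegral_const_mul' _ _ ENNReal.ofReal_ne_top]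
  refine (enorm_integral_le_lintegral_enorm _).trans (lintegral_mono fun z => ?_)
  rw [enorm_mul, mul_left_comm]
  gcongr
  rw [← ENNReal.ofReal_mul (inv_nonneg.2 hG.le), ← ofReal_norm]
  exact ENNReal.ofReal_le_ofReal (norm_windowKernel_le z₀ z₁ z)

variable {Λ : Submodule ℤ (Phase d)} {C : Set (Phase d)}

/-- Fix z₀ with V_θ g(z₀) ≠ 0 and divide by that value: V_θ g is then dominated by a multiple of
|V_g g| convolved with a Gaussian, both in W(𝒜). If there is no such z₀ nothing is to be shown. -/
theorem amalgamNorm_stft_thetaLp_lt_top [DiscreteTopology Λ] [IsZLattice ℝ Λ] [Countable Λ]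
    (hC : IsFundamentalCell Λ C) {𝒜 : SolidBanachSpace Λ} (h𝒜 : 𝒜.IsInvolutiveConvAlgebra)
    (g : L2 d) (hg : amalgamNorm 𝒜 C (fun z => ‖stft g g z‖ₑ) < ⊤) :
    amalgamNorm 𝒜 C (fun z => ‖stft (thetaLp d) g z‖ₑ) < ⊤ := by
  by_cases h0 : ∀ z, stft (thetaLp d) g z = 0
  · exact (amalgamNorm_mono fun z => by simp [h0 z]).trans_lt hg
  · push Not at h0
    obtain ⟨z₀, hz₀⟩ := h0
    have hk0 : ‖stft (thetaLp d) g z₀‖ₑ ≠ 0 := enorm_ne_zero.2 hz₀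
    obtain ⟨K, hK⟩ := exists_amalgamNorm_lconv_le hC h𝒜
    have hga := amalgamNorm_gaussian_lt_top hC h𝒜 (Real.pi / 8) (by positivity) z₀
    set Γ : Phase d → ℝ≥0∞ := fun z =>
      ENNReal.ofReal (Real.exp (-(Real.pi / 8) * ‖z - z₀‖ ^ 2)) with hΓ
    set D : ℝ≥0∞ := ENNReal.ofReal (gaussConst d (Real.pi / 8))⁻¹ / ‖stft (thetaLp d) g z₀‖ₑ
      with hD
    have hDt : D ≠ ⊤ := ENNReal.div_ne_top ENNReal.ofReal_ne_top hk0
    have hle : ∀ z, ‖stft (thetaLp d) g z‖ₑ ≤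
        (D.toNNReal : ℝ≥0∞) * lconv (fun z => ‖stft g g z‖ₑ) Γ z := by
      intro z
      rw [ENNReal.coe_toNNReal hDt, hD, ← ENNReal.mul_div_right_comm,
        ENNReal.le_div_iff_mul_le (Or.inl hk0) (Or.inl enorm_ne_top)]
      exact enorm_stft_mul_le g z₀ z
    refine (amalgamNorm_mono hle).trans_lt ((amalgamNorm_const_mul_le _ _).trans_lt ?_)
    exact ENNReal.mul_lt_top ENNReal.coe_lt_top ((hK _ _ hg hga).trans_lt
      (ENNReal.mul_lt_top (ENNReal.mul_lt_top ENNReal.coe_lt_top hg) hga))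

end STFTBounds

end WeylGabor

end

noncomputable section

namespace WeylGabor

/-! ### Tight frames and `L²` estimates -/

section Frame

theorem enorm_le_tsum_enorm {ι : Type*} {f : ι → ℂ} {a : ℂ} (h : HasSum f a) :
    ‖a‖ₑ ≤ ∑' i, ‖f i‖ₑ := by
  rw [← h.tsum_eq]; exact enorm_tsum_le_tsum_enorm

theorem ennreal_two_mul_le_add_sq (a b : ℝ≥0∞) : 2 * (a * b) ≤ a ^ 2 + b ^ 2 := by
  induction a with
  | top => simp
  | coe a =>
    induction b with
    | top => simp
    | coe b =>
      rw [← mul_assoc]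
      exact_mod_cast two_mul_le_add_sq a b

/-- The Cauchy–Schwarz inequality with weights. -/
theorem sq_tsum_mul_le {ι : Type*} (c k : ι → ℝ≥0∞) :
    (∑' i, c i * k i) ^ 2 ≤ (∑' i, c i ^ 2 * k i) * ∑' i, k i := by
  have h2 : (2 : ℝ≥0∞) ≠ 0 := two_ne_zero
  have h2' : (2 : ℝ≥0∞) ≠ ⊤ := ENNReal.ofNat_ne_top
  rw [← ENNReal.mul_le_mul_iff_right h2 h2']
  have e1 : (∑' i, c i ^ 2 * k i) * ∑' i, k i = ∑' i, ∑' j, c i ^ 2 * (k i * k j) := by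
    rw [← ENNReal.tsum_mul_right]
    refine tsum_congr fun i => ?_
    rw [← ENNReal.tsum_mul_left]
    exact tsum_congr fun j => by ring
  -- The same double sum with i and j exchanged; averaged with `e1` it matches 2 c_i c_j ≤ c_i² +
  -- c_j².
  have e2 : (∑' i, c i ^ 2 * k i) * ∑' i, k i = ∑' i, ∑' j, c j ^ 2 * (k i * k j) := by
    rw [e1, ENNReal.tsum_comm]
    exact tsum_congr fun i => tsum_congr fun j => by ring
  calc 2 * (∑' i, c i * k i) ^ 2 = ∑' i, ∑' j, 2 * (c i * c j) * (k i * k j) := by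
        rw [sq, ← ENNReal.tsum_mul_right, ← ENNReal.tsum_mul_left]
        refine tsum_congr fun i => ?_
        rw [← ENNReal.tsum_mul_left, ← ENNReal.tsum_mul_left]
        exact tsum_congr fun j => by ring
    _ ≤ ∑' i, ∑' j, (c i ^ 2 + c j ^ 2) * (k i * k j) :=
        ENNReal.tsum_le_tsum fun i => ENNReal.tsum_le_tsum fun j => by
          gcongr; exact ennreal_two_mul_le_add_sq _ _
    _ = 2 * ((∑' i, c i ^ 2 * k i) * ∑' i, k i) := by
        simp only [add_mul, ENNReal.tsum_add]
        rw [← e1, ← e2, two_mul]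

theorem lintegral_mul_le_of_sq {α : Type*} [MeasurableSpace α] {μ : Measure α} {f g : α → ℝ≥0∞}
    (hf : AEMeasurable f μ) (hg : AEMeasurable g μ) {K a b : ℝ≥0∞}
    (h1 : ∫⁻ x, f x ^ 2 ∂μ ≤ K * a ^ 2) (h2 : ∫⁻ x, g x ^ 2 ∂μ ≤ K * b ^ 2) :
    ∫⁻ x, f x * g x ∂μ ≤ K * a * b := by
  have h := ENNReal.lintegral_mul_le_Lp_mul_Lq μ Real.HolderConjugate.two_two hf hg
  simp only [Pi.mul_apply, ENNReal.rpow_two] at h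
  refine h.trans ?_
  calc _ ≤ (K * a ^ 2) ^ (1 / 2 : ℝ) * (K * b ^ 2) ^ (1 / 2 : ℝ) := by gcongr
    _ = ((K * a * b) ^ (2 : ℝ)) ^ (1 / 2 : ℝ) := by
        rw [← ENNReal.mul_rpow_of_nonneg _ _ (by norm_num), ENNReal.rpow_two]
        congr 1; ring
    _ = K * a * b := by rw [← ENNReal.rpow_mul]; norm_num

variable {d : ℕ} {Λ : Submodule ℤ (Phase d)} {C : Set (Phase d)} {g : L2 d}

/-- The coefficient map into ℓ² preserves norms, hence inner products. This is the weak form of the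
expansion h = ∑ ⟨h, π(λ)g⟩ π(λ)g. -/
theorem IsTightGaborFrame.hasSum_inner (hframe : IsTightGaborFrame Λ g) (u h : L2 d) :
    HasSum (fun l : Λ => inner ℂ u (atom g l) * stft g h l) (inner ℂ u h) := by
  have hmem : ∀ f : L2 d, Memℓp (fun l : Λ => stft g f l) 2 := fun f =>
    memℓp_gen (by simpa using (hframe f).summable)
  let U : L2 d →ₗ[ℂ] lp (fun _ : Λ => ℂ) 2 :=
    { toFun := fun f => ⟨fun l => stft g f l, hmem f⟩
      map_add' := fun f f' => by
        ext l; exact inner_add_right _ _ _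
      map_smul' := fun c f => by
        ext l; exact inner_smul_right _ _ _ }
  have hU : ∀ f, ‖U f‖ = ‖f‖ := by
    intro f
    have h1 := lp.norm_rpow_eq_tsum (p := 2) (by norm_num) (U f)
    simp only [ENNReal.toReal_ofNat, Real.rpow_two] at h1
    have h2 : ‖U f‖ ^ 2 = ‖f‖ ^ 2 := by rw [h1]; exact (hframe f).tsum_eq
    exact (sq_eq_sq₀ (norm_nonneg _) (norm_nonneg _)).1 h2
  let V : L2 d →ₗᵢ[ℂ] lp (fun _ : Λ => ℂ) 2 := ⟨U, hU⟩
  have h3 := lp.hasSum_inner (𝕜 := ℂ) (V u) (V h)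
  rw [V.inner_map_map] at h3
  have h4 : (fun l : Λ => inner ℂ u (atom g l) * stft g h l) =
      fun l => inner ℂ (V u l) (V h l) := by
    funext l
    change _ = inner ℂ (stft g u l) (stft g h l)
    rw [RCLike.inner_apply, mul_comm, stft, stft, inner_conj_symm]
  rw [h4]
  exact h3

theorem IsTightGaborFrame.tsum_enorm_sq (hframe : IsTightGaborFrame Λ g) (f : L2 d) :
    ∑' l : Λ, ‖stft g f l‖ₑ ^ 2 = ‖f‖ₑ ^ 2 := by
  have h := hframe f
  have e : ∀ x : ℂ, ‖x‖ₑ ^ 2 = ENNReal.ofReal (‖x‖ ^ 2) := fun x => by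
    rw [← ofReal_norm, ENNReal.ofReal_pow (norm_nonneg _)]
  simp only [e]
  rw [← ENNReal.ofReal_tsum_of_nonneg (fun _ => sq_nonneg _) h.summable, h.tsum_eq,
    ← ofReal_norm, ENNReal.ofReal_pow (norm_nonneg _)]

theorem IsTightGaborFrame.enorm_stft_le (hframe : IsTightGaborFrame Λ g) (γ h : L2 d)
    (z : Phase d) :
    ‖stft γ h z‖ₑ ≤ ∑' l : Λ, ‖stft g h l‖ₑ * ‖stft γ g (z - l)‖ₑ := by
  refine (enorm_le_tsum_enorm (hframe.hasSum_inner (atom γ z) h)).trans (le_of_eq ?_)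
  refine tsum_congr fun l => ?_
  rw [enorm_mul, mul_comm, ← ofReal_norm (inner ℂ (atom γ z) (atom g l)), norm_inner_atom_atom,
    ofReal_norm]

/-- If z lies in m + C, then z - l lies in m - l + C, so the sum is at most the ℓ¹-norm of the cell
suprema. -/
theorem ae_tsum_translate_le [Countable Λ] (hC : IsFundamentalCell Λ C) {𝒜 : SolidBanachSpace Λ}
    (h𝒜 : 𝒜.IsInvolutiveConvAlgebra) (k : Phase d → ℝ≥0∞) :
    ∀ᵐ z : Phase d, ∑' l : Λ, k (z - l) ≤ amalgamNorm 𝒜 C k := by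
  have h1 : ∀ᵐ z : Phase d, ∀ l m : Λ, z - l ∈ cell C m → k (z - l) ≤ cellSup C k m :=
    ae_all_iff.2 fun l => (measurePreserving_sub_right volume (l : Phase d)).quasiMeasurePreserving.ae
      (ae_le_cellSup hC k)
  filter_upwards [h1, ae_exists_cell hC] with z hz ⟨m, hm⟩
  have h2 : ∀ l : Λ, k (z - l) ≤ cellSup C k (m - l) := fun l => hz l (m - l) (by
    change z - l - ((m - l : Λ) : Phase d) ∈ C
    rw [AddSubgroupClass.coe_sub, sub_sub_sub_cancel_right]
    exact hm)
  calc _ ≤ ∑' l : Λ, cellSup C k (m - l) := ENNReal.tsum_le_tsum h2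
    _ = ∑' l : Λ, cellSup C k l := (Equiv.subLeft m).tsum_eq (cellSup C k)
    _ ≤ _ := SolidBanachSpace.tsum_le_extNorm h𝒜 _

/-- Schur's test for the kernel k(z - l), k = |V_θ g|, acting on the frame coefficients: its sums
over l are bounded by ‖k‖_{W(𝒜)} and its integrals over z equal ‖k‖₁. Tightness turns the ℓ² norm of
the coefficients into ‖h‖. -/
theorem exists_lintegral_sq_stft_le [DiscreteTopology Λ] [IsZLattice ℝ Λ] [Countable Λ]
    (hC : IsFundamentalCell Λ C) {𝒜 : SolidBanachSpace Λ} (h𝒜 : 𝒜.IsInvolutiveConvAlgebra)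
    (hframe : IsTightGaborFrame Λ g) (hg : amalgamNorm 𝒜 C (fun z => ‖stft g g z‖ₑ) < ⊤) :
    ∃ K : ℝ≥0, ∀ h : L2 d, ∫⁻ z, ‖stft (thetaLp d) h z‖ₑ ^ 2 ≤ K * ‖h‖ₑ ^ 2 := by
  have hN := amalgamNorm_stft_thetaLp_lt_top hC h𝒜 g hg
  let k : Phase d → ℝ≥0∞ := fun z => ‖stft (thetaLp d) g z‖ₑ
  change amalgamNorm 𝒜 C k < ⊤ at hN
  have hkm : Measurable k := (continuous_stft _ _).measurable.enorm
  have hki : ∫⁻ z, k z < ⊤ := (lintegral_le_amalgamNorm hC h𝒜 k).trans_lt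
    (ENNReal.mul_lt_top (volume_C_lt_top hC) hN)
  refine ⟨(amalgamNorm 𝒜 C k).toNNReal * (∫⁻ z, k z).toNNReal, fun h => ?_⟩
  rw [ENNReal.coe_mul, ENNReal.coe_toNNReal hN.ne, ENNReal.coe_toNNReal hki.ne,
    ← hframe.tsum_enorm_sq h]
  calc ∫⁻ z, ‖stft (thetaLp d) h z‖ₑ ^ 2
      ≤ ∫⁻ z, amalgamNorm 𝒜 C k * ∑' l : Λ, ‖stft g h l‖ₑ ^ 2 * k (z - l) := by
        refine lintegral_mono_ae ?_
        filter_upwards [ae_tsum_translate_le hC h𝒜 k] with z hz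
        calc _ ≤ (∑' l : Λ, ‖stft g h l‖ₑ * k (z - l)) ^ 2 := by
              gcongr; exact hframe.enorm_stft_le _ _ _
          _ ≤ (∑' l : Λ, ‖stft g h l‖ₑ ^ 2 * k (z - l)) * ∑' l : Λ, k (z - l) :=
              sq_tsum_mul_le _ _
          _ ≤ _ := by rw [mul_comm]; gcongr
    _ = amalgamNorm 𝒜 C k * ∑' l : Λ, ‖stft g h l‖ₑ ^ 2 * ∫⁻ z, k z := by
        rw [lintegral_const_mul' _ _ hN.ne, lintegral_tsum
          (f := fun (l : Λ) z => ‖stft g h l‖ₑ ^ 2 * k (z - l)) fun l =>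
          ((hkm.comp (measurable_sub_const _)).const_mul _).aemeasurable]
        congr 1
        refine tsum_congr fun l => ?_
        rw [lintegral_const_mul' _ _ (by simp), lintegral_sub_right_eq_self k]
    _ = _ := by rw [ENNReal.tsum_mul_right]; ring

theorem lintegral_stft_mul_stft_le {K : ℝ≥0}
    (hK : ∀ h : L2 d, ∫⁻ z, ‖stft (thetaLp d) h z‖ₑ ^ 2 ≤ K * ‖h‖ₑ ^ 2) (h f : L2 d)
    (ζ : Phase d) :
    ∫⁻ z : Phase d, ‖stft (thetaLp d) h z‖ₑ * ‖stft (thetaLp d) f (z - ζ)‖ₑ ≤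
      K * ‖h‖ₑ * ‖f‖ₑ := by
  have m : ∀ f : L2 d, Measurable fun z => ‖stft (thetaLp d) f z‖ₑ := fun f =>
    (continuous_stft _ _).measurable.enorm
  refine lintegral_mul_le_of_sq (m h).aemeasurable
    ((m f).comp (measurable_sub_const ζ)).aemeasurable (hK h) ?_
  exact (lintegral_sub_right_eq_self (fun z => ‖stft (thetaLp d) f z‖ₑ ^ 2) ζ).trans_le (hK f)

end Frame

/-! ### The duality bracket of a symbol and a Wigner distribution -/

section DualBound

variable {d : ℕ}

theorem le_essSup_of_lowerSemicontinuous {F : Phase d → ℝ≥0∞} (hF : LowerSemicontinuous F)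
    (z : Phase d) : F z ≤ essSup F volume := by
  by_contra! hlt
  have hopen : IsOpen {ξ | essSup F volume < F ξ} := hF.isOpen_preimage _
  refine (hopen.measure_pos volume ⟨z, hlt⟩).ne' ?_
  have := ENNReal.ae_le_essSup (μ := volume) F
  rw [ae_iff] at this
  simpa using this

theorem essSup_eq_iSup_of_lowerSemicontinuous {F : Phase d → ℝ≥0∞} (hF : LowerSemicontinuous F) :
    essSup F volume = ⨆ z, F z :=
  le_antisymm (essSup_le_of_ae_le _ (ae_of_all _ fun z => le_iSup F z))
    (iSup_le fun z => le_essSup_of_lowerSemicontinuous hF z)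

/-- The grand symbol `ζ ↦ ess sup_z |V(z, j ζ)|` for the Gaussian window. -/
def grandSymbol (σ : 𝓢'(Phase d, ℂ)) (ζ : Phase d) : ℝ≥0∞ :=
  essSup (fun z => ‖gaussSTFT σ z (rot ζ)‖ₑ) volume

theorem continuous_rot : Continuous (rot (d := d)) := by unfold rot; fun_prop

theorem measurePreserving_rot : MeasurePreserving (rot (d := d)) := by
  have h1 : MeasurePreserving (fun z : Eu d × Eu d => (z.1, -z.2)) :=
    (MeasurePreserving.id _).prod (Measure.measurePreserving_neg volume)
  exact h1.comp Measure.measurePreserving_swap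

theorem continuous_enorm_gaussSTFT_rot (σ : 𝓢'(Phase d, ℂ)) :
    Continuous fun p : Phase d × Phase d => ‖gaussSTFT σ p.1 (rot p.2)‖ₑ :=
  ((continuous_gaussSTFT σ).comp
    (continuous_fst.prodMk (continuous_rot.comp continuous_snd))).enorm

theorem enorm_gaussSTFT_le_grandSymbol (σ : 𝓢'(Phase d, ℂ)) (z ζ : Phase d) :
    ‖gaussSTFT σ z (rot ζ)‖ₑ ≤ grandSymbol σ ζ :=
  le_essSup_of_lowerSemicontinuous (F := fun z => ‖gaussSTFT σ z (rot ζ)‖ₑ)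
    ((continuous_enorm_gaussSTFT_rot σ).comp
      (continuous_id.prodMk continuous_const)).lowerSemicontinuous z

theorem measurable_funSTFT {F : Phase d → ℂ} (hF : StronglyMeasurable F) :
    Measurable (funSTFT F) := by
  have hc : Continuous fun p : (Phase d × Phase d) × Phase d =>
      conj (phaseShift p.1.1 p.1.2 (gaussian d) p.2) := by
    have h1 : Continuous fun p : (Phase d × Phase d) × Phase d => phaseChar p.1.2 p.2 := by
      unfold phaseChar phaseDot; fun_prop
    exact Complex.continuous_conj.comp (h1.mul ((gaussian d).continuous.comp (by fun_prop)))
  have h : StronglyMeasurable fun p : (Phase d × Phase d) × Phase d =>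
      F p.2 * conj (phaseShift p.1.1 p.1.2 (gaussian d) p.2) :=
    ((hF.measurable.comp measurable_snd).mul hc.measurable).stronglyMeasurable
  exact h.integral_prod_right'.measurable

/-- Substitute η = j ζ, which preserves volume, bound the transform of σ by its supremum over
positions, and integrate that of W(h, f) over positions. This is the basic estimate behind all
bounds for σ. -/
theorem exists_lintegral_gaussSTFT_mul_funSTFT_le (d : ℕ) : ∃ K : ℝ≥0,
    ∀ (σ : 𝓢'(Phase d, ℂ)) (h f : L2 d),
      ∫⁻ p : Phase d × Phase d, ‖gaussSTFT σ p.1 p.2 * conj (funSTFT (wigner h f) p)‖ₑ ≤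
        K * ∫⁻ ζ : Phase d, grandSymbol σ ζ *
          ∫⁻ z : Phase d, ‖stft (thetaLp d) h z‖ₑ * ‖stft (thetaLp d) f (z - ζ)‖ₑ := by
  obtain ⟨K, hK⟩ := exists_lintegral_funSTFT_wigner_le d
  refine ⟨K, fun σ h f => ?_⟩
  have hA := measurable_funSTFT (stronglyMeasurable_wigner h f)
  have hm : Measurable fun p : Phase d × Phase d =>
      ‖gaussSTFT σ p.1 p.2 * conj (funSTFT (wigner h f) p)‖ₑ :=
    ((continuous_gaussSTFT σ).measurable.mul
      (Complex.continuous_conj.measurable.comp hA)).enorm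
  calc _ = ∫⁻ η : Phase d, ∫⁻ u : Phase d,
        ‖gaussSTFT σ u η * conj (funSTFT (wigner h f) (u, η))‖ₑ := by
        rw [Measure.volume_eq_prod, lintegral_prod_symm _ hm.aemeasurable]
    _ = ∫⁻ ζ : Phase d, ∫⁻ u : Phase d,
        ‖gaussSTFT σ u (rot ζ) * conj (funSTFT (wigner h f) (u, rot ζ))‖ₑ :=
        (measurePreserving_rot.lintegral_comp hm.lintegral_prod_left').symm
    _ ≤ ∫⁻ ζ : Phase d, K * (grandSymbol σ ζ *
          ∫⁻ z : Phase d, ‖stft (thetaLp d) h z‖ₑ * ‖stft (thetaLp d) f (z - ζ)‖ₑ) := by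
        refine lintegral_mono fun ζ => ?_
        calc _ ≤ ∫⁻ u : Phase d, grandSymbol σ ζ * ‖funSTFT (wigner h f) (u, rot ζ)‖ₑ :=
              lintegral_mono fun u => by
                rw [enorm_mul, RCLike.enorm_conj]
                gcongr
                exact enorm_gaussSTFT_le_grandSymbol σ u ζ
          _ = grandSymbol σ ζ * ∫⁻ u : Phase d, ‖funSTFT (wigner h f) (u, rot ζ)‖ₑ :=
              lintegral_const_mul _ (hA.comp (by fun_prop)).enorm
          _ ≤ grandSymbol σ ζ * (K * _) := by gcongr; exact hK h f ζ
          _ = _ := by ring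
    _ = _ := lintegral_const_mul' _ _ ENNReal.coe_ne_top

end DualBound

end WeylGabor

end

noncomputable section

namespace WeylGabor

/-! ### The Weyl transform as a bounded operator -/

section WeylOperator

variable {d : ℕ}

theorem dualBracket_eq (σ : 𝓢'(Phase d, ℂ)) (F : Phase d → ℂ) : dualBracket σ F =
    ∫ p : Phase d × Phase d, gaussSTFT σ p.1 p.2 * conj (funSTFT F p) := rfl

theorem funSTFT_const_mul (c : ℂ) (F : Phase d → ℂ) (p : Phase d × Phase d) :
    funSTFT (fun w => c * F w) p = c * funSTFT F p := by
  rw [funSTFT, funSTFT, ← integral_const_mul]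
  exact integral_congr_ae (ae_of_all _ fun w => mul_assoc _ _ _)

theorem dualBracket_const_mul (σ : 𝓢'(Phase d, ℂ)) (c : ℂ) (F : Phase d → ℂ) :
    dualBracket σ (fun w => c * F w) = conj c * dualBracket σ F := by
  rw [dualBracket_eq, dualBracket_eq, ← integral_const_mul]
  refine integral_congr_ae (ae_of_all _ fun p => ?_)
  simp only [funSTFT_const_mul, map_mul]; ring

theorem integrable_wigner_mul_gaussian (h f : L2 d) (p : Phase d × Phase d) :
    Integrable fun w => wigner h f w * conj (phaseShift p.1 p.2 (gaussian d) w) := by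
  have h1 : Integrable fun w => phaseShift p.1 p.2 (gaussian d) w := by
    have := (schwartzPhaseShift p.1 p.2 (gaussian d)).integrable (μ := volume)
    refine this.congr (ae_of_all _ fun w => ?_)
    exact schwartzPhaseShift_apply _ _ _ _
  have h2 : Integrable fun w => conj (phaseShift p.1 p.2 (gaussian d) w) :=
    (Complex.conjCLE : ℂ →L[ℝ] ℂ).integrable_comp h1
  exact h2.bdd_mul (stronglyMeasurable_wigner h f).aestronglyMeasurable
    (ae_of_all _ fun w => norm_wigner_le h f w)

theorem funSTFT_wigner_add_left (h h' f : L2 d) (p : Phase d × Phase d) :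
    funSTFT (wigner (h + h' : L2 d) f) p = funSTFT (wigner h f) p + funSTFT (wigner h' f) p := by
  rw [funSTFT, funSTFT, funSTFT, ← integral_add (integrable_wigner_mul_gaussian h f p)
    (integrable_wigner_mul_gaussian h' f p)]
  exact integral_congr_ae (ae_of_all _ fun w => by simp only [wigner_add_left]; ring)

theorem funSTFT_wigner_add_right (h f f' : L2 d) (p : Phase d × Phase d) :
    funSTFT (wigner h (f + f' : L2 d)) p = funSTFT (wigner h f) p + funSTFT (wigner h f') p := by
  rw [funSTFT, funSTFT, funSTFT, ← integral_add (integrable_wigner_mul_gaussian h f p)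
    (integrable_wigner_mul_gaussian h f' p)]
  exact integral_congr_ae (ae_of_all _ fun w => by simp only [wigner_add_right]; ring)

/-- The form `(h, f) ↦ ⟨σ, W(h, f)⟩` is bounded on `L²` by a multiple of the integral of the
grand symbol. -/
theorem lintegral_gaussSTFT_mul_funSTFT_le {K₁ K₂ : ℝ≥0} {σ : 𝓢'(Phase d, ℂ)}
    (h₁ : ∀ h f : L2 d,
      ∫⁻ p : Phase d × Phase d, ‖gaussSTFT σ p.1 p.2 * conj (funSTFT (wigner h f) p)‖ₑ ≤
        K₁ * ∫⁻ ζ : Phase d, grandSymbol σ ζ *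
          ∫⁻ z : Phase d, ‖stft (thetaLp d) h z‖ₑ * ‖stft (thetaLp d) f (z - ζ)‖ₑ)
    (h₂ : ∀ h : L2 d, ∫⁻ z, ‖stft (thetaLp d) h z‖ₑ ^ 2 ≤ K₂ * ‖h‖ₑ ^ 2) (h f : L2 d) :
    ∫⁻ p : Phase d × Phase d, ‖gaussSTFT σ p.1 p.2 * conj (funSTFT (wigner h f) p)‖ₑ ≤
      K₁ * K₂ * (∫⁻ ζ, grandSymbol σ ζ) * ‖h‖ₑ * ‖f‖ₑ := by
  refine (h₁ h f).trans ?_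
  calc _ ≤ K₁ * ∫⁻ ζ : Phase d, grandSymbol σ ζ * (K₂ * ‖h‖ₑ * ‖f‖ₑ) := by
        gcongr with ζ
        exact lintegral_stft_mul_stft_le h₂ h f ζ
    _ = _ := by
        rw [lintegral_mul_const' _ _ (ENNReal.mul_ne_top (ENNReal.mul_ne_top ENNReal.coe_ne_top
          enorm_ne_top) enorm_ne_top)]
        ring

/-- The bound makes the form absolutely convergent, hence additive in each argument, and bounded;
Riesz representation gives T. -/
theorem exists_weylOperator {K : ℝ≥0∞} {σ : 𝓢'(Phase d, ℂ)} (hK : K ≠ ⊤)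
    (h₁ : ∀ h f : L2 d,
      ∫⁻ p : Phase d × Phase d, ‖gaussSTFT σ p.1 p.2 * conj (funSTFT (wigner h f) p)‖ₑ ≤
        K * ‖h‖ₑ * ‖f‖ₑ) :
    ∃ T : L2 d →L[ℂ] L2 d, ∀ h f : L2 d, inner ℂ h (T f) = dualBracket σ (wigner h f) := by
  have hint : ∀ h f : L2 d, Integrable fun p : Phase d × Phase d =>
      gaussSTFT σ p.1 p.2 * conj (funSTFT (wigner h f) p) := fun h f =>
    ⟨((continuous_gaussSTFT σ).measurable.mul (Complex.continuous_conj.measurable.comp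
      (measurable_funSTFT (stronglyMeasurable_wigner h f)))).aestronglyMeasurable,
      (h₁ h f).trans_lt (ENNReal.mul_lt_top (ENNReal.mul_lt_top hK.lt_top enorm_lt_top)
        enorm_lt_top)⟩
  let B : L2 d →ₗ⋆[ℂ] L2 d →ₗ[ℂ] ℂ := LinearMap.mk₂'ₛₗ (starRingEnd ℂ) (RingHom.id ℂ)
    (fun h f => dualBracket σ (wigner h f))
    (fun h h' f => by
      simp only [dualBracket_eq, funSTFT_wigner_add_left, map_add, mul_add]
      exact integral_add (hint h f) (hint h' f))
    (fun c h f => by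
      rw [show wigner (c • h : L2 d) f = fun w => c * wigner h f w from
        funext fun w => wigner_smul_left c h f w, dualBracket_const_mul, smul_eq_mul])
    (fun h f f' => by
      simp only [dualBracket_eq, funSTFT_wigner_add_right, map_add, mul_add]
      exact integral_add (hint h f) (hint h f'))
    (fun c h f => by
      rw [show wigner h (c • f : L2 d) = fun w => conj c * wigner h f w from
        funext fun w => wigner_smul_right c h f w, dualBracket_const_mul, smul_eq_mul,
        Complex.conj_conj, RingHom.id_apply])
  have hB : ∀ h f : L2 d, ‖B h f‖ ≤ K.toReal * ‖h‖ * ‖f‖ := by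
    intro h f
    have h2 : ‖B h f‖ₑ ≤ K * ‖h‖ₑ * ‖f‖ₑ := (enorm_integral_le_lintegral_enorm _).trans (h₁ h f)
    have h3 := ENNReal.toReal_mono (ENNReal.mul_ne_top (ENNReal.mul_ne_top hK enorm_ne_top)
      enorm_ne_top) h2
    simpa [ENNReal.toReal_mul] using h3
  let B' : L2 d →L⋆[ℂ] L2 d →L[ℂ] ℂ := B.mkContinuous₂ K.toReal hB
  -- The Riesz operator of B satisfies ⟨B♯h, f⟩ = B(h, f), so the operator sought is its adjoint.
  refine ⟨ContinuousLinearMap.adjoint (InnerProductSpace.continuousLinearMapOfBilin B'),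
    fun h f => ?_⟩
  rw [ContinuousLinearMap.adjoint_inner_right, InnerProductSpace.continuousLinearMapOfBilin_apply]
  rfl

/-- T was built from the M^∞–M¹ duality; here the latter is identified with the distributional
bracket. -/
theorem isWeylTransform_of_inner_eq {σ : 𝓢'(Phase d, ℂ)} {T : L2 d →L[ℂ] L2 d}
    (hT : ∀ h f : L2 d, inner ℂ h (T f) = dualBracket σ (wigner h f)) : IsWeylTransform σ T := by
  intro f h
  rw [hT, bracket_eq_dualBracket, wigner_congr (SchwartzMap.coeFn_toLp h 2 volume)
    (SchwartzMap.coeFn_toLp f 2 volume)]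
  rfl

theorem inner_atom_apply_atom {σ : 𝓢'(Phase d, ℂ)} {T : L2 d →L[ℂ] L2 d}
    (hT : ∀ h f : L2 d, inner ℂ h (T f) = dualBracket σ (wigner h f)) (g : L2 d) (l m : Phase d) :
    inner ℂ (atom g l) (T (atom g m)) = dualBracket σ (wigner (tfShift l g) (tfShift m g)) := by
  rw [hT, wigner_congr (atom_ae g l) (atom_ae g m)]

/-- The matrix entry `|⟨σ^w π(z - ζ/2) g, π(z + ζ/2) g⟩|`. -/
def entryAt (g : L2 d) (T : L2 d →L[ℂ] L2 d) (z ζ : Phase d) : ℝ≥0∞ :=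
  ‖(inner ℂ (atom g (z + (1 / 2 : ℝ) • ζ)) (T (atom g (z - (1 / 2 : ℝ) • ζ))) : ℂ)‖ₑ

theorem continuous_entryAt (g : L2 d) (T : L2 d →L[ℂ] L2 d) :
    Continuous fun p : Phase d × Phase d => entryAt g T p.1 p.2 := by
  have h1 : Continuous fun p : Phase d × Phase d => atom g (p.1 + (1 / 2 : ℝ) • p.2) :=
    (continuous_atom g).comp (by fun_prop)
  have h2 : Continuous fun p : Phase d × Phase d => T (atom g (p.1 - (1 / 2 : ℝ) • p.2)) :=
    T.continuous.comp ((continuous_atom g).comp (by fun_prop))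
  exact (h1.inner h2).enorm

/-- Covariance with l, m = z ± ζ/2: midpoint z and difference ζ, so W(π(l)g, π(m)g) is a unimodular
multiple of the phase-space shift of W(g, g) by (z, j ζ). -/
theorem enorm_windowSTFT_wigner {σ : 𝓢'(Phase d, ℂ)} {T : L2 d →L[ℂ] L2 d}
    (hT : ∀ h f : L2 d, inner ℂ h (T f) = dualBracket σ (wigner h f)) (g : L2 d)
    (z ζ : Phase d) : ‖windowSTFT (wigner g g) σ z (rot ζ)‖ₑ = entryAt g T z ζ := by
  rw [entryAt, inner_atom_apply_atom hT]
  set l := z + (1 / 2 : ℝ) • ζ with hl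
  set m := z - (1 / 2 : ℝ) • ζ with hm
  have e1 : (1 / 2 : ℝ) • (l + m) = z := by rw [hl, hm]; module
  have e2 : l - m = ζ := by rw [hl, hm]; module
  have h := funext (wigner_tfShift (g : Eu d → ℂ) l m)
  rw [e1, e2] at h
  rw [h, dualBracket_const_mul, enorm_mul, RCLike.enorm_conj, windowSTFT,
    ← ofReal_norm (chi _ _), norm_chi, ENNReal.ofReal_one, one_mul]

theorem grandSymbol_wigner_eq {σ : 𝓢'(Phase d, ℂ)} {T : L2 d →L[ℂ] L2 d}
    (hT : ∀ h f : L2 d, inner ℂ h (T f) = dualBracket σ (wigner h f)) (g : L2 d) (ζ : Phase d) :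
    essSup (fun z => ‖windowSTFT (wigner g g) σ z (rot ζ)‖ₑ) volume = ⨆ z, entryAt g T z ζ := by
  simp only [enorm_windowSTFT_wigner hT]
  exact essSup_eq_iSup_of_lowerSemicontinuous ((continuous_entryAt g T).comp
    (continuous_id.prodMk continuous_const)).lowerSemicontinuous

variable {Λ : Submodule ℤ (Phase d)} {C : Set (Phase d)} {g : L2 d}

theorem sjostrandNormWigner_eq {σ : 𝓢'(Phase d, ℂ)} {T : L2 d →L[ℂ] L2 d}
    (hT : ∀ h f : L2 d, inner ℂ h (T f) = dualBracket σ (wigner h f)) (𝒜 : SolidBanachSpace Λ)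
    (C : Set (Phase d)) (g : L2 d) :
    sjostrandNormWigner 𝒜 C g σ = amalgamNorm 𝒜 C fun ζ => ⨆ z, entryAt g T z ζ := by
  rw [sjostrandNormWigner, grandNorm]
  simp only [grandSymbol_wigner_eq hT]

theorem matrixNorm_le_sjostrandNormWigner (hC : IsFundamentalCell Λ C) {σ : 𝓢'(Phase d, ℂ)}
    {T : L2 d →L[ℂ] L2 d} (hT : ∀ h f : L2 d, inner ℂ h (T f) = dualBracket σ (wigner h f))
    (𝒜 : SolidBanachSpace Λ) (g : L2 d) :
    𝒜.matrixNorm (gaborMatrix Λ g σ) ≤ sjostrandNormWigner 𝒜 C g σ := by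
  rw [sjostrandNormWigner_eq hT, amalgamNorm_eq]
  refine SolidBanachSpace.extNorm_mono fun m => ?_
  have hlsc : LowerSemicontinuous fun ζ : Phase d => ⨆ z, entryAt g T z ζ :=
    lowerSemicontinuous_iSup fun z => ((continuous_entryAt g T).comp
      (continuous_const.prodMk continuous_id)).lowerSemicontinuous
  refine le_trans (iSup_le fun l => ?_) (le_cellSup_of_lowerSemicontinuous hC hlsc m)
  -- With z = l - m/2 and ζ = m the points z ± ζ/2 are l and l - m, so the (l, l - m) entry is a
  -- value of `entryAt`. The midpoint z need not lie in Λ, which is harmless in a supremum over all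
  -- z.
  refine le_iSup_of_le ((l : Phase d) - (1 / 2 : ℝ) • (m : Phase d)) (le_of_eq ?_)
  rw [entryAt, gaborMatrix, ← inner_atom_apply_atom hT]
  congr 4
  · module
  · rw [AddSubgroupClass.coe_sub]; module

/-- The autocorrelation bound for the matrix entries. -/
theorem entryAt_le {K : ℝ≥0} {σ : 𝓢'(Phase d, ℂ)}
    (h₁ : ∀ h f : L2 d,
      ∫⁻ p : Phase d × Phase d, ‖gaussSTFT σ p.1 p.2 * conj (funSTFT (wigner h f) p)‖ₑ ≤
        K * ∫⁻ ζ : Phase d, grandSymbol σ ζ *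
          ∫⁻ z : Phase d, ‖stft (thetaLp d) h z‖ₑ * ‖stft (thetaLp d) f (z - ζ)‖ₑ)
    {T : L2 d →L[ℂ] L2 d} (hT : ∀ h f : L2 d, inner ℂ h (T f) = dualBracket σ (wigner h f))
    (g : L2 d) (z ζ : Phase d) : entryAt g T z ζ ≤ K * lconv (grandSymbol σ)
      (lconv (fun z => ‖stft (thetaLp d) g (-z)‖ₑ) fun z => ‖stft (thetaLp d) g z‖ₑ) ζ := by
  rw [entryAt, hT]
  refine (enorm_integral_le_lintegral_enorm _).trans ((h₁ _ _).trans (le_of_eq ?_))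
  rw [lconv]
  congr 1
  refine lintegral_congr fun y => ?_
  congr 1
  -- The reflection x ↦ z + ζ/2 - x turns the correlation of the two shifted transforms into a
  -- convolution and eliminates z; hence the bound is uniform in z.
  rw [lconv, ← lintegral_sub_left_eq_self _ (z + (1 / 2 : ℝ) • ζ)]
  refine lintegral_congr fun x => ?_
  rw [← ofReal_norm (stft _ (atom _ _) _), ← ofReal_norm (stft _ (atom _ _) _), norm_stft_atom,
    norm_stft_atom, ofReal_norm, ofReal_norm]
  congr 3
  · module
  · module

/-- Stability of W(𝒜) under reflection and convolution, applied to `entryAt_le`. The constant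
contains the norm of the autocorrelation of |V_θ g| and so depends on g but not on σ. -/
theorem exists_sjostrandNormWigner_le [DiscreteTopology Λ] [Countable Λ]
    (hC : IsFundamentalCell Λ C) {𝒜 : SolidBanachSpace Λ} (h𝒜 : 𝒜.IsInvolutiveConvAlgebra)
    (hN : amalgamNorm 𝒜 C (fun z => ‖stft (thetaLp d) g z‖ₑ) < ⊤) (K : ℝ≥0) :
    ∃ C₀ : ℝ≥0, ∀ (σ : 𝓢'(Phase d, ℂ)) (T : L2 d →L[ℂ] L2 d), sjostrandNorm 𝒜 C σ < ⊤ →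
      (∀ h f : L2 d,
        ∫⁻ p : Phase d × Phase d, ‖gaussSTFT σ p.1 p.2 * conj (funSTFT (wigner h f) p)‖ₑ ≤
          K * ∫⁻ ζ : Phase d, grandSymbol σ ζ *
            ∫⁻ z : Phase d, ‖stft (thetaLp d) h z‖ₑ * ‖stft (thetaLp d) f (z - ζ)‖ₑ) →
      (∀ h f : L2 d, inner ℂ h (T f) = dualBracket σ (wigner h f)) →
      sjostrandNormWigner 𝒜 C g σ ≤ C₀ * sjostrandNorm 𝒜 C σ := by
  obtain ⟨L, hL⟩ := exists_amalgamNorm_lconv_le hC h𝒜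
  obtain ⟨R, hR⟩ := exists_amalgamNorm_comp_neg_le hC h𝒜
  set k : Phase d → ℝ≥0∞ := fun z => ‖stft (thetaLp d) g z‖ₑ with hk
  have hkn : amalgamNorm 𝒜 C (fun z => k (-z)) < ⊤ :=
    (hR k hN).trans_lt (ENNReal.mul_lt_top ENNReal.coe_lt_top hN)
  have hρ : amalgamNorm 𝒜 C (lconv (fun z => k (-z)) k) < ⊤ := (hL _ _ hkn hN).trans_lt
    (ENNReal.mul_lt_top (ENNReal.mul_lt_top ENNReal.coe_lt_top hkn) hN)
  refine ⟨K * (L * (amalgamNorm 𝒜 C (lconv (fun z => k (-z)) k)).toNNReal), fun σ T hσ h₁ hT => ?_⟩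
  rw [sjostrandNormWigner_eq hT, ENNReal.coe_mul, ENNReal.coe_mul, ENNReal.coe_toNNReal hρ.ne]
  calc _ ≤ amalgamNorm 𝒜 C fun ζ => K * lconv (grandSymbol σ) (lconv (fun z => k (-z)) k) ζ :=
        amalgamNorm_mono fun ζ => iSup_le fun z => entryAt_le h₁ hT g z ζ
    _ ≤ K * amalgamNorm 𝒜 C (lconv (grandSymbol σ) (lconv (fun z => k (-z)) k)) :=
        amalgamNorm_const_mul_le _ _
    _ ≤ K * (L * sjostrandNorm 𝒜 C σ * amalgamNorm 𝒜 C (lconv (fun z => k (-z)) k)) := by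
        gcongr
        exact hL _ _ hσ hρ
    _ = _ := by ring

/-! ### Matrix estimates -/

theorem IsTightGaborFrame.hasSum_matrix (hframe : IsTightGaborFrame Λ g) (T : L2 d →L[ℂ] L2 d)
    (f : L2 d) (z : Phase d) :
    HasSum (fun m : Λ => inner ℂ (atom g z) (T (atom g m)) * stft g f m) (stft g (T f) z) := by
  have h := hframe.hasSum_inner (ContinuousLinearMap.adjoint T (atom g z)) f
  simpa only [ContinuousLinearMap.adjoint_inner_left, stft] using h

/-- In frame coefficients T is the matrix M, and each entry satisfies |M l m| ≤ d_M(l - m). -/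
theorem IsTightGaborFrame.enorm_stft_apply_le (hframe : IsTightGaborFrame Λ g)
    {T : L2 d →L[ℂ] L2 d} {M : Matrix Λ Λ ℂ}
    (hM : ∀ l m : Λ, inner ℂ (atom g l) (T (atom g m)) = M l m) (f : L2 d) (l : Λ) :
    ‖stft g (T f) l‖ₑ ≤ ∑' m : Λ, ‖stft g f m‖ₑ * ⨆ k, ‖M k (k - (l - m))‖ₑ := by
  refine (enorm_le_tsum_enorm (hframe.hasSum_matrix T f l)).trans
    (ENNReal.tsum_le_tsum fun m => ?_)
  rw [enorm_mul, mul_comm, hM]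
  gcongr
  refine le_iSup_of_le l ?_
  rw [sub_sub_cancel]

/-- Schur's test on ℓ²: convolution with d_M has norm at most ‖d_M‖₁ ≤ ‖d_M‖_𝒜. Tightness with
constant 1 transfers the bound to L² without loss. -/
theorem enorm_le_matrixNorm {𝒜 : SolidBanachSpace Λ} (h𝒜 : 𝒜.IsInvolutiveConvAlgebra)
    (hframe : IsTightGaborFrame Λ g) {T : L2 d →L[ℂ] L2 d} {M : Matrix Λ Λ ℂ}
    (hM : ∀ l m : Λ, inner ℂ (atom g l) (T (atom g m)) = M l m) :
    ‖T‖ₑ ≤ 𝒜.matrixNorm M := by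
  set D : Λ → ℝ≥0∞ := fun m => ⨆ k, ‖M k (k - m)‖ₑ with hD
  refine le_trans ?_ (SolidBanachSpace.tsum_le_extNorm h𝒜 D)
  rcases eq_or_ne (∑' m, D m) ⊤ with htop | htop
  · rw [htop]; exact le_top
  have key : ∀ f, ‖T f‖ₑ ≤ (∑' m, D m) * ‖f‖ₑ := by
    intro f
    rw [← ENNReal.pow_le_pow_left_iff two_ne_zero, mul_pow, ← hframe.tsum_enorm_sq,
      ← hframe.tsum_enorm_sq]
    calc ∑' l : Λ, ‖stft g (T f) l‖ₑ ^ 2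
        ≤ ∑' l : Λ, (∑' m : Λ, ‖stft g f m‖ₑ ^ 2 * D (l - m)) * ∑' m, D m := by
          refine ENNReal.tsum_le_tsum fun l => ?_
          calc _ ≤ (∑' m : Λ, ‖stft g f m‖ₑ * D (l - m)) ^ 2 := by
                gcongr; exact hframe.enorm_stft_apply_le hM f l
            _ ≤ (∑' m : Λ, ‖stft g f m‖ₑ ^ 2 * D (l - m)) * ∑' m, D (l - m) := sq_tsum_mul_le _ _
            _ = _ := by
                have : ∑' m, D (l - m) = ∑' m, D m := (Equiv.subLeft l).tsum_eq D
                rw [this]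
      _ = (∑' m : Λ, ‖stft g f m‖ₑ ^ 2 * ∑' l, D (l - m)) * ∑' m, D m := by
          rw [ENNReal.tsum_mul_right, ENNReal.tsum_comm]
          simp only [ENNReal.tsum_mul_left]
      _ = (∑' m, D m) ^ 2 * ∑' l : Λ, ‖stft g f l‖ₑ ^ 2 := by
          have : ∀ m : Λ, ∑' l, D (l - m) = ∑' l, D l := fun m => (Equiv.subRight m).tsum_eq D
          simp only [this, ENNReal.tsum_mul_right]
          ring
  rw [← ENNReal.ofReal_toReal htop, ← ofReal_norm]
  refine ENNReal.ofReal_le_ofReal (T.opNorm_le_bound ENNReal.toReal_nonneg fun f => ?_)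
  have h3 := ENNReal.toReal_mono (ENNReal.mul_ne_top htop enorm_ne_top) (key f)
  simpa [ENNReal.toReal_mul] using h3

end WeylOperator

end WeylGabor

end

noncomputable section

namespace WeylGabor

/-! ### Operators on modulation spaces -/

section Modulation

open SolidBanachSpace

/-- Domination by a convolution gives membership in 𝒴 by solidity. It is applied with D = d_M for
the operator and D = |V_g g| on Λ for the Gram matrix. -/
theorem exists_mem_nrm_le {ι : Type*} [AddCommGroup ι] {𝒜 𝒴 : SolidBanachSpace ι} {K : ℝ≥0}
    (hact : ConvActs K 𝒜 𝒴) {D : ι → ℝ≥0∞} (hD : 𝒜.extNorm D < ⊤) (c : 𝒴.carrier) (s : ι → ℂ)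
    (hs : ∀ l, ‖s l‖ₑ ≤ ∑' m, ‖(c : ι → ℂ) m‖ₑ * D (l - m)) :
    ∃ h : s ∈ 𝒴.carrier, 𝒴.nrm ⟨s, h⟩ ≤ K * (𝒜.extNorm D).toReal * 𝒴.nrm c := by
  have hc : 𝒴.extNorm (fun i => ‖(c : ι → ℂ) i‖ₑ) < ⊤ := by
    rw [extNorm_enorm]; exact ENNReal.ofReal_lt_top
  have h1 : 𝒴.extNorm (fun i => ‖s i‖ₑ) ≤ K * 𝒜.extNorm D * ENNReal.ofReal (𝒴.nrm c) := by
    rw [← extNorm_enorm]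
    refine le_trans (extNorm_mono hs) ?_
    have h2 := extNorm_econv_le hact hD hc
    rwa [econv_comm] at h2
  have hfin : K * 𝒜.extNorm D * ENNReal.ofReal (𝒴.nrm c) < ⊤ :=
    ENNReal.mul_lt_top (ENNReal.mul_lt_top ENNReal.coe_lt_top hD) ENNReal.ofReal_lt_top
  have hmem := mem_of_extNorm_lt_top (h1.trans_lt hfin)
  refine ⟨hmem, ?_⟩
  rw [← ofReal_nrm hmem] at h1
  have h3 := ENNReal.toReal_mono hfin.ne h1
  simpa [ENNReal.toReal_mul, ENNReal.toReal_ofReal (apply_nonneg 𝒴.nrm _)] using h3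

variable {d : ℕ} {Λ : Submodule ℤ (Phase d)} {g : L2 d} {𝒜 𝒴 : SolidBanachSpace Λ} {K : ℝ≥0}

theorem analysis_apply (f : L2 d) (l : Λ) : analysis Λ g f l = stft g f l := rfl

/-- The Gram matrix of the Gabor system is dominated by a convolution. -/
theorem enorm_inner_atom_atom (l m : Λ) :
    ‖(inner ℂ (atom g l) (atom g m) : ℂ)‖ₑ = ‖stft g g ((l - m : Λ) : Phase d)‖ₑ := by
  rw [← ofReal_norm, norm_inner_atom_atom, ofReal_norm, AddSubgroupClass.coe_sub]

/-- The coefficients of π(m)g are dominated by δ_m convolved with |V_g g| on Λ. -/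
theorem gaborSpan_le_comap (hfin : ∀ c : Λ → ℂ, c.support.Finite → c ∈ 𝒴.carrier)
    (hact : ConvActs K 𝒜 𝒴) (hV : 𝒜.extNorm (fun l : Λ => ‖stft g g l‖ₑ) < ⊤) :
    gaborSpan Λ g ≤ 𝒴.carrier.comap (analysis Λ g) := by
  classical
  refine Submodule.span_le.2 ?_
  rintro _ ⟨m, rfl⟩
  have hm : (Pi.single m 1 : Λ → ℂ) ∈ 𝒴.carrier :=
    hfin _ ((Set.finite_singleton m).subset (Pi.support_single_subset))
  refine (exists_mem_nrm_le hact hV ⟨_, hm⟩ (analysis Λ g (atom g m)) fun l => ?_).1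
  refine le_trans (le_of_eq ?_) (ENNReal.le_tsum m)
  have hs : ((⟨Pi.single m 1, hm⟩ : 𝒴.carrier) : Λ → ℂ) m = 1 := Pi.single_eq_same m 1
  rw [hs, enorm_one, one_mul]
  exact enorm_inner_atom_atom l m

/-- The element `∑ b(l) π(l) g` of `ℒ₀` for a finitely supported sequence `b`. -/
theorem exists_synthesis (b : Λ → ℂ) (hb : b.support.Finite) : ∃ u ∈ gaborSpan Λ g, ∀ l : Λ,
    HasSum (fun m : Λ => inner ℂ (atom g l) (atom g m) * b m) (analysis Λ g u l) := by
  refine ⟨∑ m ∈ hb.toFinset, b m • atom g m, Submodule.sum_mem _ fun m _ =>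
    Submodule.smul_mem _ _ (Submodule.subset_span ⟨m, rfl⟩), fun l => ?_⟩
  have h1 : analysis Λ g (∑ m ∈ hb.toFinset, b m • atom g m) l =
      ∑ m ∈ hb.toFinset, inner ℂ (atom g l) (atom g m) * b m := by
    rw [analysis_apply, stft, inner_sum]
    exact Finset.sum_congr rfl fun m _ => by rw [inner_smul_right, mul_comm]
  rw [h1]
  refine hasSum_sum_of_ne_finset_zero fun m hm => ?_
  have : b m = 0 := by simpa using hm
  rw [this, mul_zero]

/-- An element of `ℒ₀` with coefficients in `𝒴`, as an element of the pre-modulation space. -/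
def PreModulationSpace.mk (u : L2 d) (hu : u ∈ gaborSpan Λ g)
    (h : analysis Λ g u ∈ 𝒴.carrier) : PreModulationSpace 𝒴 g :=
  (⟨u, hu, h⟩ : ↥(finiteNormSpan 𝒴 g))

theorem norm_sub_preModulationSpace (u v : PreModulationSpace 𝒴 g) :
    ‖u - v‖ = 𝒴.nrm (u.coeff - v.coeff) := by
  rw [PreModulationSpace.norm_def, map_sub]

/-- Approximate the coefficients c of f by finitely supported b and synthesize u = ∑ b(m) π(m)g ∈
ℒ₀. As c is reproduced by the Gram matrix, the coefficients of f - u are the Gram matrix applied to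
c - b, hence small in 𝒴. -/
theorem exists_represents [DiscreteTopology Λ] (hframe : IsTightGaborFrame Λ g)
    (hfsd : 𝒴.FinitelySupportedDense) (hact : ConvActs K 𝒜 𝒴)
    (hV : 𝒜.extNorm (fun l : Λ => ‖stft g g l‖ₑ) < ⊤) (f : L2 d)
    (hf : analysis Λ g f ∈ 𝒴.carrier) : ∃ m : ModulationSpace 𝒴 g, Represents f m := by
  set c : 𝒴.carrier := ⟨analysis Λ g f, hf⟩ with hc
  have happrox : ∀ n : ℕ, ∃ b : 𝒴.carrier, (b : Λ → ℂ).support.Finite ∧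
      𝒴.nrm (c - b) < 1 / ((n : ℝ) + 1) := fun n => hfsd.dense c _ (by positivity)
  choose b hbf hbn using happrox
  choose u hu hsum using fun n => exists_synthesis (g := g) (b n : Λ → ℂ) (hbf n)
  have hum : ∀ n, analysis Λ g (u n) ∈ 𝒴.carrier := fun n =>
    gaborSpan_le_comap hfsd.mem hact hV (hu n)
  set B : ℝ := K * (𝒜.extNorm (fun l : Λ => ‖stft g g l‖ₑ)).toReal with hB
  have hbound : ∀ n, 𝒴.nrm (⟨analysis Λ g (u n), hum n⟩ - c) ≤ B * 𝒴.nrm (c - b n) := by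
    intro n
    have hdiff : ∀ l : Λ, ‖(analysis Λ g f - analysis Λ g (u n)) l‖ₑ ≤
        ∑' m : Λ, ‖((c - b n : 𝒴.carrier) : Λ → ℂ) m‖ₑ * ‖stft g g ((l - m : Λ) : Phase d)‖ₑ := by
      intro l
      have h1 := (hframe.hasSum_inner (atom g l) f).sub (hsum n l)
      refine (enorm_le_tsum_enorm h1).trans (ENNReal.tsum_le_tsum fun m => ?_)
      rw [← mul_sub, enorm_mul, enorm_inner_atom_atom, mul_comm]
      rfl
    obtain ⟨h2, h3⟩ := exists_mem_nrm_le hact hV (c - b n) _ hdiff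
    rw [← map_neg_eq_map, neg_sub]
    exact h3
  let v : ℕ → PreModulationSpace 𝒴 g := fun n => PreModulationSpace.mk (u n) (hu n) (hum n)
  have hlim : Tendsto (fun n => 𝒴.nrm ((v n).coeff - c)) atTop (𝓝 0) := by
    have h0 : Tendsto (fun n : ℕ => B * (1 / ((n : ℝ) + 1))) atTop (𝓝 0) := by
      simpa only [mul_zero] using (tendsto_one_div_add_atTop_nhds_zero_nat (𝕜 := ℝ)).const_mul B
    refine squeeze_zero (fun n => apply_nonneg _ _) (fun n => (hbound n).trans ?_) h0
    exact mul_le_mul_of_nonneg_left (hbn n).le (by positivity)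
  have hcauchy : CauchySeq v := by
    rw [Metric.cauchySeq_iff']
    intro ε hε
    obtain ⟨N, hN⟩ := eventually_atTop.1 (hlim.eventually (gt_mem_nhds (half_pos hε)))
    refine ⟨N, fun n hn => ?_⟩
    rw [dist_eq_norm, norm_sub_preModulationSpace,
      ← sub_sub_sub_cancel_right _ _ c]
    calc _ ≤ 𝒴.nrm ((v n).coeff - c) + 𝒴.nrm ((v N).coeff - c) := map_sub_le_add _ _ _
      _ < ε / 2 + ε / 2 := add_lt_add (hN n hn) (hN N le_rfl)
      _ = ε := add_halves ε
  have hcauchy' : CauchySeq fun n => (v n : ModulationSpace 𝒴 g) :=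
    (UniformSpace.Completion.uniformContinuous_coe _).comp_cauchySeq hcauchy
  obtain ⟨m, hm⟩ := cauchySeq_tendsto_of_complete hcauchy'
  exact ⟨m, v, hf, hm, hlim⟩

theorem Represents.norm_eq {f : L2 d} {m : ModulationSpace 𝒴 g} (h : Represents f m)
    (hf : analysis Λ g f ∈ 𝒴.carrier) : ‖m‖ = 𝒴.nrm ⟨analysis Λ g f, hf⟩ := by
  obtain ⟨u, hf', hu, hc⟩ := h
  have h1 : Tendsto (fun n => ‖u n‖) atTop (𝓝 ‖m‖) := by
    simpa only [UniformSpace.Completion.norm_coe] using hu.norm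
  refine tendsto_nhds_unique h1 ?_
  rw [tendsto_iff_norm_sub_tendsto_zero]
  refine squeeze_zero (fun _ => norm_nonneg _) (fun n => ?_) hc
  rw [PreModulationSpace.norm_def]
  exact abs_sub_map_le_sub 𝒴.nrm _ _

theorem Represents.add {f f' : L2 d} {m m' : ModulationSpace 𝒴 g} (h : Represents f m)
    (h' : Represents f' m') : Represents (f + f') (m + m') := by
  obtain ⟨u, hf, hu, hc⟩ := h
  obtain ⟨u', hf', hu', hc'⟩ := h'
  have hmem : analysis Λ g (f + f') ∈ 𝒴.carrier := by
    rw [map_add]; exact 𝒴.carrier.add_mem hf hf'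
  refine ⟨fun n => u n + u' n, hmem, ?_, ?_⟩
  · simpa only [UniformSpace.Completion.coe_add] using hu.add hu'
  · refine squeeze_zero (fun n => apply_nonneg _ _) (fun n => ?_) (by simpa using hc.add hc')
    have e : (⟨analysis Λ g (f + f'), hmem⟩ : 𝒴.carrier) =
        ⟨analysis Λ g f, hf⟩ + ⟨analysis Λ g f', hf'⟩ := Subtype.ext (map_add _ _ _)
    rw [e, map_add, add_sub_add_comm]
    exact map_add_le_add _ _ _

theorem Represents.smul {f : L2 d} {m : ModulationSpace 𝒴 g} (h : Represents f m) (a : ℂ) :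
    Represents (a • f) (a • m) := by
  obtain ⟨u, hf, hu, hc⟩ := h
  have hmem : analysis Λ g (a • f) ∈ 𝒴.carrier := by
    rw [map_smul]; exact 𝒴.carrier.smul_mem a hf
  refine ⟨fun n => a • u n, hmem, ?_, ?_⟩
  · simpa only [UniformSpace.Completion.coe_smul] using hu.const_smul a
  · have e : (⟨analysis Λ g (a • f), hmem⟩ : 𝒴.carrier) = a • ⟨analysis Λ g f, hf⟩ :=
      Subtype.ext (map_smul _ _ _)
    have e2 : ∀ n, 𝒴.nrm ((a • u n).coeff - ⟨analysis Λ g (a • f), hmem⟩) =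
        ‖a‖ * 𝒴.nrm ((u n).coeff - ⟨analysis Λ g f, hf⟩) := fun n => by
      have e3 : (a • u n).coeff - ⟨analysis Λ g (a • f), hmem⟩ =
          a • ((u n).coeff - ⟨analysis Λ g f, hf⟩) := by
        rw [e, map_smul]; exact (smul_sub _ _ _).symm
      rw [e3, map_smul_eq_mul]
    simp only [e2]
    simpa using hc.const_mul ‖a‖

/-- The difference represents 0, so it has norm 0 by `Represents.norm_eq`. Uniqueness is what makes
the choice of representatives linear. -/
theorem Represents.unique {f : L2 d} {m m' : ModulationSpace 𝒴 g} (h : Represents f m)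
    (h' : Represents f m') : m = m' := by
  have h1 := h.add (h'.smul (-1))
  have h2 : f + (-1 : ℂ) • f = 0 := by module
  rw [h2] at h1
  have hmem : analysis Λ g (0 : L2 d) ∈ 𝒴.carrier := by rw [map_zero]; exact zero_mem _
  have h3 := h1.norm_eq hmem
  have e : (⟨analysis Λ g (0 : L2 d), hmem⟩ : 𝒴.carrier) = 0 := Subtype.ext (map_zero _)
  rw [e, map_zero, norm_eq_zero, neg_one_smul, ← sub_eq_add_neg, sub_eq_zero] at h3
  exact h3

/-- On ℒ₀ the operator sends f to the element represented by T f; the norm identity for represented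
elements gives the bound with constant K‖M‖, and density extends it to the completion. -/
theorem exists_modulationSpace_operator [DiscreteTopology Λ] (hframe : IsTightGaborFrame Λ g)
    (hfsd : 𝒴.FinitelySupportedDense) (hact : ConvActs K 𝒜 𝒴)
    (hV : 𝒜.extNorm (fun l : Λ => ‖stft g g l‖ₑ) < ⊤) {T : L2 d →L[ℂ] L2 d} {M : Matrix Λ Λ ℂ}
    (hM : ∀ l m : Λ, inner ℂ (atom g l) (T (atom g m)) = M l m) (hfin : 𝒜.matrixNorm M < ⊤) :
    ∃ S : ModulationSpace 𝒴 g →L[ℂ] ModulationSpace 𝒴 g,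
      (∀ f : PreModulationSpace 𝒴 g, Represents (T f.toL2) (S f)) ∧
        ‖S‖ₑ ≤ K * 𝒜.matrixNorm M := by
  set B : ℝ := K * (𝒜.matrixNorm M).toReal with hB
  have hB0 : 0 ≤ B := by positivity
  have hT : ∀ f : PreModulationSpace 𝒴 g, ∃ h : analysis Λ g (T f.toL2) ∈ 𝒴.carrier,
      𝒴.nrm ⟨_, h⟩ ≤ B * ‖f‖ := fun f =>
    exists_mem_nrm_le hact hfin f.coeff _ fun l => hframe.enorm_stft_apply_le hM f.toL2 l
  choose hmem hnorm using hT
  choose S₀ hS₀ using fun f => exists_represents hframe hfsd hact hV _ (hmem f)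
  let S₁ : PreModulationSpace 𝒴 g →ₗ[ℂ] ModulationSpace 𝒴 g :=
    { toFun := S₀
      map_add' := fun f f' => (hS₀ (f + f')).unique (by
        rw [map_add, map_add]; exact (hS₀ f).add (hS₀ f'))
      map_smul' := fun a f => (hS₀ (a • f)).unique (by
        rw [map_smul, map_smul]; exact (hS₀ f).smul a) }
  have hS₁ : ∀ f, ‖S₁ f‖ ≤ B * ‖f‖ := fun f => by
    rw [show ‖S₁ f‖ = _ from (hS₀ f).norm_eq (hmem f)]; exact hnorm f
  let S₂ : PreModulationSpace 𝒴 g →L[ℂ] ModulationSpace 𝒴 g := S₁.mkContinuous B hS₁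
  let e : PreModulationSpace 𝒴 g →L[ℂ] ModulationSpace 𝒴 g := UniformSpace.Completion.toComplL
  let S : ModulationSpace 𝒴 g →L[ℂ] ModulationSpace 𝒴 g := S₂.extend e
  have hS : ∀ f : PreModulationSpace 𝒴 g, S f = S₀ f := fun f =>
    S₂.extend_eq (e := e) UniformSpace.Completion.denseRange_coe
      (UniformSpace.Completion.isUniformInducing_coe _) f
  refine ⟨S, fun f => by rw [hS]; exact hS₀ f, ?_⟩
  have hle : ‖S‖ ≤ B := by
    refine S.opNorm_le_bound hB0 fun m => ?_
    induction m using UniformSpace.Completion.induction_on with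
    | hp => exact isClosed_le S.continuous.norm (continuous_const.mul continuous_norm)
    | ih f => rw [hS, UniformSpace.Completion.norm_coe]; exact hS₁ f
  rw [← ofReal_norm]
  refine (ENNReal.ofReal_le_ofReal hle).trans (le_of_eq ?_)
  rw [hB, ENNReal.ofReal_mul K.coe_nonneg, ENNReal.ofReal_coe_nnreal, ENNReal.ofReal_toReal hfin.ne]

end Modulation

end WeylGabor

end

/-! ### The main theorem -/

theorem mainTheorem7 {d : ℕ} (Λ : Submodule ℤ (Phase d)) [DiscreteTopology Λ] [IsZLattice ℝ Λ]
    (C : Set (Phase d)) (hC : IsFundamentalCell Λ C)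
    (𝒜 : SolidBanachSpace Λ) (h𝒜 : 𝒜.IsInvolutiveConvAlgebra)
    (g : L2 d) (hframe : IsTightGaborFrame Λ g)
    (hg : amalgamNorm 𝒜 C (fun z => ‖stft g g z‖ₑ) < ⊤) :
    ∃ C₀ : ℝ≥0, ∀ σ : 𝓢'(Phase d, ℂ), sjostrandNorm 𝒜 C σ < ⊤ →
      sjostrandNormWigner 𝒜 C g σ ≤ C₀ * sjostrandNorm 𝒜 C σ ∧
      𝒜.matrixNorm (gaborMatrix Λ g σ) ≤ sjostrandNormWigner 𝒜 C g σ ∧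
      ∃ T : L2 d →L[ℂ] L2 d, IsWeylTransform σ T ∧
        (∀ l m : Λ, inner ℂ (atom g l) (T (atom g m)) = gaborMatrix Λ g σ l m) ∧
        ‖T‖ₑ ≤ 𝒜.matrixNorm (gaborMatrix Λ g σ) ∧
        ∀ (𝒴 : SolidBanachSpace Λ) (K : ℝ≥0), 𝒴.FinitelySupportedDense →
          SolidBanachSpace.ConvActs K 𝒜 𝒴 →
          gaborSpan Λ g ≤ 𝒴.carrier.comap (analysis Λ g) ∧
          ∃ S : ModulationSpace 𝒴 g →L[ℂ] ModulationSpace 𝒴 g,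
            (∀ f : PreModulationSpace 𝒴 g, Represents (T f.toL2) (S f)) ∧
            ‖S‖ₑ ≤ K * 𝒜.matrixNorm (gaborMatrix Λ g σ) := by
  have : Countable Λ := inferInstance
  obtain ⟨K₁, hK₁⟩ := exists_lintegral_gaussSTFT_mul_funSTFT_le d
  obtain ⟨K₂, hK₂⟩ := exists_lintegral_sq_stft_le hC h𝒜 hframe hg
  have hN := amalgamNorm_stft_thetaLp_lt_top hC h𝒜 g hg
  obtain ⟨C₀, hC₀⟩ := exists_sjostrandNormWigner_le hC h𝒜 hN K₁
  -- V_g g is continuous, so its lattice values are below its cell suprema.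
  have hV : 𝒜.extNorm (fun l : Λ => ‖stft g g l‖ₑ) < ⊤ :=
    (SolidBanachSpace.extNorm_mono fun l => le_cellSup_of_lowerSemicontinuous hC
      (continuous_stft g g).enorm.lowerSemicontinuous l).trans_lt hg
  refine ⟨C₀, fun σ hσ => ?_⟩
  -- The embedding 𝒜 ⊂ ℓ¹ makes the grand symbol integrable, which is all that boundedness on L²
  -- requires of σ.
  have hH : ∫⁻ ζ, grandSymbol σ ζ < ⊤ := (lintegral_le_amalgamNorm hC h𝒜 _).trans_lt
    (ENNReal.mul_lt_top (volume_C_lt_top hC) hσ)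
  obtain ⟨T, hT⟩ := exists_weylOperator (K := K₁ * K₂ * ∫⁻ ζ, grandSymbol σ ζ)
    (ENNReal.mul_ne_top (ENNReal.mul_ne_top ENNReal.coe_ne_top ENNReal.coe_ne_top) hH.ne)
    (lintegral_gaussSTFT_mul_funSTFT_le (hK₁ σ) hK₂)
  have h1 := hC₀ σ T hσ (hK₁ σ) hT
  have h2 := matrixNorm_le_sjostrandNormWigner hC hT 𝒜 g
  have hM : ∀ l m : Λ, inner ℂ (atom g l) (T (atom g m)) = gaborMatrix Λ g σ l m :=
    fun l m => inner_atom_apply_atom hT g l m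
  have hfin : 𝒜.matrixNorm (gaborMatrix Λ g σ) < ⊤ :=
    (h2.trans h1).trans_lt (ENNReal.mul_lt_top ENNReal.coe_lt_top hσ)
  exact ⟨h1, h2, T, isWeylTransform_of_inner_eq hT, hM, enorm_le_matrixNorm h𝒜 hframe hM,
    fun 𝒴 K hfsd hact => ⟨gaborSpan_le_comap hfsd.mem hact hV,
      exists_modulationSpace_operator hframe hfsd hact hV hM hfin⟩⟩
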